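/- Let $\mathrm{Set}_f$ be the category of finite sets. Let $\mathbb{P}\mathrm{b}\,\mathrm{Set}_f$ be the double category whose objects are finite sets, whose horizontal arrows and proarrows are mappings, and whose cells are pullback squares; $(-)^{\mathrm{op}}$ is the horizontal opposite (horizontal arrows and cells are reversed, sources and targets of proarrows are kept). Let $\mathbb{C}\mathrm{at}$ be the (pseudo) double category of small categories, functors, profunctors $\Phi:\mathcal A\to\mathcal B$ (functors $\mathcal A^{\mathrm{op}}\times\mathcal B\to\mathrm{Set}$, composed by coends), and natural families of maps $\Phi(X,Y)\to\Psi(FX,GY)$ as cells. A *DF operad on* $\mathrm{Set}_f$ is a lax double functor $M:(\mathbb{P}\mathrm{b}\,\mathrm{Set}_f)^{\mathrm{op}}\to\mathbb{C}\mathrm{at}$ which is normal (vertical identities are strictly preserved) and product-preserving (its horizontal component $M_h$, on objects and horizontal arrows, and its vertical component $M_v$, on proarrows and cells, both preserve finite products). An isomorphism of DF operads is an invertible double natural transformation. An *operad* is a classical coloured operad, i.e. a symmetric multicategory with sets of operations $N(A_1,\dots,A_n;B)$, identities, composition and actions of the symmetric groups, subject to the usual unit, associativity and equivariance axioms; an isomorphism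 of operads is a bijection on colours together with compatible bijections on operations. Say that the DF operad $M$ is *the non-skeletal form of* the operad $N$ if there are * bijections between the objects of $MI$ and the $I$-indexed families of colours of $N$, for every finite set $I$, under which $M_hl$ is reindexing along $l$ for every mapping $l$; * bijections $(M_vf)(X,Y)\cong\prod_{j\in J}N\big((A_i)_{i\in f^{-1}j};B_j\big)$ for every mapping $f:I\to J$ of finite sets, every $X\in MI$ and $Y\in MJ$ with corresponding families $(A_i)_{i\in I}$ and $(B_j)_{j\in J}$, and every enumeration of each fibre $f^{-1}j$, such that the cell of a pullback square acts by restriction to the corresponding fibres and by the action of the induced bijections of (enumerated) fibres, the unit cells of $M$ give the identities of $N$, and the laxity cells $M_vg\circ M_vf\to M_v(gf)$ of $M$ are given by the composition of $N$ (up to the permutations relating the chosen enumerations). In particular, the colours of $N$ correspond to the objects of $M1$, and $N(A_1,\dots,A_n;B)\cong(M_vf)(X,B)$ for $f:\{1,\dots,n\}\to 1$ and $X=(A_i)_i$. **Proposition.** There are constructions $N\mapsto\overline N$, from operads to DF operads on $\mathrm{Set}_f$, and $M\mapsto\underline M$, from DF operads on $\mathrm{Set}_f$ to operads, such that 1. for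 every operad $N$, $\overline N$ is the non-skeletal form of $N$; 2. for every DF operad $M$ on $\mathrm{Set}_f$, $M$ is the non-skeletal form of $\underline M$; 3. $\overline{(\underline M)}\cong M$ for every DF operad $M$ on $\mathrm{Set}_f$; 4. $\underline{(\overline N)}\cong N$ for every operad $N$; 5. whenever $M$ is the non-skeletal form of $N$ and $M'$ is the non-skeletal form of $N'$, one has $N\cong N'$ if and only if $M\cong M'$. -/

import Mathlib

open CategoryTheory Opposite Limits

universe u

/-! ## Pseudo double categories and lax double functors -/

/-- A (pseudo) double category whose objects and horizontal arrows form the category `A`.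
`Pro I J` are the vertical arrows (proarrows) and `Sq f g` the cells from `f` to `g`; the functions
`left` and `right` are the source and target functors `s` and `t` on cells:
```
  I --left--> L
  |           |
  f           g
  v           v
  J --right-> K
```
Horizontal composition (`hcomp`) makes proarrows and cells into a category `A₁`; vertical
composition (`vcomp`, `vcompSq`) is associative and unital up to coherent invertible cells whose
left and right sides are identities. -/
structure DoubleCategory.{w, z, v₁, u₁} (A : Type u₁) [Category.{v₁} A] where
  Pro : A → A → Type w
  Sq : {I J L K : A} → Pro I J → Pro L K → Type z
  left : {I J L K : A} → {f : Pro I J} → {g : Pro L K} → Sq f g → (I ⟶ L)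
  right : {I J L K : A} → {f : Pro I J} → {g : Pro L K} → Sq f g → (J ⟶ K)
  -- the category `A₁`, with source and target functors
  hid : {I J : A} → (f : Pro I J) → Sq f f
  hcomp : {I J L K P Q : A} → {f : Pro I J} → {g : Pro L K} → {h : Pro P Q} →
    Sq f g → Sq g h → Sq f h
  left_hid : ∀ {I J : A} (f : Pro I J), left (hid f) = 𝟙 I
  right_hid : ∀ {I J : A} (f : Pro I J), right (hid f) = 𝟙 J
  left_hcomp : ∀ {I J L K P Q : A} {f : Pro I J} {g : Pro L K} {h : Pro P Q}
    (α : Sq f g) (β : Sq g h), left (hcomp α β) = left α ≫ left β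
  right_hcomp : ∀ {I J L K P Q : A} {f : Pro I J} {g : Pro L K} {h : Pro P Q}
    (α : Sq f g) (β : Sq g h), right (hcomp α β) = right α ≫ right β
  hid_hcomp : ∀ {I J L K : A} {f : Pro I J} {g : Pro L K} (α : Sq f g), hcomp (hid f) α = α
  hcomp_hid : ∀ {I J L K : A} {f : Pro I J} {g : Pro L K} (α : Sq f g), hcomp α (hid g) = α
  hcomp_assoc : ∀ {I J L K P Q R S : A} {f : Pro I J} {g : Pro L K} {h : Pro P Q} {k : Pro R S}
    (α : Sq f g) (β : Sq g h) (γ : Sq h k),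
    hcomp (hcomp α β) γ = hcomp α (hcomp β γ)
  -- vertical identities, functorially
  vid : (I : A) → Pro I I
  vidSq : {I L : A} → (k : I ⟶ L) → Sq (vid I) (vid L)
  left_vidSq : ∀ {I L : A} (k : I ⟶ L), left (vidSq k) = k
  right_vidSq : ∀ {I L : A} (k : I ⟶ L), right (vidSq k) = k
  vidSq_id : ∀ I : A, vidSq (𝟙 I) = hid (vid I)
  vidSq_comp : ∀ {I L P : A} (k : I ⟶ L) (l : L ⟶ P),
    vidSq (k ≫ l) = hcomp (vidSq k) (vidSq l)
  -- vertical composition, functorially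
  vcomp : {I J K : A} → Pro I J → Pro J K → Pro I K
  vcompSq : {I J K I' J' K' : A} → {f : Pro I J} → {g : Pro J K} → {f' : Pro I' J'} →
    {g' : Pro J' K'} → (α : Sq f f') → (β : Sq g g') → right α = left β →
    Sq (vcomp f g) (vcomp f' g')
  left_vcompSq : ∀ {I J K I' J' K' : A} {f : Pro I J} {g : Pro J K} {f' : Pro I' J'}
    {g' : Pro J' K'} (α : Sq f f') (β : Sq g g') (e : right α = left β),
    left (vcompSq α β e) = left α
  right_vcompSq : ∀ {I J K I' J' K' : A} {f : Pro I J} {g : Pro J K} {f' : Pro I' J'}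
    {g' : Pro J' K'} (α : Sq f f') (β : Sq g g') (e : right α = left β),
    right (vcompSq α β e) = right β
  vcompSq_hid : ∀ {I J K : A} (f : Pro I J) (g : Pro J K),
    vcompSq (hid f) (hid g) ((right_hid f).trans (left_hid g).symm) = hid (vcomp f g)
  interchange : ∀ {I J K I' J' K' I'' J'' K'' : A} {f : Pro I J} {g : Pro J K}
    {f' : Pro I' J'} {g' : Pro J' K'} {f'' : Pro I'' J''} {g'' : Pro J'' K''}
    (α : Sq f f') (β : Sq g g') (α' : Sq f' f'') (β' : Sq g' g'')
    (e : right α = left β) (e' : right α' = left β'),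
    vcompSq (hcomp α α') (hcomp β β') (by rw [right_hcomp, left_hcomp, e, e']) =
      hcomp (vcompSq α β e) (vcompSq α' β' e')
  -- associativity and unit constraints
  assoc : {I J K L : A} → (f : Pro I J) → (g : Pro J K) → (h : Pro K L) →
    Sq (vcomp (vcomp f g) h) (vcomp f (vcomp g h))
  assocInv : {I J K L : A} → (f : Pro I J) → (g : Pro J K) → (h : Pro K L) →
    Sq (vcomp f (vcomp g h)) (vcomp (vcomp f g) h)
  lunit : {I J : A} → (f : Pro I J) → Sq (vcomp (vid I) f) f
  lunitInv : {I J : A} → (f : Pro I J) → Sq f (vcomp (vid I) f)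
  runit : {I J : A} → (f : Pro I J) → Sq (vcomp f (vid J)) f
  runitInv : {I J : A} → (f : Pro I J) → Sq f (vcomp f (vid J))
  left_assoc : ∀ {I J K L : A} (f : Pro I J) (g : Pro J K) (h : Pro K L),
    left (assoc f g h) = 𝟙 I
  right_assoc : ∀ {I J K L : A} (f : Pro I J) (g : Pro J K) (h : Pro K L),
    right (assoc f g h) = 𝟙 L
  left_lunit : ∀ {I J : A} (f : Pro I J), left (lunit f) = 𝟙 I
  right_lunit : ∀ {I J : A} (f : Pro I J), right (lunit f) = 𝟙 J
  left_runit : ∀ {I J : A} (f : Pro I J), left (runit f) = 𝟙 I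
  right_runit : ∀ {I J : A} (f : Pro I J), right (runit f) = 𝟙 J
  assoc_assocInv : ∀ {I J K L : A} (f : Pro I J) (g : Pro J K) (h : Pro K L),
    hcomp (assoc f g h) (assocInv f g h) = hid _
  assocInv_assoc : ∀ {I J K L : A} (f : Pro I J) (g : Pro J K) (h : Pro K L),
    hcomp (assocInv f g h) (assoc f g h) = hid _
  lunit_lunitInv : ∀ {I J : A} (f : Pro I J), hcomp (lunit f) (lunitInv f) = hid _
  lunitInv_lunit : ∀ {I J : A} (f : Pro I J), hcomp (lunitInv f) (lunit f) = hid _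
  runit_runitInv : ∀ {I J : A} (f : Pro I J), hcomp (runit f) (runitInv f) = hid _
  runitInv_runit : ∀ {I J : A} (f : Pro I J), hcomp (runitInv f) (runit f) = hid _
  assoc_natural : ∀ {I J K L I' J' K' L' : A} {f : Pro I J} {g : Pro J K} {h : Pro K L}
    {f' : Pro I' J'} {g' : Pro J' K'} {h' : Pro K' L'}
    (α : Sq f f') (β : Sq g g') (γ : Sq h h') (e : right α = left β) (e' : right β = left γ),
    hcomp (vcompSq (vcompSq α β e) γ ((right_vcompSq α β e).trans e')) (assoc f' g' h') =
      hcomp (assoc f g h) (vcompSq α (vcompSq β γ e') (e.trans (left_vcompSq β γ e').symm))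
  lunit_natural : ∀ {I J I' J' : A} {f : Pro I J} {f' : Pro I' J'} (α : Sq f f'),
    hcomp (vcompSq (vidSq (left α)) α (right_vidSq _)) (lunit f') = hcomp (lunit f) α
  runit_natural : ∀ {I J I' J' : A} {f : Pro I J} {f' : Pro I' J'} (α : Sq f f'),
    hcomp (vcompSq α (vidSq (right α)) (left_vidSq _).symm) (runit f') = hcomp (runit f) α
  pentagon : ∀ {I J K L M : A} (f : Pro I J) (g : Pro J K) (h : Pro K L) (k : Pro L M),
    hcomp (vcompSq (assoc f g h) (hid k) ((right_assoc f g h).trans (left_hid k).symm))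
      (hcomp (assoc f (vcomp g h) k)
        (vcompSq (hid f) (assoc g h k) ((right_hid f).trans (left_assoc g h k).symm))) =
      hcomp (assoc (vcomp f g) h k) (assoc f g (vcomp h k))
  triangle : ∀ {I J K : A} (f : Pro I J) (g : Pro J K),
    hcomp (assoc f (vid J) g)
      (vcompSq (hid f) (lunit g) ((right_hid f).trans (left_lunit g).symm)) =
      vcompSq (runit f) (hid g) ((right_runit f).trans (left_hid g).symm)

namespace DoubleCategory

section

variable {A : Type*} [Category A]

/-- Objects of the category `A₁` of a double category: the proarrows. -/
structure One (𝔸 : DoubleCategory A) where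
  {dom : A}
  {cod : A}
  pro : 𝔸.Pro dom cod

/-- The category `A₁` of proarrows and cells. -/
instance (𝔸 : DoubleCategory A) : Category 𝔸.One where
  Hom f g := 𝔸.Sq f.pro g.pro
  id f := 𝔸.hid f.pro
  comp α β := 𝔸.hcomp α β
  id_comp α := 𝔸.hid_hcomp α
  comp_id α := 𝔸.hcomp_hid α
  assoc α β γ := 𝔸.hcomp_assoc α β γ

variable (𝔸 : DoubleCategory A)

theorem left_inv_eq {I J : A} {f g : 𝔸.Pro I J} {α : 𝔸.Sq f g} {β : 𝔸.Sq g f}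
    (h : 𝔸.hcomp α β = 𝔸.hid _) (hα : 𝔸.left α = 𝟙 I) : 𝔸.left β = 𝟙 I := by
  have := congrArg 𝔸.left h
  rwa [𝔸.left_hcomp, 𝔸.left_hid, hα, Category.id_comp] at this

theorem right_inv_eq {I J : A} {f g : 𝔸.Pro I J} {α : 𝔸.Sq f g} {β : 𝔸.Sq g f}
    (h : 𝔸.hcomp α β = 𝔸.hid _) (hα : 𝔸.right α = 𝟙 J) : 𝔸.right β = 𝟙 J := by
  have := congrArg 𝔸.right h
  rwa [𝔸.right_hcomp, 𝔸.right_hid, hα, Category.id_comp] at this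

theorem left_assocInv {I J K L : A} (f : 𝔸.Pro I J) (g : 𝔸.Pro J K) (h : 𝔸.Pro K L) :
    𝔸.left (𝔸.assocInv f g h) = 𝟙 I :=
  𝔸.left_inv_eq (𝔸.assoc_assocInv f g h) (𝔸.left_assoc f g h)

theorem right_assocInv {I J K L : A} (f : 𝔸.Pro I J) (g : 𝔸.Pro J K) (h : 𝔸.Pro K L) :
    𝔸.right (𝔸.assocInv f g h) = 𝟙 L :=
  𝔸.right_inv_eq (𝔸.assoc_assocInv f g h) (𝔸.right_assoc f g h)

theorem left_lunitInv {I J : A} (f : 𝔸.Pro I J) : 𝔸.left (𝔸.lunitInv f) = 𝟙 I :=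
  𝔸.left_inv_eq (𝔸.lunit_lunitInv f) (𝔸.left_lunit f)

theorem right_lunitInv {I J : A} (f : 𝔸.Pro I J) : 𝔸.right (𝔸.lunitInv f) = 𝟙 J :=
  𝔸.right_inv_eq (𝔸.lunit_lunitInv f) (𝔸.right_lunit f)

theorem left_runitInv {I J : A} (f : 𝔸.Pro I J) : 𝔸.left (𝔸.runitInv f) = 𝟙 I :=
  𝔸.left_inv_eq (𝔸.runit_runitInv f) (𝔸.left_runit f)

theorem right_runitInv {I J : A} (f : 𝔸.Pro I J) : 𝔸.right (𝔸.runitInv f) = 𝟙 J :=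
  𝔸.right_inv_eq (𝔸.runit_runitInv f) (𝔸.right_runit f)

end

end DoubleCategory

namespace DoubleCategory

section

variable {A : Type*} [Category A] (𝔸 : DoubleCategory A)

theorem inv_unique {I J L K : A} {f : 𝔸.Pro I J} {g : 𝔸.Pro L K} {α : 𝔸.Sq f g}
    {β β' : 𝔸.Sq g f} (h : 𝔸.hcomp α β = 𝔸.hid _) (h' : 𝔸.hcomp β' α = 𝔸.hid _) : β' = β := by
  rw [← 𝔸.hcomp_hid β', ← h, ← 𝔸.hcomp_assoc, h', 𝔸.hid_hcomp]

theorem inv_natural {I J L K I' J' L' K' : A} {f : 𝔸.Pro I J} {g : 𝔸.Pro L K}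
    {f' : 𝔸.Pro I' J'} {g' : 𝔸.Pro L' K'} {α : 𝔸.Sq f g} {β : 𝔸.Sq g f} {α' : 𝔸.Sq f' g'}
    {β' : 𝔸.Sq g' f'} {γ : 𝔸.Sq f f'} {δ : 𝔸.Sq g g'} (h : 𝔸.hcomp β α = 𝔸.hid _)
    (h' : 𝔸.hcomp α' β' = 𝔸.hid _) (e : 𝔸.hcomp γ α' = 𝔸.hcomp α δ) :
    𝔸.hcomp β γ = 𝔸.hcomp δ β' := by
  rw [← 𝔸.hcomp_hid (𝔸.hcomp β γ), ← h', 𝔸.hcomp_assoc, ← 𝔸.hcomp_assoc γ, e, 𝔸.hcomp_assoc,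
    ← 𝔸.hcomp_assoc β, h, 𝔸.hid_hcomp]

theorem hcomp_inv {I J L K P Q : A} {f : 𝔸.Pro I J} {g : 𝔸.Pro L K} {k : 𝔸.Pro P Q}
    {α : 𝔸.Sq f g} {α' : 𝔸.Sq g f} {β : 𝔸.Sq g k} {β' : 𝔸.Sq k g}
    (h : 𝔸.hcomp α α' = 𝔸.hid _) (h' : 𝔸.hcomp β β' = 𝔸.hid _) :
    𝔸.hcomp (𝔸.hcomp α β) (𝔸.hcomp β' α') = 𝔸.hid _ := by
  rw [𝔸.hcomp_assoc, ← 𝔸.hcomp_assoc β, h', 𝔸.hid_hcomp, h]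

theorem vcompSq_inv {I J K I' J' K' : A} {f : 𝔸.Pro I J} {g : 𝔸.Pro J K} {f' : 𝔸.Pro I' J'}
    {g' : 𝔸.Pro J' K'} {α : 𝔸.Sq f f'} {α' : 𝔸.Sq f' f} {β : 𝔸.Sq g g'} {β' : 𝔸.Sq g' g}
    (e : 𝔸.right α = 𝔸.left β) (e' : 𝔸.right α' = 𝔸.left β')
    (h : 𝔸.hcomp α α' = 𝔸.hid _) (h' : 𝔸.hcomp β β' = 𝔸.hid _) :
    𝔸.hcomp (𝔸.vcompSq α β e) (𝔸.vcompSq α' β' e') = 𝔸.hid _ := by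
  rw [← 𝔸.interchange, ← 𝔸.vcompSq_hid]
  congr 1

/-- The horizontal opposite: the categories of horizontal arrows and of cells are reversed, while
source and target of proarrows are kept. -/
def hop : DoubleCategory Aᵒᵖ where
  Pro I J := 𝔸.Pro I.unop J.unop
  Sq f g := 𝔸.Sq g f
  left α := (𝔸.left α).op
  right α := (𝔸.right α).op
  hid f := 𝔸.hid f
  hcomp α β := 𝔸.hcomp β α
  left_hid f := by rw [𝔸.left_hid]; rfl
  right_hid f := by rw [𝔸.right_hid]; rfl
  left_hcomp α β := by rw [𝔸.left_hcomp]; rfl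
  right_hcomp α β := by rw [𝔸.right_hcomp]; rfl
  hid_hcomp α := 𝔸.hcomp_hid α
  hcomp_hid α := 𝔸.hid_hcomp α
  hcomp_assoc α β γ := (𝔸.hcomp_assoc γ β α).symm
  vid I := 𝔸.vid I.unop
  vidSq k := 𝔸.vidSq k.unop
  left_vidSq k := by rw [𝔸.left_vidSq]; rfl
  right_vidSq k := by rw [𝔸.right_vidSq]; rfl
  vidSq_id I := 𝔸.vidSq_id I.unop
  vidSq_comp k l := 𝔸.vidSq_comp l.unop k.unop
  vcomp f g := 𝔸.vcomp f g
  vcompSq α β e := 𝔸.vcompSq α β (Quiver.Hom.op_inj e)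
  left_vcompSq α β e := by rw [𝔸.left_vcompSq]
  right_vcompSq α β e := by rw [𝔸.right_vcompSq]
  vcompSq_hid f g := 𝔸.vcompSq_hid f g
  interchange α β α' β' e e' := 𝔸.interchange α' β' α β _ _
  assoc f g h := 𝔸.assocInv f g h
  assocInv f g h := 𝔸.assoc f g h
  lunit f := 𝔸.lunitInv f
  lunitInv f := 𝔸.lunit f
  runit f := 𝔸.runitInv f
  runitInv f := 𝔸.runit f
  left_assoc f g h := by rw [𝔸.left_assocInv]; rfl
  right_assoc f g h := by rw [𝔸.right_assocInv]; rfl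
  left_lunit f := by rw [𝔸.left_lunitInv]; rfl
  right_lunit f := by rw [𝔸.right_lunitInv]; rfl
  left_runit f := by rw [𝔸.left_runitInv]; rfl
  right_runit f := by rw [𝔸.right_runitInv]; rfl
  assoc_assocInv f g h := 𝔸.assoc_assocInv f g h
  assocInv_assoc f g h := 𝔸.assocInv_assoc f g h
  lunit_lunitInv f := 𝔸.lunit_lunitInv f
  lunitInv_lunit f := 𝔸.lunitInv_lunit f
  runit_runitInv f := 𝔸.runit_runitInv f
  runitInv_runit f := 𝔸.runitInv_runit f
  assoc_natural α β γ e e' := 𝔸.inv_natural (𝔸.assocInv_assoc _ _ _) (𝔸.assoc_assocInv _ _ _)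
    (𝔸.assoc_natural α β γ (Quiver.Hom.op_inj e) (Quiver.Hom.op_inj e'))
  lunit_natural α := 𝔸.inv_natural (𝔸.lunitInv_lunit _) (𝔸.lunit_lunitInv _)
    (𝔸.lunit_natural α)
  runit_natural α := 𝔸.inv_natural (𝔸.runitInv_runit _) (𝔸.runit_runitInv _)
    (𝔸.runit_natural α)
  pentagon f g h k := by
    refine 𝔸.inv_unique (𝔸.hcomp_inv (𝔸.assoc_assocInv _ _ _) (𝔸.assoc_assocInv _ _ _)) ?_
    rw [← 𝔸.pentagon]
    refine 𝔸.hcomp_inv (𝔸.hcomp_inv (𝔸.vcompSq_inv _ _ (𝔸.hid_hcomp _) (𝔸.assocInv_assoc _ _ _))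
      (𝔸.assocInv_assoc _ _ _)) (𝔸.vcompSq_inv _ _ (𝔸.assocInv_assoc _ _ _) (𝔸.hid_hcomp _))
  triangle f g := by
    refine 𝔸.inv_unique (𝔸.vcompSq_inv ((𝔸.right_runit f).trans (𝔸.left_hid g).symm) _
      (𝔸.runit_runitInv f) (𝔸.hid_hcomp (𝔸.hid g))) ?_
    rw [← 𝔸.triangle]
    exact 𝔸.hcomp_inv (𝔸.vcompSq_inv _ _ (𝔸.hid_hcomp _) (𝔸.lunitInv_lunit _))
      (𝔸.assocInv_assoc _ _ _)

end

end DoubleCategory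

/-! ## Pullback squares -/

/-- A pullback square
```
  I --left--> L
  |           |
  f           g
  v           v
  J --right-> K
```
-/
@[ext]
structure PbSq {C : Type*} [Category C] {I J L K : C} (f : I ⟶ J) (g : L ⟶ K) where
  left : I ⟶ L
  right : J ⟶ K
  isPullback : IsPullback left f g right

/-- The double category of pullback squares in `C`: horizontal arrows and proarrows are the arrows
of `C`, cells are the pullback squares. -/
def pbDouble (C : Type*) [Category C] : DoubleCategory C where
  Pro I J := I ⟶ J
  Sq f g := PbSq f g
  left α := α.left
  right α := α.right
  hid f := ⟨𝟙 _, 𝟙 _, IsPullback.of_horiz_isIso ⟨by simp⟩⟩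
  hcomp α β := ⟨α.left ≫ β.left, α.right ≫ β.right, α.isPullback.paste_horiz β.isPullback⟩
  left_hid _ := rfl
  right_hid _ := rfl
  left_hcomp _ _ := rfl
  right_hcomp _ _ := rfl
  hid_hcomp α := by ext <;> simp
  hcomp_hid α := by ext <;> simp
  hcomp_assoc α β γ := by ext <;> simp
  vid I := 𝟙 I
  vidSq k := ⟨k, k, IsPullback.of_vert_isIso ⟨by simp⟩⟩
  left_vidSq _ := rfl
  right_vidSq _ := rfl
  vidSq_id _ := rfl
  vidSq_comp _ _ := rfl
  vcomp f g := f ≫ g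
  vcompSq α β e := ⟨α.left, β.right, α.isPullback.paste_vert (by rw [e]; exact β.isPullback)⟩
  left_vcompSq _ _ _ := rfl
  right_vcompSq _ _ _ := rfl
  vcompSq_hid _ _ := rfl
  interchange _ _ _ _ _ _ := rfl
  assoc f g h := ⟨𝟙 _, 𝟙 _, IsPullback.of_horiz_isIso ⟨by simp⟩⟩
  assocInv f g h := ⟨𝟙 _, 𝟙 _, IsPullback.of_horiz_isIso ⟨by simp⟩⟩
  lunit f := ⟨𝟙 _, 𝟙 _, IsPullback.of_horiz_isIso ⟨by simp⟩⟩
  lunitInv f := ⟨𝟙 _, 𝟙 _, IsPullback.of_horiz_isIso ⟨by simp⟩⟩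
  runit f := ⟨𝟙 _, 𝟙 _, IsPullback.of_horiz_isIso ⟨by simp⟩⟩
  runitInv f := ⟨𝟙 _, 𝟙 _, IsPullback.of_horiz_isIso ⟨by simp⟩⟩
  left_assoc _ _ _ := rfl
  right_assoc _ _ _ := rfl
  left_lunit _ := rfl
  right_lunit _ := rfl
  left_runit _ := rfl
  right_runit _ := rfl
  assoc_assocInv _ _ _ := by ext <;> simp
  assocInv_assoc _ _ _ := by ext <;> simp
  lunit_lunitInv _ := by ext <;> simp
  lunitInv_lunit _ := by ext <;> simp
  runit_runitInv _ := by ext <;> simp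
  runitInv_runit _ := by ext <;> simp
  assoc_natural _ _ _ _ _ := by ext <;> simp
  lunit_natural _ := by ext <;> simp
  runit_natural _ := by ext <;> simp
  pentagon _ _ _ _ := by ext <;> simp
  triangle _ _ := by ext <;> simp

/-! ## Profunctors -/

/-- Profunctors `C → D` between small categories, in the convention `Cᵒᵖ × D ⥤ Type`
(Mathlib's `Profunctor D C` is `D ⥤ Cᵒᵖ ⥤ Type`). -/
abbrev Prof (C D : Cat.{u, u}) := Profunctor.{u} D C

namespace Prof

section

variable {C D : Cat.{u, u}}

/-- The set `Φ(X, Y)`. -/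
def Het (Φ : Prof C D) (X : C) (Y : D) : Type u := (Φ.obj Y).obj (op X)

/-- Contravariant action of the arrows of `C`. -/
def pre (Φ : Prof C D) {X' X : C} {Y : D} (f : X' ⟶ X) (φ : Het Φ X Y) : Het Φ X' Y :=
  (Φ.obj Y).map f.op φ

/-- Covariant action of the arrows of `D`. -/
def post (Φ : Prof C D) {X : C} {Y Y' : D} (φ : Het Φ X Y) (g : Y ⟶ Y') : Het Φ X Y' :=
  (Φ.map g).app (op X) φ

variable (Φ : Prof C D)

@[simp] theorem pre_id {X : C} {Y : D} (φ : Het Φ X Y) : pre Φ (𝟙 X) φ = φ := by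
  simp [pre, Het]
  rfl

@[simp] theorem post_id {X : C} {Y : D} (φ : Het Φ X Y) : post Φ φ (𝟙 Y) = φ := by
  simp [post, Het]
  rfl

theorem pre_comp {X'' X' X : C} {Y : D} (f : X'' ⟶ X') (g : X' ⟶ X) (φ : Het Φ X Y) :
    pre Φ (f ≫ g) φ = pre Φ f (pre Φ g φ) := by
  simp [pre, Het]
  rfl

theorem post_comp {X : C} {Y Y' Y'' : D} (φ : Het Φ X Y) (g : Y ⟶ Y') (h : Y' ⟶ Y'') :
    post Φ φ (g ≫ h) = post Φ (post Φ φ g) h := by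
  simp [post, Het]
  rfl

theorem pre_post {X' X : C} {Y Y' : D} (f : X' ⟶ X) (φ : Het Φ X Y) (g : Y ⟶ Y') :
    pre Φ f (post Φ φ g) = post Φ (pre Φ f φ) g :=
  (NatTrans.naturality_apply (Φ.map g) f.op φ).symm

/-- Build a profunctor from sets with a left and a right action. -/
def mk (H : C → D → Type u) (l : ∀ {X' X : C} {Y : D}, (X' ⟶ X) → H X Y → H X' Y)
    (r : ∀ {X : C} {Y Y' : D}, H X Y → (Y ⟶ Y') → H X Y')
    (l_id : ∀ {X : C} {Y : D} (φ : H X Y), l (𝟙 X) φ = φ)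
    (r_id : ∀ {X : C} {Y : D} (φ : H X Y), r φ (𝟙 Y) = φ)
    (l_comp : ∀ {X'' X' X : C} {Y : D} (f : X'' ⟶ X') (g : X' ⟶ X) (φ : H X Y),
      l (f ≫ g) φ = l f (l g φ))
    (r_comp : ∀ {X : C} {Y Y' Y'' : D} (φ : H X Y) (g : Y ⟶ Y') (h : Y' ⟶ Y''),
      r φ (g ≫ h) = r (r φ g) h)
    (l_r : ∀ {X' X : C} {Y Y' : D} (f : X' ⟶ X) (φ : H X Y) (g : Y ⟶ Y'),
      l f (r φ g) = r (l f φ) g) : Prof C D where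
  obj Y :=
    { obj := fun X => H X.unop Y
      map := fun f => ↾(fun φ => l f.unop φ)
      map_id := fun X => by ext φ; exact l_id φ
      map_comp := fun f g => by ext φ; exact l_comp _ _ φ }
  map g :=
    { app := fun X => ↾(fun φ => r φ g)
      naturality := fun X X' f => by ext φ; exact (l_r _ _ _).symm }
  map_id Y := by ext X φ; exact r_id φ
  map_comp g h := by ext X φ; exact r_comp φ g h

/-- The identity profunctor: the hom functor. -/
def hom (C : Cat.{u, u}) : Prof C C := Profunctor.id

end

section

variable {C D E : Cat.{u, u}} (Φ : Prof C D) (Ψ : Prof D E)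

/-- The relation on `Σ Y, Φ(X, Y) × Ψ(Y, Z)` whose quotient is the coend over `Y`. -/
inductive CompRel (X : C) (Z : E) : (Σ Y : D, Het Φ X Y × Het Ψ Y Z) →
    (Σ Y : D, Het Φ X Y × Het Ψ Y Z) → Prop
  | slide {Y Y' : D} (φ : Het Φ X Y) (h : Y ⟶ Y') (ψ : Het Ψ Y' Z) :
      CompRel X Z ⟨Y', post Φ φ h, ψ⟩ ⟨Y, φ, pre Ψ h ψ⟩

/-- The coend `∫^Y Φ(X, Y) × Ψ(Y, Z)`. -/
def CompHet (X : C) (Z : E) : Type u := Quot (CompRel Φ Ψ X Z)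

/-- The class of a pair in the coend. -/
def tmul {X : C} {Y : D} {Z : E} (φ : Het Φ X Y) (ψ : Het Ψ Y Z) : CompHet Φ Ψ X Z :=
  Quot.mk _ ⟨Y, φ, ψ⟩

theorem tmul_slide {X : C} {Y Y' : D} {Z : E} (φ : Het Φ X Y) (h : Y ⟶ Y') (ψ : Het Ψ Y' Z) :
    tmul Φ Ψ (post Φ φ h) ψ = tmul Φ Ψ φ (pre Ψ h ψ) :=
  Quot.sound (.slide φ h ψ)

variable {Φ Ψ} in
theorem CompHet.ind {X : C} {Z : E} {p : CompHet Φ Ψ X Z → Prop}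
    (h : ∀ (Y : D) (φ : Het Φ X Y) (ψ : Het Ψ Y Z), p (tmul Φ Ψ φ ψ)) (x) : p x :=
  Quot.ind (fun ⟨Y, φ, ψ⟩ => h Y φ ψ) x

variable {Φ Ψ} in
/-- Maps out of the coend are families of maps compatible with the actions of `D`. -/
def CompHet.lift {X : C} {Z : E} {T : Type u} (t : ∀ Y : D, Het Φ X Y → Het Ψ Y Z → T)
    (ht : ∀ (Y Y' : D) (φ : Het Φ X Y) (h : Y ⟶ Y') (ψ : Het Ψ Y' Z),
      t Y' (post Φ φ h) ψ = t Y φ (pre Ψ h ψ)) : CompHet Φ Ψ X Z → T :=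
  Quot.lift (fun x => t x.1 x.2.1 x.2.2) (by rintro _ _ ⟨φ, h, ψ⟩; exact ht _ _ φ h ψ)

/-- Composition of profunctors. -/
def comp : Prof C E :=
  mk (CompHet Φ Ψ)
    (fun f => CompHet.lift (fun _ φ ψ => tmul Φ Ψ (pre Φ f φ) ψ)
      (fun _ _ φ h ψ => by rw [pre_post, tmul_slide]))
    (fun x g => CompHet.lift (fun _ φ ψ => tmul Φ Ψ φ (post Ψ ψ g))
      (fun _ _ φ h ψ => by rw [tmul_slide, pre_post]) x)
    (fun x => by
      induction x using CompHet.ind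
      exact congrArg (tmul Φ Ψ · _) (pre_id _ _))
    (fun x => by
      induction x using CompHet.ind
      exact congrArg (tmul Φ Ψ _) (post_id _ _))
    (fun f g x => by
      induction x using CompHet.ind
      exact congrArg (tmul Φ Ψ · _) (pre_comp _ _ _ _))
    (fun x g h => by
      induction x using CompHet.ind
      exact congrArg (tmul Φ Ψ _) (post_comp _ _ _ _))
    (fun f x g => by
      induction x using CompHet.ind
      rfl)

end

/-- A cell
```
  C --left--> C'
  |           |
  Φ           Ψ
  v           v
  D --right-> D'
```
of functors and profunctors: a natural family of maps `Φ(X, Y) → Ψ(left X, right Y)`. -/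
structure Cell {C D C' D' : Cat.{u, u}} (Φ : Prof C D) (Ψ : Prof C' D') where
  left : C ⟶ C'
  right : D ⟶ D'
  app : ∀ {X : C} {Y : D}, Het Φ X Y → Het Ψ (left.toFunctor.obj X) (right.toFunctor.obj Y)
  app_pre : ∀ {X' X : C} {Y : D} (f : X' ⟶ X) (φ : Het Φ X Y),
    app (pre Φ f φ) = pre Ψ (left.toFunctor.map f) (app φ)
  app_post : ∀ {X : C} {Y Y' : D} (φ : Het Φ X Y) (g : Y ⟶ Y'),
    app (post Φ φ g) = post Ψ (app φ) (right.toFunctor.map g)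

namespace Cell

theorem ext_heq {C D C' D' : Cat.{u, u}} {Φ : Prof C D} {Ψ : Prof C' D'} {α β : Cell Φ Ψ}
    (hl : α.left = β.left) (hr : α.right = β.right)
    (h : ∀ (X : C) (Y : D) (φ : Het Φ X Y), HEq (α.app φ) (β.app φ)) : α = β := by
  obtain ⟨l, r, a, _, _⟩ := α
  obtain ⟨l', r', b, _, _⟩ := β
  dsimp only at hl hr
  subst hl hr
  have : @a = @b := by
    funext X Y φ
    exact eq_of_heq (h X Y φ)
  subst this
  rfl

/-- Identity cell. -/
def hid {C D : Cat.{u, u}} (Φ : Prof C D) : Cell Φ Φ where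
  left := 𝟙 C
  right := 𝟙 D
  app φ := φ
  app_pre _ _ := rfl
  app_post _ _ := rfl

/-- Horizontal composition of cells. -/
def hcomp {C D C' D' C'' D'' : Cat.{u, u}} {Φ : Prof C D} {Ψ : Prof C' D'} {Θ : Prof C'' D''}
    (α : Cell Φ Ψ) (β : Cell Ψ Θ) : Cell Φ Θ where
  left := α.left ≫ β.left
  right := α.right ≫ β.right
  app φ := β.app (α.app φ)
  app_pre f φ := by rw [α.app_pre, β.app_pre]; rfl
  app_post φ g := by rw [α.app_post, β.app_post]; rfl

/-- The identity cell of a functor. -/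
def vid {C D : Cat.{u, u}} (F : C ⟶ D) : Cell (hom C) (hom D) where
  left := F
  right := F
  app φ := F.toFunctor.map φ
  app_pre f φ := F.toFunctor.map_comp f φ
  app_post φ g := F.toFunctor.map_comp φ g

/-- Vertical composition of cells: `φ ⊗ ψ ↦ α φ ⊗ β ψ` on coends. -/
def vcomp {C D E C' D' E' : Cat.{u, u}} {Φ : Prof C D} {Ψ : Prof D E} {Φ' : Prof C' D'}
    {Ψ' : Prof D' E'} (α : Cell Φ Φ') (β : Cell Ψ Ψ') (e : α.right = β.left) :
    Cell (comp Φ Ψ) (comp Φ' Ψ') where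
  left := α.left
  right := β.right
  app := CompHet.lift
    (fun Y φ ψ => tmul Φ' Ψ' (α.app φ)
      (pre Ψ' (eqToHom (congrArg (fun F => F.toFunctor.obj Y) e)) (β.app ψ)))
    (fun Y Y' φ h ψ => by
      obtain ⟨l, r, a, ha, ha'⟩ := α
      dsimp only at e
      subst e
      simp only [eqToHom_refl, pre_id, ha', β.app_pre, tmul_slide]
      rfl)
  app_pre f x := by
    induction x using CompHet.ind
    exact congrArg (tmul Φ' Ψ' · _) (α.app_pre _ _)
  app_post x g := by
    induction x using CompHet.ind
    refine congrArg (tmul Φ' Ψ' _) ?_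
    rw [β.app_post, pre_post]

theorem vcomp_tmul {C D E C' D' E' : Cat.{u, u}} {Φ : Prof C D} {Ψ : Prof D E} {Φ' : Prof C' D'}
    {Ψ' : Prof D' E'} (α : Cell Φ Φ') (β : Cell Ψ Ψ') (e : α.right = β.left) {X : C} {Y : D}
    {Z : E} (φ : Het Φ X Y) (ψ : Het Ψ Y Z) :
    (vcomp α β e).app (tmul Φ Ψ φ ψ) = tmul Φ' Ψ' (α.app φ)
      (pre Ψ' (eqToHom (congrArg (fun F => F.toFunctor.obj Y) e)) (β.app ψ)) := rfl

/-- Associativity of composition of profunctors: `(φ ⊗ ψ) ⊗ θ ↦ φ ⊗ (ψ ⊗ θ)`. -/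
def assoc {C D E B : Cat.{u, u}} (Φ : Prof C D) (Ψ : Prof D E) (Θ : Prof E B) :
    Cell (comp (comp Φ Ψ) Θ) (comp Φ (comp Ψ Θ)) where
  left := 𝟙 C
  right := 𝟙 B
  app := CompHet.lift
    (fun _ x θ => CompHet.lift (fun _ φ ψ => tmul Φ (comp Ψ Θ) φ (tmul Ψ Θ ψ θ))
      (fun _ _ φ h ψ => tmul_slide Φ (comp Ψ Θ) φ h (tmul Ψ Θ ψ θ)) x)
    (fun _ _ x h θ => by
      induction x using CompHet.ind with | h _ φ ψ =>
      exact congrArg (tmul Φ (comp Ψ Θ) φ) (tmul_slide Ψ Θ ψ h θ))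
  app_pre f x := by
    induction x using CompHet.ind with | h _ x θ =>
    induction x using CompHet.ind
    rfl
  app_post x g := by
    induction x using CompHet.ind with | h _ x θ =>
    induction x using CompHet.ind
    rfl

/-- Inverse of `assoc`. -/
def assocInv {C D E B : Cat.{u, u}} (Φ : Prof C D) (Ψ : Prof D E) (Θ : Prof E B) :
    Cell (comp Φ (comp Ψ Θ)) (comp (comp Φ Ψ) Θ) where
  left := 𝟙 C
  right := 𝟙 B
  app := CompHet.lift
    (fun _ φ x => CompHet.lift (fun _ ψ θ => tmul (comp Φ Ψ) Θ (tmul Φ Ψ φ ψ) θ)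
      (fun _ _ ψ h θ => tmul_slide (comp Φ Ψ) Θ (tmul Φ Ψ φ ψ) h θ) x)
    (fun _ _ φ h x => by
      induction x using CompHet.ind with | h _ ψ θ =>
      exact congrArg (tmul (comp Φ Ψ) Θ · θ) (tmul_slide Φ Ψ φ h ψ))
  app_pre f x := by
    induction x using CompHet.ind with | h _ φ x =>
    induction x using CompHet.ind
    rfl
  app_post x g := by
    induction x using CompHet.ind with | h _ φ x =>
    induction x using CompHet.ind
    rfl

/-- Left unit: `f ⊗ φ ↦ f * φ`. -/
def lunit {C D : Cat.{u, u}} (Φ : Prof C D) : Cell (comp (hom C) Φ) Φ where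
  left := 𝟙 C
  right := 𝟙 D
  app := CompHet.lift (fun _ (f : _ ⟶ _) φ => pre Φ f φ)
    (fun _ _ (f : _ ⟶ _) h φ => pre_comp Φ f h φ)
  app_pre f x := by
    induction x using CompHet.ind with | h _ g φ =>
    exact pre_comp Φ f g φ
  app_post x g := by
    induction x using CompHet.ind with | h _ f φ =>
    exact pre_post Φ f φ g

/-- Inverse of `lunit`. -/
def lunitInv {C D : Cat.{u, u}} (Φ : Prof C D) : Cell Φ (comp (hom C) Φ) where
  left := 𝟙 C
  right := 𝟙 D
  app {X _} φ := tmul (hom C) Φ (𝟙 X : X ⟶ X) φ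
  app_pre {X' X _} f φ := by
    refine (tmul_slide (hom C) Φ (𝟙 X' : X' ⟶ X') f φ).symm.trans ?_
    exact congrArg (tmul (hom C) Φ · φ)
      ((Category.id_comp f).trans (Category.comp_id f).symm : 𝟙 X' ≫ f = f ≫ 𝟙 X)
  app_post _ _ := rfl

/-- Right unit: `φ ⊗ g ↦ φ * g`. -/
def runit {C D : Cat.{u, u}} (Φ : Prof C D) : Cell (comp Φ (hom D)) Φ where
  left := 𝟙 C
  right := 𝟙 D
  app := CompHet.lift (fun _ φ (g : _ ⟶ _) => post Φ φ g)
    (fun _ _ φ h (g : _ ⟶ _) => (post_comp Φ φ h g).symm)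
  app_pre f x := by
    induction x using CompHet.ind with | h _ φ g =>
    exact (pre_post Φ f φ g).symm
  app_post x g := by
    induction x using CompHet.ind with | h _ φ f =>
    exact post_comp Φ φ f g

/-- Inverse of `runit`. -/
def runitInv {C D : Cat.{u, u}} (Φ : Prof C D) : Cell Φ (comp Φ (hom D)) where
  left := 𝟙 C
  right := 𝟙 D
  app {_ Y} φ := tmul Φ (hom D) φ (𝟙 Y : Y ⟶ Y)
  app_pre _ _ := rfl
  app_post {_ Y Y'} φ g := by
    refine (tmul_slide Φ (hom D) φ g (𝟙 Y' : Y' ⟶ Y')).trans ?_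
    exact congrArg (tmul Φ (hom D) φ)
      ((Category.comp_id g).trans (Category.id_comp g).symm : g ≫ 𝟙 Y' = 𝟙 Y ≫ g)

end Cell

end Prof

open Prof in
/-- The double category of small categories, functors and profunctors. -/
def catDouble : DoubleCategory Cat.{u, u} where
  Pro C D := Prof C D
  Sq Φ Ψ := Cell Φ Ψ
  left α := α.left
  right α := α.right
  hid := Cell.hid
  hcomp := Cell.hcomp
  left_hid _ := rfl
  right_hid _ := rfl
  left_hcomp _ _ := rfl
  right_hcomp _ _ := rfl
  hid_hcomp _ := rfl
  hcomp_hid _ := rfl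
  hcomp_assoc _ _ _ := rfl
  vid := hom
  vidSq := Cell.vid
  left_vidSq _ := rfl
  right_vidSq _ := rfl
  vidSq_id _ := rfl
  vidSq_comp _ _ := rfl
  vcomp := comp
  vcompSq := Cell.vcomp
  left_vcompSq _ _ _ := rfl
  right_vcompSq _ _ _ := rfl
  vcompSq_hid Φ Ψ := by
    refine Cell.ext_heq rfl rfl fun X Z x => heq_of_eq ?_
    induction x using CompHet.ind with | h _ φ ψ =>
    exact congrArg (tmul Φ Ψ φ) (pre_id Ψ ψ)
  interchange {_ _ _ _ _ _ _ _ _ Φ Ψ Φ' Ψ' Φ'' Ψ''} α β α' β' e e' := by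
    refine Cell.ext_heq rfl rfl fun X Z x => heq_of_eq ?_
    induction x using CompHet.ind with | h _ φ ψ =>
    obtain ⟨l, r, a, ha, ha'⟩ := α
    obtain ⟨l', r', a', h1, h2⟩ := α'
    dsimp only at e e'
    subst e e'
    refine congrArg (tmul Φ'' Ψ'' _) ((pre_id Ψ'' _).trans ?_)
    refine Eq.trans ?_ (pre_id Ψ'' _).symm
    exact congrArg β'.app (pre_id Ψ' (β.app ψ)).symm
  assoc := Cell.assoc
  assocInv := Cell.assocInv
  lunit := Cell.lunit
  lunitInv := Cell.lunitInv
  runit := Cell.runit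
  runitInv := Cell.runitInv
  left_assoc _ _ _ := rfl
  right_assoc _ _ _ := rfl
  left_lunit _ := rfl
  right_lunit _ := rfl
  left_runit _ := rfl
  right_runit _ := rfl
  assoc_assocInv Φ Ψ Θ := by
    refine Cell.ext_heq rfl rfl fun X Z x => heq_of_eq ?_
    induction x using CompHet.ind with | h _ x θ =>
    induction x using CompHet.ind
    rfl
  assocInv_assoc Φ Ψ Θ := by
    refine Cell.ext_heq rfl rfl fun X Z x => heq_of_eq ?_
    induction x using CompHet.ind with | h _ φ x =>
    induction x using CompHet.ind
    rfl
  lunit_lunitInv Φ := by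
    refine Cell.ext_heq rfl rfl fun X Z x => heq_of_eq ?_
    induction x using CompHet.ind with | h _ f φ =>
    refine (tmul_slide (hom _) Φ (𝟙 X : X ⟶ X) f φ).symm.trans ?_
    exact congrArg (tmul (hom _) Φ · φ) (Category.id_comp (f : _ ⟶ _))
  lunitInv_lunit Φ := Cell.ext_heq rfl rfl fun X Z φ => heq_of_eq (pre_id Φ φ)
  runit_runitInv Φ := by
    refine Cell.ext_heq rfl rfl fun X Z x => heq_of_eq ?_
    induction x using CompHet.ind with | h _ φ g =>
    refine (tmul_slide Φ (hom _) φ g (𝟙 Z : Z ⟶ Z)).trans ?_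
    exact congrArg (tmul Φ (hom _) φ) (Category.comp_id (g : _ ⟶ _))
  runitInv_runit Φ := Cell.ext_heq rfl rfl fun X Z φ => heq_of_eq (post_id Φ φ)
  assoc_natural {_ _ _ _ _ _ _ _ Φ Ψ Θ Φ' Ψ' Θ'} α β γ e e' := by
    refine Cell.ext_heq rfl rfl fun X Z x => heq_of_eq ?_
    induction x using CompHet.ind with | h _ x θ =>
    induction x using CompHet.ind with | h _ φ ψ =>
    obtain ⟨l, r, a, ha, ha'⟩ := α
    obtain ⟨l', r', b, hb, hb'⟩ := β
    dsimp only at e e'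
    subst e e'
    refine congrArg (tmul Φ' (comp Ψ' Θ') _) ?_
    refine Eq.trans ?_ (pre_id (comp Ψ' Θ') _).symm
    refine congrArg (tmul Ψ' Θ' · _) ?_
    exact pre_id Ψ' _
  lunit_natural {_ _ _ _ Φ Φ'} α := by
    refine Cell.ext_heq rfl rfl fun X Z x => heq_of_eq ?_
    induction x using CompHet.ind with | h _ f φ =>
    refine Eq.trans ?_ (α.app_pre f φ).symm
    exact congrArg (pre Φ' (α.left.toFunctor.map f)) (pre_id Φ' _)
  runit_natural {_ _ _ _ Φ Φ'} α := by
    refine Cell.ext_heq rfl rfl fun X Z x => heq_of_eq ?_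
    induction x using CompHet.ind with | h _ φ g =>
    refine Eq.trans ?_ (α.app_post φ g).symm
    exact congrArg (post Φ' (α.app φ)) (Category.id_comp (α.right.toFunctor.map g))
  pentagon Φ Ψ Θ Ξ := by
    refine Cell.ext_heq rfl rfl fun X Z x => heq_of_eq ?_
    induction x using CompHet.ind with | h _ x ξ =>
    induction x using CompHet.ind with | h _ x θ =>
    induction x using CompHet.ind with | h _ φ ψ =>
    refine congrArg (tmul Φ (comp Ψ (comp Θ Ξ)) φ) ?_
    refine (pre_id (comp Ψ (comp Θ Ξ)) _).trans ?_
    refine congrArg (tmul Ψ (comp Θ Ξ) ψ) ?_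
    exact congrArg (tmul Θ Ξ θ) (pre_id Ξ ξ)
  triangle Φ Ψ := by
    refine Cell.ext_heq rfl rfl fun X Z x => heq_of_eq ?_
    induction x using CompHet.ind with | h _ x ψ =>
    induction x using CompHet.ind with | h _ φ g =>
    refine (congrArg (tmul Φ Ψ φ) (pre_id Ψ _)).trans ?_
    refine (tmul_slide Φ Ψ φ g ψ).symm.trans ?_
    exact (congrArg (tmul Φ Ψ (post Φ φ g)) (pre_id Ψ ψ)).symm

/-! ## Lax double functors -/

section

variable {A B : Type*} [Category A] [Category B]

/-- A lax double functor: functors on horizontal arrows and on cells, compatible with source and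
target, and comparison cells `vid (F I) → F (vid I)` and `F g ∘ F f → F (g ∘ f)` whose left and
right sides are identities, natural and coherent. -/
structure LaxDoubleFunctor (𝔸 : DoubleCategory A) (𝔹 : DoubleCategory B) where
  /-- the horizontal component -/
  h : A ⥤ B
  /-- the vertical component on proarrows -/
  pro : {I J : A} → 𝔸.Pro I J → 𝔹.Pro (h.obj I) (h.obj J)
  /-- the vertical component on cells -/
  sq : {I J L K : A} → {f : 𝔸.Pro I J} → {g : 𝔸.Pro L K} → 𝔸.Sq f g → 𝔹.Sq (pro f) (pro g)
  left_sq : ∀ {I J L K : A} {f : 𝔸.Pro I J} {g : 𝔸.Pro L K} (α : 𝔸.Sq f g),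
    𝔹.left (sq α) = h.map (𝔸.left α)
  right_sq : ∀ {I J L K : A} {f : 𝔸.Pro I J} {g : 𝔸.Pro L K} (α : 𝔸.Sq f g),
    𝔹.right (sq α) = h.map (𝔸.right α)
  sq_hid : ∀ {I J : A} (f : 𝔸.Pro I J), sq (𝔸.hid f) = 𝔹.hid (pro f)
  sq_hcomp : ∀ {I J L K P Q : A} {f : 𝔸.Pro I J} {g : 𝔸.Pro L K} {k : 𝔸.Pro P Q}
    (α : 𝔸.Sq f g) (β : 𝔸.Sq g k), sq (𝔸.hcomp α β) = 𝔹.hcomp (sq α) (sq β)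
  unit : (I : A) → 𝔹.Sq (𝔹.vid (h.obj I)) (pro (𝔸.vid I))
  left_unit : ∀ I : A, 𝔹.left (unit I) = 𝟙 (h.obj I)
  right_unit : ∀ I : A, 𝔹.right (unit I) = 𝟙 (h.obj I)
  comp : {I J K : A} → (f : 𝔸.Pro I J) → (g : 𝔸.Pro J K) →
    𝔹.Sq (𝔹.vcomp (pro f) (pro g)) (pro (𝔸.vcomp f g))
  left_comp : ∀ {I J K : A} (f : 𝔸.Pro I J) (g : 𝔸.Pro J K), 𝔹.left (comp f g) = 𝟙 (h.obj I)
  right_comp : ∀ {I J K : A} (f : 𝔸.Pro I J) (g : 𝔸.Pro J K), 𝔹.right (comp f g) = 𝟙 (h.obj K)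
  unit_natural : ∀ {I L : A} (k : I ⟶ L),
    𝔹.hcomp (𝔹.vidSq (h.map k)) (unit L) = 𝔹.hcomp (unit I) (sq (𝔸.vidSq k))
  comp_natural : ∀ {I J K I' J' K' : A} {f : 𝔸.Pro I J} {g : 𝔸.Pro J K} {f' : 𝔸.Pro I' J'}
    {g' : 𝔸.Pro J' K'} (α : 𝔸.Sq f f') (β : 𝔸.Sq g g') (e : 𝔸.right α = 𝔸.left β),
    𝔹.hcomp (𝔹.vcompSq (sq α) (sq β) (by rw [right_sq, left_sq, e])) (comp f' g') =
      𝔹.hcomp (comp f g) (sq (𝔸.vcompSq α β e))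
  comp_assoc : ∀ {I J K L : A} (f : 𝔸.Pro I J) (g : 𝔸.Pro J K) (k : 𝔸.Pro K L),
    𝔹.hcomp (𝔹.vcompSq (comp f g) (𝔹.hid (pro k)) ((right_comp f g).trans (𝔹.left_hid _).symm))
      (𝔹.hcomp (comp (𝔸.vcomp f g) k) (sq (𝔸.assoc f g k))) =
      𝔹.hcomp (𝔹.assoc (pro f) (pro g) (pro k))
        (𝔹.hcomp (𝔹.vcompSq (𝔹.hid (pro f)) (comp g k)
          ((𝔹.right_hid _).trans (left_comp g k).symm)) (comp f (𝔸.vcomp g k)))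
  unit_comp : ∀ {I J : A} (f : 𝔸.Pro I J),
    𝔹.hcomp (𝔹.vcompSq (unit I) (𝔹.hid (pro f)) ((right_unit I).trans (𝔹.left_hid _).symm))
      (𝔹.hcomp (comp (𝔸.vid I) f) (sq (𝔸.lunit f))) = 𝔹.lunit (pro f)
  comp_unit : ∀ {I J : A} (f : 𝔸.Pro I J),
    𝔹.hcomp (𝔹.vcompSq (𝔹.hid (pro f)) (unit J) ((𝔹.right_hid _).trans (left_unit J).symm))
      (𝔹.hcomp (comp f (𝔸.vid J)) (sq (𝔸.runit f))) = 𝔹.runit (pro f)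

namespace LaxDoubleFunctor

variable {𝔸 : DoubleCategory A} {𝔹 : DoubleCategory B}

/-- The vertical component, as a functor `A₁ ⥤ B₁`. -/
def v (F : LaxDoubleFunctor 𝔸 𝔹) : 𝔸.One ⥤ 𝔹.One where
  obj f := ⟨F.pro f.pro⟩
  map α := F.sq α
  map_id f := F.sq_hid f.pro
  map_comp α β := F.sq_hcomp α β

/-- Vertical identities are strictly preserved. -/
def Normal (F : LaxDoubleFunctor 𝔸 𝔹) : Prop :=
  ∀ I : A, ∃ e : 𝔹.vid (F.h.obj I) = F.pro (𝔸.vid I), F.unit I = e ▸ 𝔹.hid (𝔹.vid (F.h.obj I))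

/-- Preservation of finite products, by both components. -/
def PreservesProducts (F : LaxDoubleFunctor 𝔸 𝔹) : Prop :=
  PreservesFiniteProducts F.h ∧ PreservesFiniteProducts F.v

/-- Double natural transformations between lax double functors. -/
structure Trans (F G : LaxDoubleFunctor 𝔸 𝔹) where
  app : (I : A) → (F.h.obj I ⟶ G.h.obj I)
  sq : {I J : A} → (f : 𝔸.Pro I J) → 𝔹.Sq (F.pro f) (G.pro f)
  left_sq : ∀ {I J : A} (f : 𝔸.Pro I J), 𝔹.left (sq f) = app I
  right_sq : ∀ {I J : A} (f : 𝔸.Pro I J), 𝔹.right (sq f) = app J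
  app_natural : ∀ {I J : A} (k : I ⟶ J), F.h.map k ≫ app J = app I ≫ G.h.map k
  sq_natural : ∀ {I J L K : A} {f : 𝔸.Pro I J} {g : 𝔸.Pro L K} (α : 𝔸.Sq f g),
    𝔹.hcomp (F.sq α) (sq g) = 𝔹.hcomp (sq f) (G.sq α)
  unit_sq : ∀ I : A,
    𝔹.hcomp (F.unit I) (sq (𝔸.vid I)) = 𝔹.hcomp (𝔹.vidSq (app I)) (G.unit I)
  comp_sq : ∀ {I J K : A} (f : 𝔸.Pro I J) (g : 𝔸.Pro J K),
    𝔹.hcomp (F.comp f g) (sq (𝔸.vcomp f g)) =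
      𝔹.hcomp (𝔹.vcompSq (sq f) (sq g) ((right_sq f).trans (left_sq g).symm)) (G.comp f g)

/-- Isomorphisms of lax double functors: mutually inverse double natural transformations. -/
structure Iso (F G : LaxDoubleFunctor 𝔸 𝔹) where
  hom : Trans F G
  inv : Trans G F
  app_hom_inv : ∀ I : A, hom.app I ≫ inv.app I = 𝟙 _
  app_inv_hom : ∀ I : A, inv.app I ≫ hom.app I = 𝟙 _
  sq_hom_inv : ∀ {I J : A} (f : 𝔸.Pro I J), 𝔹.hcomp (hom.sq f) (inv.sq f) = 𝔹.hid _
  sq_inv_hom : ∀ {I J : A} (f : 𝔸.Pro I J), 𝔹.hcomp (inv.sq f) (hom.sq f) = 𝔹.hid _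

end LaxDoubleFunctor

end

/-! ## DF operads on finite sets -/

/-- A DF operad on finite sets: a product-preserving normal lax double functor
`(ℙb Set_f)ᵒᵖ → ℂat`. (A family of finite sets, or of maps of finite sets and pullback squares,
has a sum only if almost all its members are empty, so there are no products to preserve other than
the finite ones.) -/
structure DFOperad extends
    LaxDoubleFunctor (pbDouble FintypeCat.{0}).hop catDouble.{u} where
  normal : toLaxDoubleFunctor.Normal
  preservesProducts : toLaxDoubleFunctor.PreservesProducts

namespace DFOperad

open Prof

variable (M : DFOperad.{u})

/-- The category `M I`. -/
def fam (I : FintypeCat.{0}) : Cat.{u, u} := M.h.obj (op I)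

/-- The reindexing functor `l* = M_h l : M K → M J` of `l : J → K`. -/
def reindex {J K : FintypeCat.{0}} (l : J ⟶ K) : M.fam K ⟶ M.fam J := M.h.map l.op

/-- The profunctor `M_v f : M I → M J` of `f : I → J`. -/
def prof {I J : FintypeCat.{0}} (f : I ⟶ J) : Prof (M.fam I) (M.fam J) :=
  M.pro (I := op I) (J := op J) f

/-- The value of a cell at an element, when the sides of the cell are known. -/
def _root_.Prof.Cell.appOf {C D C' D' : Cat.{u, u}} {Φ : Prof C D} {Ψ : Prof C' D'}
    (α : Cell Φ Ψ) {F : C ⟶ C'} {G : D ⟶ D'} (hF : α.left = F) (hG : α.right = G)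
    {X : C} {Y : D} (φ : Het Φ X Y) : Het Ψ (F.toFunctor.obj X) (G.toFunctor.obj Y) :=
  cast (by rw [hF, hG]) (α.app φ)

/-- The action of the cell of a pullback square from `f` to `g`:
`(M_v g)(X, Y) → (M_v f)(k* X, l* Y)`. -/
def cellEl {I J L K : FintypeCat.{0}} {f : I ⟶ J} {g : L ⟶ K} (s : PbSq f g) {X : M.fam L}
    {Y : M.fam K} (φ : Het (M.prof g) X Y) :
    Het (M.prof f) ((M.reindex s.left).toFunctor.obj X) ((M.reindex s.right).toFunctor.obj Y) :=
  Cell.appOf (Φ := M.prof g) (Ψ := M.prof f)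
    (M.sq (I := op L) (J := op K) (L := op I) (K := op J) (f := g) (g := f) s)
    (M.left_sq (I := op L) (J := op K) (L := op I) (K := op J) (f := g) (g := f) s)
    (M.right_sq (I := op L) (J := op K) (L := op I) (K := op J) (f := g) (g := f) s) φ

/-- The element of `(M_v id)(X, X)` given by the unit cell at the identity of `X`. -/
def unitEl {I : FintypeCat.{0}} (X : M.fam I) : Het (M.prof (𝟙 I)) X X :=
  Cell.appOf (Φ := Prof.hom (M.fam I)) (Ψ := M.prof (𝟙 I)) (F := 𝟙 (M.fam I)) (G := 𝟙 (M.fam I))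
    (M.unit (op I)) (M.left_unit (op I)) (M.right_unit (op I)) (𝟙 X : X ⟶ X)

/-- Composition `(M_v f)(X, Y) × (M_v g)(Y, Z) → (M_v (g ∘ f))(X, Z)` given by the laxity cells. -/
def compEl {I J K : FintypeCat.{0}} {f : I ⟶ J} {g : J ⟶ K} {X : M.fam I} {Y : M.fam J}
    {Z : M.fam K} (φ : Het (M.prof f) X Y) (ψ : Het (M.prof g) Y Z) :
    Het (M.prof (f ≫ g)) X Z :=
  Cell.appOf (Φ := Prof.comp (M.prof f) (M.prof g)) (Ψ := M.prof (f ≫ g))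
    (F := 𝟙 (M.fam I)) (G := 𝟙 (M.fam K))
    (M.comp (I := op I) (J := op J) (K := op K) f g)
    (M.left_comp (I := op I) (J := op J) (K := op K) f g)
    (M.right_comp (I := op I) (J := op J) (K := op K) f g) (tmul _ _ φ ψ)

end DFOperad

/-! ## Classical coloured operads -/

/-- The concatenation `A₁₁, …, A₁ₖ₁, …, Aₙ₁, …, Aₙₖₙ` of finite sequences. -/
def concat {Col : Type*} {n : ℕ} {k : Fin n → ℕ} (A : ∀ i, Fin (k i) → Col) :
    Fin (∑ i, k i) → Col :=
  fun p => A (finSigmaFinEquiv.symm p).1 (finSigmaFinEquiv.symm p).2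

/-- The data of a coloured operad: a set of colours, sets of operations `Op (A₁, …, Aₙ) B`,
identities, composition, and actions of the symmetric groups,
`Op (A₁, …, Aₙ) B → Op (A_σ1, …, A_σn) B`. -/
structure OperadData where
  Col : Type u
  Op : {n : ℕ} → (Fin n → Col) → Col → Type u
  one : (A : Col) → Op (fun _ : Fin 1 => A) A
  comp : {n : ℕ} → {B : Fin n → Col} → {C : Col} → {k : Fin n → ℕ} →
    {A : ∀ i, Fin (k i) → Col} → Op B C → (∀ i, Op (A i) (B i)) → Op (concat A) C
  act : {n : ℕ} → {A : Fin n → Col} → {B : Col} → (σ : Equiv.Perm (Fin n)) →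
    Op A B → Op (A ∘ σ) B

namespace OperadData

/-- The action of a bijection `σ : Fin m ≃ Fin n` on operations: as `m = n`, this is the action of
a permutation, up to equality of the sequences of colours. -/
def relabel (N : OperadData.{u}) {m n : ℕ} {A : Fin n → N.Col} {A' : Fin m → N.Col} {B B' : N.Col}
    (σ : Fin m ≃ Fin n) (hA : ∀ p, A' p = A (σ p)) (hB : B' = B) (θ : N.Op A B) : N.Op A' B' := by
  obtain rfl : m = n := by simpa using Fintype.card_congr σ
  obtain rfl : A' = A ∘ σ := funext hA
  subst hB
  exact N.act σ θ

theorem relabel_eq_act (N : OperadData.{u}) {n : ℕ} {A : Fin n → N.Col} {B : N.Col}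
    (σ : Equiv.Perm (Fin n)) (θ : N.Op A B) :
    N.relabel σ (fun _ => rfl) rfl θ = N.act σ θ := rfl

end OperadData

/-! Canonical bijections between the index sets of iterated concatenations. The enumeration
`finSigmaFinEquiv` is lexicographic, so that `idxOne`, `idxUnit` and `idxAssoc` preserve positions,
`idxBlock` permutes blocks and `idxSum` is a block sum of permutations. -/

/-- One sequence of length `n`. -/
def idxOne (n : ℕ) : Fin (∑ _i : Fin 1, n) ≃ Fin n :=
  finSigmaFinEquiv.symm.trans (Equiv.uniqueSigma fun _ : Fin 1 => Fin n)

/-- A sequence of `n` sequences of length one. -/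
def idxUnit (n : ℕ) : Fin (∑ _i : Fin n, 1) ≃ Fin n :=
  finSigmaFinEquiv.symm.trans (Equiv.sigmaUnique (Fin n) fun _ => Fin 1)

/-- Concatenating in two ways a sequence of sequences of sequences. -/
def idxAssoc {n : ℕ} {k : Fin n → ℕ} (m : ∀ i, Fin (k i) → ℕ) :
    Fin (∑ p : Fin (∑ i, k i), m (finSigmaFinEquiv.symm p).1 (finSigmaFinEquiv.symm p).2) ≃
      Fin (∑ i, ∑ j, m i j) :=
  finSigmaFinEquiv.symm.trans <|
    (finSigmaFinEquiv.symm.sigmaCongrLeft (β := fun q : (i : Fin n) × Fin (k i) =>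
      Fin (m q.1 q.2))).trans <|
    (Equiv.sigmaAssoc fun i j => Fin (m i j)).trans <|
    (Equiv.sigmaCongrRight fun _ => finSigmaFinEquiv).trans finSigmaFinEquiv

/-- Permutation of blocks. -/
def idxBlock {n : ℕ} (σ : Equiv.Perm (Fin n)) (k : Fin n → ℕ) :
    Fin (∑ i, k (σ i)) ≃ Fin (∑ i, k i) :=
  finSigmaFinEquiv.symm.trans ((σ.sigmaCongrLeft (β := fun i => Fin (k i))).trans finSigmaFinEquiv)

/-- Block sum of permutations. -/
def idxSum {n : ℕ} {k : Fin n → ℕ} (τ : ∀ i, Equiv.Perm (Fin (k i))) :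
    Fin (∑ i, k i) ≃ Fin (∑ i, k i) :=
  finSigmaFinEquiv.symm.trans ((Equiv.sigmaCongrRight τ).trans finSigmaFinEquiv)

theorem concat_finSigma {Col : Type*} {n : ℕ} {k : Fin n → ℕ} (A : ∀ i, Fin (k i) → Col)
    (q : (i : Fin n) × Fin (k i)) : concat A (finSigmaFinEquiv q) = A q.1 q.2 := by
  unfold concat
  rw [Equiv.symm_apply_apply]

theorem concat_one {Col : Type*} {n : ℕ} (A : Fin n → Col) (p : Fin (∑ _i : Fin 1, n)) :
    concat (fun _ : Fin 1 => A) p = A (idxOne n p) := by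
  obtain ⟨⟨i, j⟩, rfl⟩ := finSigmaFinEquiv.surjective p
  rw [concat_finSigma]
  simp [idxOne, Equiv.uniqueSigma]

theorem concat_unit {Col : Type*} {n : ℕ} (A : Fin n → Col) (p : Fin (∑ _i : Fin n, 1)) :
    concat (fun i (_ : Fin 1) => A i) p = A (idxUnit n p) := by
  obtain ⟨⟨i, j⟩, rfl⟩ := finSigmaFinEquiv.surjective p
  rw [concat_finSigma]
  simp [idxUnit]

theorem concat_assoc {Col : Type*} {n : ℕ} {k : Fin n → ℕ} {m : ∀ i, Fin (k i) → ℕ}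
    (A : ∀ i j, Fin (m i j) → Col)
    (p : Fin (∑ p : Fin (∑ i, k i), m (finSigmaFinEquiv.symm p).1 (finSigmaFinEquiv.symm p).2)) :
    concat (fun q : Fin (∑ i, k i) => A (finSigmaFinEquiv.symm q).1 (finSigmaFinEquiv.symm q).2) p =
      concat (fun i => concat (A i)) (idxAssoc m p) := by
  obtain ⟨⟨q, l⟩, rfl⟩ := finSigmaFinEquiv.surjective p
  rw [concat_finSigma]
  simp only [idxAssoc, Equiv.trans_apply, Equiv.symm_apply_apply, concat_finSigma]
  exact (concat_finSigma (A (finSigmaFinEquiv.symm q).1) ⟨(finSigmaFinEquiv.symm q).2, l⟩).symm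

theorem concat_block {Col : Type*} {n : ℕ} (σ : Equiv.Perm (Fin n)) {k : Fin n → ℕ}
    (A : ∀ i, Fin (k i) → Col) (p : Fin (∑ i, k (σ i))) :
    concat (fun i => A (σ i)) p = concat A (idxBlock σ k p) := by
  obtain ⟨⟨i, j⟩, rfl⟩ := finSigmaFinEquiv.surjective p
  simp only [idxBlock, Equiv.trans_apply, Equiv.symm_apply_apply, concat_finSigma]
  rfl

theorem concat_sum {Col : Type*} {n : ℕ} {k : Fin n → ℕ} (τ : ∀ i, Equiv.Perm (Fin (k i)))
    (A : ∀ i, Fin (k i) → Col) (p : Fin (∑ i, k i)) :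
    concat (fun i => A i ∘ τ i) p = concat A (idxSum τ p) := by
  obtain ⟨⟨i, j⟩, rfl⟩ := finSigmaFinEquiv.surjective p
  simp only [idxSum, Equiv.trans_apply, Equiv.symm_apply_apply, concat_finSigma]
  rfl

/-- A classical coloured operad (symmetric multicategory). -/
structure Operad extends OperadData.{u} where
  act_refl : ∀ {n : ℕ} {A : Fin n → Col} {B : Col} (θ : Op A B), act (Equiv.refl _) θ = θ
  act_trans : ∀ {n : ℕ} {A : Fin n → Col} {B : Col} (σ τ : Equiv.Perm (Fin n)) (θ : Op A B),
    act τ (act σ θ) = act (τ.trans σ) θ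
  one_comp : ∀ {n : ℕ} {A : Fin n → Col} {B : Col} (θ : Op A B),
    comp (one B) (fun _ => θ) = toOperadData.relabel (idxOne n) (concat_one A) rfl θ
  comp_one : ∀ {n : ℕ} {A : Fin n → Col} {B : Col} (θ : Op A B),
    comp θ (fun i => one (A i)) = toOperadData.relabel (idxUnit n) (concat_unit A) rfl θ
  comp_assoc : ∀ {n : ℕ} {k : Fin n → ℕ} {m : ∀ i, Fin (k i) → ℕ} {C : Fin n → Col} {D : Col}
    {B : ∀ i, Fin (k i) → Col} {A : ∀ i j, Fin (m i j) → Col}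
    (θ : Op C D) (φ : ∀ i, Op (B i) (C i)) (ψ : ∀ i j, Op (A i j) (B i j)),
    comp (comp θ φ) (fun p => ψ (finSigmaFinEquiv.symm p).1 (finSigmaFinEquiv.symm p).2) =
      toOperadData.relabel (idxAssoc m) (concat_assoc A) rfl
        (comp θ (fun i => comp (φ i) (ψ i)))
  act_comp : ∀ {n : ℕ} {k : Fin n → ℕ} {B : Fin n → Col} {C : Col} {A : ∀ i, Fin (k i) → Col}
    (σ : Equiv.Perm (Fin n)) (θ : Op B C) (φ : ∀ i, Op (A i) (B i)),
    comp (act σ θ) (fun i => φ (σ i)) =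
      toOperadData.relabel (idxBlock σ k) (concat_block σ A) rfl (comp θ φ)
  comp_act : ∀ {n : ℕ} {k : Fin n → ℕ} {B : Fin n → Col} {C : Col} {A : ∀ i, Fin (k i) → Col}
    (τ : ∀ i, Equiv.Perm (Fin (k i))) (θ : Op B C) (φ : ∀ i, Op (A i) (B i)),
    comp θ (fun i => act (τ i) (φ i)) =
      toOperadData.relabel (idxSum τ) (concat_sum τ A) rfl (comp θ φ)

/-- Isomorphisms of coloured operads. -/
structure Operad.Iso (N N' : Operad.{u}) where
  col : N.Col ≃ N'.Col
  op : {n : ℕ} → {A : Fin n → N.Col} → {B : N.Col} → N.Op A B ≃ N'.Op (col ∘ A) (col B)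
  op_one : ∀ A : N.Col, op (N.one A) = N'.one (col A)
  op_comp : ∀ {n : ℕ} {B : Fin n → N.Col} {C : N.Col} {k : Fin n → ℕ}
    {A : ∀ i, Fin (k i) → N.Col} (θ : N.Op B C) (φ : ∀ i, N.Op (A i) (B i)),
    op (N.comp θ φ) = N'.comp (A := fun i => col ∘ A i) (op θ) (fun i => op (φ i))
  op_act : ∀ {n : ℕ} {A : Fin n → N.Col} {B : N.Col} (σ : Equiv.Perm (Fin n)) (θ : N.Op A B),
    op (N.act σ θ) = N'.act σ (op θ)

/-! ## The correspondence -/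

/-- An enumeration of each fibre of `f : I → J`. -/
structure FibreEnum {I J : FintypeCat.{0}} (f : I ⟶ J) where
  card : J → ℕ
  idx : ∀ j : J, Fin (card j) ≃ {i : I // f i = j}

open Prof in
/-- `M` is the non-skeletal form of the coloured operad `N` (and `N` is the classical operad
underlying `M`).

Objects of `M I` are the `I`-families of colours, with the standard reindexing, and for `f : I → J`
and `X = (A_i)`, `Y = (B_j)`,
`(M_v f)(X, Y) ≃ ∏_j N((A_i)_{i ∈ f⁻¹ j}; B_j)`, where the fibre `f⁻¹ j` is enumerated in any way.
Under these bijections the cells of pullback squares (in particular changes of the enumeration)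
act by permutation of the inputs, and the unit and laxity cells are the identities and the
composition of `N`. In particular, for `J = 1`, the colours of `N` are the objects of `M 1` and
`N(A_1, …, A_n; B) ≃ (M_v f)(X, B)` for `f : n → 1` and `X = (A_i)`. -/
structure NonSkeletalForm (N : Operad.{u}) (M : DFOperad.{u}) where
  obj : (I : FintypeCat.{0}) → M.fam I ≃ (I → N.Col)
  obj_reindex : ∀ {J K : FintypeCat.{0}} (l : J ⟶ K) (Y : M.fam K) (j : J),
    obj J ((M.reindex l).toFunctor.obj Y) j = obj K Y (l j)
  ops : {I J : FintypeCat.{0}} → {f : I ⟶ J} → (E : FibreEnum f) → {X : M.fam I} →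
    {Y : M.fam J} → Het (M.prof f) X Y ≃ ∀ j : J, N.Op (fun p => obj I X (E.idx j p).1) (obj J Y j)
  ops_cell : ∀ {I J L K : FintypeCat.{0}} {f : I ⟶ J} {g : L ⟶ K} (s : PbSq f g)
    (E : FibreEnum f) (E' : FibreEnum g) {X : M.fam L} {Y : M.fam K} (φ : Het (M.prof g) X Y)
    (j : J) (σ : Fin (E.card j) ≃ Fin (E'.card (s.right j)))
    (hσ : ∀ p, s.left (E.idx j p).1 = (E'.idx (s.right j) (σ p)).1),
    ops E (M.cellEl s φ) j =
      N.relabel σ (fun p => by rw [obj_reindex, hσ]) (obj_reindex _ _ _) (ops E' φ (s.right j))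
  ops_unit : ∀ {I : FintypeCat.{0}} (E : FibreEnum (𝟙 I)) (X : M.fam I) (i : I)
    (σ : Fin (E.card i) ≃ Fin 1),
    ops E (M.unitEl X) i =
      N.relabel σ (fun p => congrArg (obj I X) (E.idx i p).2) rfl (N.one (obj I X i))
  ops_comp : ∀ {I J K : FintypeCat.{0}} {f : I ⟶ J} {g : J ⟶ K} (E : FibreEnum f)
    (E' : FibreEnum g) (E'' : FibreEnum (f ≫ g)) {X : M.fam I} {Y : M.fam J} {Z : M.fam K}
    (φ : Het (M.prof f) X Y) (ψ : Het (M.prof g) Y Z) (k : K)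
    (σ : Fin (E''.card k) ≃ Fin (∑ q, E.card (E'.idx k q).1))
    (hσ : ∀ p, (E''.idx k p).1 =
      (E.idx (E'.idx k (finSigmaFinEquiv.symm (σ p)).1).1 (finSigmaFinEquiv.symm (σ p)).2).1),
    ops E'' (M.compEl φ ψ) k =
      N.relabel σ (fun p => congrArg (obj I X) (hσ p)) rfl
        (N.comp (ops E' ψ k) (fun q => ops E φ (E'.idx k q).1))

/-! A finite set is a sum of points, and a mapping f : I → J is, among mappings and pullback
squares, the sum of its fibres f⁻¹j → 1. Sums become products in the horizontal opposite.
Preservation of products therefore makes an object of M I a family of objects of M 1, and an element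
of (M_v f)(X, Y) a family of elements over the mappings f⁻¹j → 1. Hence everything is determined by
the elements over n → 1, which are the operations of a coloured operad. Permutations act through
invertible squares and the unit cell gives the identities. To compose θ over n → 1 with operations
φ_i over k_i → 1, the φ_i are glued to one element over the projection ∑ k_i → n, and the laxity
cell composes it with θ. By normality the arrows of M I are the elements over the identity of I, so
the categories M I carry no further data.

Conversely, an operad gives families of colours and, over each mapping, families of operations on
the enumerated fibres; pullback squares act by relabelling along the bijections of fibres. The
axioms reduce to the equality of two relabellings of one operation. Enumerations are injective, so a
bijection between enumerated fibres is determined by the elements it reaches, and it suffices to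
compare elements of a finite set. The carrying lemmas are `Operad.comp_relabel`,
`Operad.Het.comp_cell`, `Operad.Het.comp_assoc` and, for products, `Operad.Het.cell_bijective`.

From a DF operad to an operad, the main tool is `DFOperad.cell_bijective`: elements over a sum are
families of elements over the summands. Identities about glued elements are checked on each block,
which yields `DFOperad.opComp_rel`, `DFOperad.opComp_assoc` and `DFOperad.fibreOps_cmp`.

An isomorphism of operads transports families of operations (`NonSkeletalForm.elementIso`), and an
isomorphism of DF operads restricts to the mappings n → 1 (`NonSkeletalForm.operadIso`). Thus
non-skeletal forms detect isomorphism in both directions, and the statements about round trips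
follow formally.

Many equalities of objects hold only propositionally. Restrictions and composites are therefore
stated for arbitrary objects with the right colours, and elements over equal objects are compared by
heterogeneous equality. -/

/-! ## Relabelling of operations -/

namespace Operad

variable (N : Operad.{u})

/-- The map of concatenated index sets given by a bijection of blocks and bijections between
corresponding blocks. -/
def idxMap {m n : ℕ} (σ : Fin m ≃ Fin n) {k' : Fin m → ℕ} {k : Fin n → ℕ}
    (τ : ∀ i, Fin (k' i) ≃ Fin (k (σ i))) : Fin (∑ i, k' i) ≃ Fin (∑ i, k i) :=
  finSigmaFinEquiv.symm.trans ((Equiv.sigmaCongr σ τ).trans finSigmaFinEquiv)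

theorem idxMap_apply {m n : ℕ} (σ : Fin m ≃ Fin n) {k' : Fin m → ℕ} {k : Fin n → ℕ}
    (τ : ∀ i, Fin (k' i) ≃ Fin (k (σ i))) (i : Fin m) (p : Fin (k' i)) :
    idxMap σ τ (finSigmaFinEquiv ⟨i, p⟩) = finSigmaFinEquiv ⟨σ i, τ i p⟩ := by
  simp only [idxMap, Equiv.trans_apply, Equiv.symm_apply_apply]
  rfl

/-- The colours on the two sides agree only propositionally, hence the heterogeneous equality;
`relabel_eq_self` is the variant for coinciding colours. -/
theorem relabel_refl {n : ℕ} {A A' : Fin n → N.Col} {B B' : N.Col} (hA : ∀ p, A' p = A p)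
    (hB : B' = B) (θ : N.Op A B) : HEq (N.relabel (Equiv.refl _) hA hB θ) θ := by
  obtain rfl : A' = A := funext hA
  subst hB
  exact heq_of_eq (N.act_refl θ)

theorem relabel_eq_self {n : ℕ} {A : Fin n → N.Col} {B : N.Col} (σ : Fin n ≃ Fin n)
    (hA : ∀ p, A p = A (σ p)) (hσ : ∀ p, σ p = p) (θ : N.Op A B) : N.relabel σ hA rfl θ = θ := by
  obtain rfl : σ = Equiv.refl _ := Equiv.ext hσ
  exact N.act_refl θ

/-- A bijection of `Fin m` with `Fin n` forces `m = n`; after substituting sizes and colours, only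
the action axiom remains. Chains of relabellings are collapsed with this lemma before being
compared. -/
theorem relabel_relabel {l m n : ℕ} {A : Fin n → N.Col} {A' : Fin m → N.Col} {A'' : Fin l → N.Col}
    {B B' B'' : N.Col} (σ : Fin m ≃ Fin n) (τ : Fin l ≃ Fin m) (hA : ∀ p, A' p = A (σ p))
    (hB : B' = B) (hA' : ∀ p, A'' p = A' (τ p)) (hB' : B'' = B') (θ : N.Op A B) :
    N.relabel τ hA' hB' (N.relabel σ hA hB θ) =
      N.relabel (τ.trans σ) (fun p => (hA' p).trans (hA _)) (hB'.trans hB) θ := by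
  obtain rfl : m = n := by simpa using Fintype.card_congr σ
  obtain rfl : l = m := by simpa using Fintype.card_congr τ
  obtain rfl : A' = A ∘ σ := funext hA
  obtain rfl : A'' = (A ∘ σ) ∘ τ := funext hA'
  subst hB hB'
  exact N.act_trans σ τ θ

theorem relabel_congr {m n : ℕ} {A : Fin n → N.Col} {A' : Fin m → N.Col} {B B' : N.Col}
    {σ τ : Fin m ≃ Fin n} (h : ∀ p, σ p = τ p) (hA : ∀ p, A' p = A (σ p))
    (hB : B' = B) (θ : N.Op A B) :
    N.relabel σ hA hB θ = N.relabel τ (fun p => (hA p).trans (congrArg A (h p))) hB θ := by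
  obtain rfl : σ = τ := Equiv.ext h
  rfl

/-- The two equivariance axioms in one formula: rearranging the blocks and the inside of each block
is a block permutation (`act_comp`) combined with a block sum (`comp_act`), and `idxMap σ τ` is
their composite. -/
theorem comp_relabel {m n : ℕ} (σ : Fin m ≃ Fin n) {k' : Fin m → ℕ} {k : Fin n → ℕ}
    (τ : ∀ i, Fin (k' i) ≃ Fin (k (σ i))) {B : Fin n → N.Col} {B' : Fin m → N.Col} {C C' : N.Col}
    {A : ∀ i, Fin (k i) → N.Col} {A' : ∀ i, Fin (k' i) → N.Col} (hB : ∀ i, B' i = B (σ i))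
    (hC : C' = C) (hA : ∀ i p, A' i p = A (σ i) (τ i p)) (θ : N.Op B C)
    (φ : ∀ i, N.Op (A i) (B i)) :
    N.comp (N.relabel σ hB hC θ) (fun i => N.relabel (τ i) (hA i) (hB i) (φ (σ i))) =
      N.relabel (idxMap σ τ) (fun p => by
        obtain ⟨⟨i, p⟩, rfl⟩ := finSigmaFinEquiv.surjective p
        rw [idxMap_apply, concat_finSigma, concat_finSigma, hA]) hC (N.comp θ φ) := by
  obtain rfl : m = n := by simpa using Fintype.card_congr σ
  obtain rfl : k' = fun i => k (σ i) := funext fun i => by simpa using Fintype.card_congr (τ i)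
  obtain rfl : B' = B ∘ σ := funext hB
  obtain rfl : A' = fun i => A (σ i) ∘ τ i := funext fun i => funext (hA i)
  subst hC
  have h1 := N.comp_act τ (N.act σ θ) (fun i => φ (σ i))
  have h2 := N.act_comp σ θ φ
  refine h1.trans ?_
  rw [h2, relabel_relabel]
  refine N.relabel_congr (fun p => ?_) _ _ _
  obtain ⟨⟨i, p⟩, rfl⟩ := finSigmaFinEquiv.surjective p
  rw [idxMap_apply]
  simp only [idxSum, idxBlock, Equiv.trans_apply, Equiv.symm_apply_apply]
  rfl

/-- The map of concatenated index sets given by bijections between corresponding blocks. -/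
def idxMapRight {n : ℕ} {k' k : Fin n → ℕ} (τ : ∀ i, Fin (k' i) ≃ Fin (k i)) :
    Fin (∑ i, k' i) ≃ Fin (∑ i, k i) :=
  finSigmaFinEquiv.symm.trans ((Equiv.sigmaCongrRight τ).trans finSigmaFinEquiv)

theorem idxMapRight_apply {n : ℕ} {k' k : Fin n → ℕ} (τ : ∀ i, Fin (k' i) ≃ Fin (k i))
    (i : Fin n) (p : Fin (k' i)) :
    idxMapRight τ (finSigmaFinEquiv ⟨i, p⟩) = finSigmaFinEquiv ⟨i, τ i p⟩ := by
  simp only [idxMapRight, Equiv.trans_apply, Equiv.symm_apply_apply]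
  rfl

theorem comp_relabel_right {n : ℕ} {k' k : Fin n → ℕ} (τ : ∀ i, Fin (k' i) ≃ Fin (k i))
    {B : Fin n → N.Col} {C : N.Col} {A : ∀ i, Fin (k i) → N.Col} {A' : ∀ i, Fin (k' i) → N.Col}
    (hA : ∀ i p, A' i p = A i (τ i p)) (θ : N.Op B C) (φ : ∀ i, N.Op (A i) (B i)) :
    N.comp θ (fun i => N.relabel (τ i) (hA i) rfl (φ i)) =
      N.relabel (idxMapRight τ) (fun p => by
        obtain ⟨⟨i, p⟩, rfl⟩ := finSigmaFinEquiv.surjective p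
        rw [idxMapRight_apply, concat_finSigma, concat_finSigma, hA]) rfl (N.comp θ φ) := by
  obtain rfl : k' = k := funext fun i => by simpa using Fintype.card_congr (τ i)
  obtain rfl : A' = fun i => A i ∘ τ i := funext fun i => funext (hA i)
  exact N.comp_act τ θ φ

end Operad

/-! ## Pullback squares of finite sets -/

namespace PbSq

variable {I J L K : FintypeCat.{0}} {f : I ⟶ J} {g : L ⟶ K}

theorem w (s : PbSq f g) (i : I) : g (s.left i) = s.right (f i) :=
  ConcreteCategory.congr_hom s.isPullback.w i

/-- The inclusion of finite sets into types preserves and reflects pullbacks, and in types a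
pullback is a bijection with the set of compatible pairs. -/
theorem isPullback_iff {l : I ⟶ L} {r : J ⟶ K} : IsPullback l f g r ↔
    (∀ i, g (l i) = r (f i)) ∧ ∀ x j, g x = r j → ∃! i, l i = x ∧ f i = j := by
  have : IsPullback l f g r ↔ IsPullback (FintypeCat.incl.map l) (FintypeCat.incl.map f)
      (FintypeCat.incl.map g) (FintypeCat.incl.map r) :=
    ⟨fun h => h.map FintypeCat.incl, fun h => IsPullback.of_map_of_faithful FintypeCat.incl h⟩
  rw [this, Types.isPullback_iff]
  constructor
  · rintro ⟨h1, h2, h3⟩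
    refine ⟨fun i => ConcreteCategory.congr_hom h1 i, fun x j h => ?_⟩
    obtain ⟨i, hi, hi'⟩ := h3 x j h
    exact ⟨i, ⟨hi, hi'⟩, fun i' h => h2 _ _ ⟨h.1.trans hi.symm, h.2.trans hi'.symm⟩⟩
  · rintro ⟨h1, h2⟩
    refine ⟨by ext i; exact h1 i, fun i i' h => ?_, fun x j h => (h2 x j h).exists⟩
    exact (h2 (l i') (f i') (h1 i')).unique h ⟨rfl, rfl⟩

theorem existsUnique (s : PbSq f g) {x : L} {j : J} (h : g x = s.right j) :
    ∃! i, s.left i = x ∧ f i = j :=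
  (isPullback_iff.1 s.isPullback).2 x j h

theorem ext_left (s : PbSq f g) {i i' : I} (h : s.left i = s.left i') (h' : f i = f i') : i = i' :=
  (s.existsUnique (s.w i')).unique ⟨h, h'⟩ ⟨rfl, rfl⟩

/-- Pullback squares from their elementwise characterisation. -/
def ofExistsUnique (l : I → L) (r : J → K) (w : ∀ i, g (l i) = r (f i))
    (h : ∀ x j, g x = r j → ∃! i, l i = x ∧ f i = j) : PbSq f g :=
  ⟨FintypeCat.homMk l, FintypeCat.homMk r, isPullback_iff.2 ⟨w, h⟩⟩

/-- The bijection between corresponding fibres of a pullback square. -/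
noncomputable def fibreEquiv (s : PbSq f g) (j : J) :
    {i : I // f i = j} ≃ {x : L // g x = s.right j} :=
  Equiv.ofBijective (fun i => ⟨s.left i.1, by rw [s.w, i.2]⟩)
    ⟨fun i i' h => Subtype.ext (s.ext_left (congrArg Subtype.val h) (i.2.trans i'.2.symm)),
      fun x => by
        obtain ⟨i, ⟨hi, hi'⟩, _⟩ := s.existsUnique x.2
        exact ⟨⟨i, hi'⟩, Subtype.ext hi⟩⟩

/-- The induced bijection between enumerations of corresponding fibres. -/
noncomputable def idx (s : PbSq f g) (E : FibreEnum f) (E' : FibreEnum g) (j : J) :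
    Fin (E.card j) ≃ Fin (E'.card (s.right j)) :=
  (E.idx j).trans ((s.fibreEquiv j).trans (E'.idx _).symm)

/-- Since enumerations are injective, this equation determines `idx`; it is all that is used of the
construction. -/
theorem idx_spec (s : PbSq f g) (E : FibreEnum f) (E' : FibreEnum g) (j : J) (p : Fin (E.card j)) :
    s.left (E.idx j p).1 = (E'.idx (s.right j) (s.idx E E' j p)).1 := by
  simp only [idx, Equiv.trans_apply, Equiv.apply_symm_apply]
  rfl

end PbSq

/-! ### Enumerations of fibres and of fibres of composites -/

namespace FibreEnum

variable {I J K : FintypeCat.{0}}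

/-- A chosen enumeration of the fibres. -/
noncomputable def std (f : I ⟶ J) : FibreEnum f where
  card j := Nat.card {i : I // f i = j}
  idx _ := (Finite.equivFin _).symm

theorem ext_idx {f : I ⟶ J} (E : FibreEnum f) {j : J} {p q : Fin (E.card j)}
    (h : (E.idx j p).1 = (E.idx j q).1) : p = q :=
  (E.idx j).injective (Subtype.ext h)

theorem ext_idx' {f : I ⟶ J} (E : FibreEnum f) {j j' : J} {p : Fin (E.card j)}
    {q : Fin (E.card j')} (h : (E.idx j p).1 = (E.idx j' q).1) :
    (⟨j, p⟩ : (j : J) × Fin (E.card j)) = ⟨j', q⟩ := by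
  obtain rfl : j = j' := (E.idx j p).2.symm.trans ((congrArg f h).trans (E.idx j' q).2)
  rw [show p = _ from E.ext_idx h]

/-- The bijection between enumerations of equal fibres. -/
def castIdx {f : I ⟶ J} (E : FibreEnum f) {a b : J} (h : a = b) :
    Fin (E.card a) ≃ Fin (E.card b) :=
  finCongr (congrArg E.card h)

theorem castIdx_spec {f : I ⟶ J} (E : FibreEnum f) {a b : J} (h : a = b) (p : Fin (E.card a)) :
    (E.idx b (E.castIdx h p)).1 = (E.idx a p).1 := by
  subst h
  rfl

theorem exists_idx {f : I ⟶ J} (E : FibreEnum f) {i : I} {j : J} (h : f i = j) :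
    ∃ p, (E.idx j p).1 = i :=
  ⟨(E.idx j).symm ⟨i, h⟩, by simp⟩

variable {f : I ⟶ J} {g : J ⟶ K} {h : I ⟶ K}

/-- The elements of a fibre of a composite, enumerated by concatenation. -/
def concatIdx (E : FibreEnum f) (E' : FibreEnum g) (k : K) (x : Fin (∑ q, E.card (E'.idx k q).1)) :
    I :=
  (E.idx (E'.idx k (finSigmaFinEquiv.symm x).1).1 (finSigmaFinEquiv.symm x).2).1

theorem concatIdx_finSigma (E : FibreEnum f) (E' : FibreEnum g) (k : K) (q : Fin (E'.card k))
    (p : Fin (E.card (E'.idx k q).1)) :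
    E.concatIdx E' k (finSigmaFinEquiv ⟨q, p⟩) = (E.idx (E'.idx k q).1 p).1 := by
  rw [concatIdx, Equiv.symm_apply_apply]

theorem concatIdx_injective (E : FibreEnum f) (E' : FibreEnum g) {k : K}
    {x y : Fin (∑ q, E.card (E'.idx k q).1)} (h : E.concatIdx E' k x = E.concatIdx E' k y) :
    x = y := by
  obtain ⟨⟨q, p⟩, rfl⟩ := finSigmaFinEquiv.surjective x
  obtain ⟨⟨q', p'⟩, rfl⟩ := finSigmaFinEquiv.surjective y
  rw [concatIdx_finSigma, concatIdx_finSigma] at h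
  obtain rfl : q = q' := E'.ext_idx (congrArg Sigma.fst (E.ext_idx' h))
  rw [E.ext_idx h]

theorem apply_concatIdx (E : FibreEnum f) (E' : FibreEnum g) (k : K)
    (x : Fin (∑ q, E.card (E'.idx k q).1)) : g (f (E.concatIdx E' k x)) = k := by
  rw [concatIdx, (E.idx _ _).2, (E'.idx _ _).2]

/-- The bijection between the enumeration of a fibre of a composite and the concatenated
enumeration. -/
noncomputable def compIdx (E : FibreEnum f) (E' : FibreEnum g) (E'' : FibreEnum h) (e : f ≫ g = h)
    (k : K) : Fin (E''.card k) ≃ Fin (∑ q, E.card (E'.idx k q).1) :=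
  ((Equiv.ofBijective (fun x => (E''.idx k).symm
      ⟨E.concatIdx E' k x, (ConcreteCategory.congr_hom e.symm _).trans (E.apply_concatIdx E' k x)⟩)
    ⟨fun x y hxy => E.concatIdx_injective E'
        (congrArg Subtype.val ((E''.idx k).symm.injective hxy)),
      fun p => by
        have hp : g (f (E''.idx k p).1) = k :=
          (ConcreteCategory.congr_hom e _).trans (E''.idx k p).2
        -- Surjectivity: first the intermediate point `f i` is found in the fibre of `g`, then `i`
        -- in the fibre of `f` over it.
        obtain ⟨q, hq⟩ := E'.exists_idx hp
        obtain ⟨r, hr⟩ := E.exists_idx hq.symm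
        refine ⟨finSigmaFinEquiv ⟨q, r⟩, (E''.idx k).symm_apply_eq.2 (Subtype.ext ?_)⟩
        exact (E.concatIdx_finSigma E' k q r).trans hr⟩)).symm

/-- Together with `concatIdx_injective` this characterises `compIdx`, so relabellings of composites
can be compared on elements of `I`. -/
theorem compIdx_spec (E : FibreEnum f) (E' : FibreEnum g) (E'' : FibreEnum h) (e : f ≫ g = h)
    (k : K) (p : Fin (E''.card k)) :
    (E''.idx k p).1 = E.concatIdx E' k (E.compIdx E' E'' e k p) := by
  obtain ⟨x, rfl⟩ := (E.compIdx E' E'' e k).symm.surjective p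
  rw [Equiv.apply_symm_apply]
  exact congrArg Subtype.val ((E''.idx k).apply_symm_apply _)

end FibreEnum

namespace Operad

variable (N : Operad.{u}) {I J : FintypeCat.{0}} {f : I ⟶ J}

/-- Relabellings of the members of a family of operations indexed by the enumerated fibres are
determined by the induced map to the domain. -/
theorem relabel_fibre (E : FibreEnum f) {X : I → N.Col} {Y : J → N.Col}
    (φ : ∀ j, N.Op (fun p => X (E.idx j p).1) (Y j)) {a b : J} (hab : a = b) {m : ℕ}
    {A : Fin m → N.Col} {B : N.Col} (σ : Fin m ≃ Fin (E.card a)) (hA : ∀ p, A p = X (E.idx a (σ p)).1)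
    (hB : B = Y a) :
    N.relabel σ hA hB (φ a) = N.relabel (σ.trans (E.castIdx hab))
      (fun p => (hA p).trans (congrArg X (E.castIdx_spec hab _).symm)) (hB.trans (congrArg Y hab))
      (φ b) := by
  subst hab
  exact N.relabel_congr (fun p => rfl) _ _ _

/-- Operations at propositionally equal indices have different types. Relabelling by `castIdx`
replaces the transport, so that the calculus of relabellings applies to it. -/
theorem eq_relabel_fibre (E : FibreEnum f) {X : I → N.Col} {Y : J → N.Col}
    (φ : ∀ j, N.Op (fun p => X (E.idx j p).1) (Y j)) {a b : J} (hab : a = b) :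
    φ a = N.relabel (E.castIdx hab) (fun p => congrArg X (E.castIdx_spec hab p).symm)
      (congrArg Y hab) (φ b) := by
  subst hab
  exact (N.relabel_eq_self _ _ (fun _ => rfl) _).symm

end Operad

/-! ## Families of operations over mappings of finite sets -/

namespace Operad

variable (N : Operad.{u})

/-- Families of operations over a mapping of finite sets with enumerated fibres. -/
def Het {I J : FintypeCat.{0}} {f : I ⟶ J} (E : FibreEnum f) (X : I → N.Col) (Y : J → N.Col) :
    Type u :=
  ∀ j, N.Op (fun p => X (E.idx j p).1) (Y j)

variable {N} {I J K L : FintypeCat.{0}}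

/-- Restriction along a pullback square. -/
noncomputable def Het.cell {f : I ⟶ J} {g : L ⟶ K} (s : PbSq f g) {E : FibreEnum f}
    {E' : FibreEnum g} {X : L → N.Col} {Y : K → N.Col}
    {X' : I → N.Col} {Y' : J → N.Col} (hX : ∀ i, X' i = X (s.left i))
    (hY : ∀ j, Y' j = Y (s.right j)) (φ : N.Het E' X Y) : N.Het E X' Y' := fun j =>
  N.relabel (s.idx _ _ j) (fun p => (hX _).trans (congrArg X (s.idx_spec _ _ j p))) (hY j)
    (φ (s.right j))

theorem concat_compIdx {f : I ⟶ J} {g : J ⟶ K} {h : I ⟶ K} (e : f ≫ g = h) (E : FibreEnum f)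
    (E' : FibreEnum g) (E'' : FibreEnum h) {C : Type u} (X : I → C) (k : K)
    (p : Fin (E''.card k)) : X (E''.idx k p).1 =
      concat (fun q p => X (E.idx (E'.idx k q).1 p).1) (E.compIdx E' E'' e k p) :=
  congrArg X (FibreEnum.compIdx_spec _ _ _ e k p)

/-- Composition of families of operations. -/
noncomputable def Het.comp {f : I ⟶ J} {g : J ⟶ K} {h : I ⟶ K} (e : f ≫ g = h) {E : FibreEnum f}
    {E' : FibreEnum g} {E'' : FibreEnum h} {X : I → N.Col} {Y : J → N.Col} {Z : K → N.Col}
    (φ : N.Het E X Y) (ψ : N.Het E' Y Z) : N.Het E'' X Z := fun k =>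
  N.relabel (E.compIdx E' E'' e k) (concat_compIdx e E E' E'' X k) rfl
    (N.comp (ψ k) (fun q => φ (E'.idx k q).1))

theorem card_fibre_id (E : FibreEnum (𝟙 I)) (i : I) : E.card i = 1 := by
  have : Unique {i' : I // (𝟙 I : I ⟶ I) i' = i} := ⟨⟨⟨i, rfl⟩⟩, fun x => Subtype.ext x.2⟩
  simpa using Fintype.card_congr ((E.idx i).trans (Equiv.ofUnique _ (Fin 1)))

theorem idx_id (E : FibreEnum (𝟙 I)) (i : I) (p : Fin (E.card i)) : (E.idx i p).1 = i :=
  (E.idx i p).2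

/-- The family of identity operations. -/
noncomputable def Het.one (E : FibreEnum (𝟙 I)) (X : I → N.Col) : N.Het E X X := fun i =>
  N.relabel (finCongr (card_fibre_id E i)) (fun p => congrArg X (idx_id E i p)) rfl (N.one (X i))

theorem Het.cell_id {f : I ⟶ J} (s : PbSq f f) (hl : ∀ i, s.left i = i) (hr : ∀ j, s.right j = j)
    {E : FibreEnum f} {X : I → N.Col} {Y : J → N.Col} (hX : ∀ i, X i = X (s.left i))
    (hY : ∀ j, Y j = Y (s.right j)) (φ : N.Het E X Y) : φ.cell s hX hY = φ := by
  obtain rfl : s = ⟨𝟙 I, 𝟙 J, IsPullback.of_horiz_isIso ⟨by simp⟩⟩ :=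
    PbSq.ext (FintypeCat.hom_ext _ _ hl) (FintypeCat.hom_ext _ _ hr)
  refine funext fun j => N.relabel_eq_self _ _ (fun p => FibreEnum.ext_idx _ ?_) _
  exact (PbSq.idx_spec _ E _ j p).symm

/-- Both sides relabel the same operation, along bijections that send an index to the same element
of `I'`; injectivity of the enumeration `E''` makes them equal. -/
theorem Het.cell_cell {I' J' : FintypeCat.{0}} {f : I ⟶ J} {g : L ⟶ K} {h : I' ⟶ J'}
    {E : FibreEnum f} {E' : FibreEnum g} {E'' : FibreEnum h}
    (s : PbSq f g) (t : PbSq g h) (st : PbSq f h) (hl : ∀ i, t.left (s.left i) = st.left i)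
    (hr : ∀ j, t.right (s.right j) = st.right j) {X : I' → N.Col} {Y : J' → N.Col}
    {X' : L → N.Col} {Y' : K → N.Col} {X'' : I → N.Col} {Y'' : J → N.Col}
    (hX : ∀ x, X' x = X (t.left x)) (hY : ∀ y, Y' y = Y (t.right y))
    (hX' : ∀ i, X'' i = X' (s.left i)) (hY' : ∀ j, Y'' j = Y' (s.right j)) (φ : N.Het E'' X Y) :
    (φ.cell (E := E') t hX hY).cell (E := E) s hX' hY' = φ.cell st
      (fun i => (hX' i).trans ((hX _).trans (congrArg X (hl i))))
      (fun j => (hY' j).trans ((hY _).trans (congrArg Y (hr j)))) := by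
  obtain rfl : st = ⟨s.left ≫ t.left, s.right ≫ t.right, s.isPullback.paste_horiz t.isPullback⟩ :=
    PbSq.ext (FintypeCat.hom_ext _ _ fun i => (hl i).symm)
      (FintypeCat.hom_ext _ _ fun j => (hr j).symm)
  refine funext fun j => ?_
  unfold cell
  rw [relabel_relabel]
  refine N.relabel_congr (fun p => FibreEnum.ext_idx _ ?_) _ _ _
  refine ((PbSq.idx_spec t _ _ _ _).symm.trans ?_).trans (PbSq.idx_spec
    (⟨s.left ≫ t.left, s.right ≫ t.right, _⟩ : PbSq f h) E _ _ _)
  exact congrArg t.left (s.idx_spec _ _ _ _).symm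

theorem Het.cell_one (s : PbSq (𝟙 I) (𝟙 L)) {E : FibreEnum (𝟙 I)} {E' : FibreEnum (𝟙 L)}
    {X : L → N.Col} {X' : I → N.Col}
    (hX : ∀ i, X' i = X (s.left i)) (hX' : ∀ i, X' i = X (s.right i)) :
    (Het.one E' X).cell s hX hX' = Het.one E X' := by
  refine funext fun j => ?_
  -- Identities at equal colours have different types and are linked by a trivial relabelling. Both
  -- sides then relabel one identity along bijections onto a one-element set, and such bijections
  -- coincide.
  have h (a b : N.Col) (hab : a = b) : N.one a = N.relabel (Equiv.refl _) (fun _ => hab) hab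
      (N.one b) := by
    subst hab
    exact (N.act_refl _).symm
  unfold cell one
  rw [relabel_relabel, h _ _ (hX' j), relabel_relabel]
  exact N.relabel_congr (fun p => Subsingleton.elim _ _) _ _ _

/-- Composing restricted operations means composing relabelled ones, so `comp_relabel` pulls all
relabellings outside. What remains is an equality of bijections, checked on elements of `I'`. -/
theorem Het.comp_cell {I' J' K' : FintypeCat.{0}} {f : I ⟶ J} {g : J ⟶ K} {h : I ⟶ K}
    {f' : I' ⟶ J'} {g' : J' ⟶ K'} {h' : I' ⟶ K'} (e : f ≫ g = h) (e' : f' ≫ g' = h')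
    {E₁ : FibreEnum f} {E₂ : FibreEnum g} {E₃ : FibreEnum h} {E₁' : FibreEnum f'}
    {E₂' : FibreEnum g'} {E₃' : FibreEnum h'}
    (s : PbSq f f') (t : PbSq g g') (st : PbSq h h') (hst : ∀ j, s.right j = t.left j)
    (hl : ∀ i, st.left i = s.left i) (hr : ∀ k, st.right k = t.right k)
    {X : I' → N.Col} {Y : J' → N.Col} {Z : K' → N.Col} {X' : I → N.Col} {Y' : J → N.Col}
    {Z' : K → N.Col} (hX : ∀ i, X' i = X (s.left i)) (hY : ∀ j, Y' j = Y (s.right j))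
    (hY' : ∀ j, Y' j = Y (t.left j)) (hZ : ∀ k, Z' k = Z (t.right k)) (φ : N.Het E₁' X Y)
    (ψ : N.Het E₂' Y Z) :
    Het.comp e (φ.cell s hX hY : N.Het E₁ X' Y') (ψ.cell t hY' hZ : N.Het E₂ Y' Z') =
      ((φ.comp e' ψ : N.Het E₃' X Z).cell st (fun i => (hX i).trans (congrArg X (hl i).symm))
        (fun k => (hZ k).trans (congrArg Z (hr k).symm)) : N.Het E₃ X' Z') := by
  obtain ⟨l, r, hp⟩ := st
  obtain rfl : l = s.left := FintypeCat.hom_ext _ _ hl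
  obtain rfl : r = t.right := FintypeCat.hom_ext _ _ hr
  refine funext fun k => ?_
  -- The inner operations sit at `s.right` of a point of the fibre of `g`, while the restricted
  -- composite uses the enumerated points of the fibre of `g'`. These agree only propositionally,
  -- and `relabel_fibre` passes from one to the other.
  have hq (q) : s.right (E₂.idx k q).1 = (E₂'.idx _ (t.idx _ E₂' k q)).1 :=
    (hst _).trans (t.idx_spec _ E₂' k q)
  have key (q) : φ.cell s hX hY (E₂.idx k q).1 = _ :=
    N.relabel_fibre E₁' φ (hq q) (s.idx E₁ _ _) _ _
  have key2 := N.comp_relabel (t.idx _ E₂' k)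
    (fun q => (s.idx E₁ _ (E₂.idx k q).1).trans (E₁'.castIdx (hq q)))
    (fun q => (hY' _).trans (congrArg Y (t.idx_spec _ E₂' k q))) (hZ k)
    (fun q p => (hX _).trans ((congrArg X ((s.idx_spec _ _ _ _).trans
      ((FibreEnum.castIdx_spec _ (hq q) _).symm)))))
    (ψ (t.right k)) (fun q => φ (E₂'.idx (t.right k) q).1)
  refine (congrArg (N.relabel _ (concat_compIdx e E₁ E₂ E₃ X' k) _)
    ((congrArg (N.comp _) (funext key)).trans key2)).trans ?_
  unfold cell comp
  rw [relabel_relabel, relabel_relabel]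
  refine N.relabel_congr (fun p => FibreEnum.concatIdx_injective _ _ ?_) _ _ _
  refine Eq.trans ?_ (FibreEnum.compIdx_spec _ _ E₃' e' _ _)
  refine Eq.trans ?_ (PbSq.idx_spec (⟨s.left, t.right, hp⟩ : PbSq h h') E₃ _ _ _)
  rw [FibreEnum.compIdx_spec E₁ E₂ _ e k p]
  simp only [Equiv.trans_apply]
  generalize E₁.compIdx E₂ _ e k p = x
  obtain ⟨⟨q, r⟩, rfl⟩ := finSigmaFinEquiv.surjective x
  rw [idxMap_apply, FibreEnum.concatIdx_finSigma, FibreEnum.concatIdx_finSigma]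
  exact (FibreEnum.castIdx_spec _ (hq q) _).trans (s.idx_spec _ _ _ _).symm

/-- Composition is in diagrammatic order: identities on the left are plugged into the inputs of `φ`,
so this is the law `comp_one` of `N`, and `Het.comp_one` rests on `one_comp`. -/
theorem Het.one_comp {f : I ⟶ J} (e : 𝟙 I ≫ f = f) {E : FibreEnum f} {E' : FibreEnum (𝟙 I)}
    {X : I → N.Col} {Y : J → N.Col}
    (φ : N.Het E X Y) : (Het.one E' X).comp e φ = φ := by
  refine funext fun j => ?_
  have key1 := N.comp_relabel_right (fun q => finCongr (card_fibre_id E' (E.idx j q).1))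
    (fun q p => congrArg X (idx_id _ _ p)) (φ j) (fun q => N.one _)
  rw [N.comp_one] at key1
  refine (congrArg (N.relabel _ (concat_compIdx e E' E E X j) _) key1).trans ?_
  rw [relabel_relabel, relabel_relabel]
  refine N.relabel_eq_self _ _ (fun p => FibreEnum.ext_idx _ ?_) _
  refine Eq.trans ?_ (FibreEnum.compIdx_spec E' E E e j p).symm
  simp only [Equiv.trans_apply]
  generalize E'.compIdx E _ e j p = x
  obtain ⟨⟨q, r⟩, rfl⟩ := finSigmaFinEquiv.surjective x
  rw [idxMapRight_apply, FibreEnum.concatIdx_finSigma, idx_id]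
  simp [idxUnit]

theorem Het.comp_one {f : I ⟶ J} (e : f ≫ 𝟙 J = f) {E : FibreEnum f} {E' : FibreEnum (𝟙 J)}
    {X : I → N.Col} {Y : J → N.Col}
    (φ : N.Het E X Y) : φ.comp e (Het.one E' Y) = φ := by
  refine funext fun j => ?_
  have hq (q) := idx_id E' j q
  have key1 := N.comp_relabel (finCongr (card_fibre_id E' j))
    (fun q => E.castIdx (hq q)) (fun q => congrArg Y (hq q)) rfl
    (fun q p => congrArg X (FibreEnum.castIdx_spec _ (hq q) p).symm) (N.one (Y j)) (fun _ => φ j)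
  rw [N.one_comp, relabel_relabel] at key1
  have key2 (q) := N.eq_relabel_fibre E φ (hq q)
  refine (congrArg (N.relabel _ (concat_compIdx e E E' E X j) _)
    ((congrArg (N.comp _) (funext key2)).trans key1)).trans ?_
  rw [relabel_relabel]
  refine N.relabel_eq_self _ _ (fun p => FibreEnum.ext_idx _ ?_) _
  refine Eq.trans ?_ (FibreEnum.compIdx_spec E E' E e j p).symm
  simp only [Equiv.trans_apply]
  generalize E.compIdx E' E e j p = x
  obtain ⟨⟨q, r⟩, rfl⟩ := finSigmaFinEquiv.surjective x
  rw [idxMap_apply, FibreEnum.concatIdx_finSigma]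
  refine Eq.trans ?_ (FibreEnum.castIdx_spec _ (hq q) r)
  simp [idxOne, Equiv.uniqueSigma]

theorem idxAssoc_apply {n : ℕ} {k : Fin n → ℕ} (m : ∀ i, Fin (k i) → ℕ) (p : Fin (∑ i, k i))
    (t : Fin (m (finSigmaFinEquiv.symm p).1 (finSigmaFinEquiv.symm p).2)) :
    idxAssoc m (finSigmaFinEquiv ⟨p, t⟩) = finSigmaFinEquiv ⟨(finSigmaFinEquiv.symm p).1,
      finSigmaFinEquiv ⟨(finSigmaFinEquiv.symm p).2, t⟩⟩ := by
  simp only [idxAssoc, Equiv.trans_apply, Equiv.symm_apply_apply]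
  rfl

/-- Associativity of the enumeration of a fibre of a threefold composite by concatenation. -/
def idxTriple {f : I ⟶ J} {g : J ⟶ K} {h : K ⟶ L} (F : FibreEnum f) (G : FibreEnum g)
    (H : FibreEnum h) (l : L) : Fin (∑ p, F.card (G.concatIdx H l p)) ≃
      Fin (∑ q, ∑ r, F.card (G.idx (H.idx l q).1 r).1) :=
  idxAssoc (fun q r => F.card (G.idx (H.idx l q).1 r).1)

theorem concat_concatIdx {f : I ⟶ J} {g : J ⟶ K} {h : K ⟶ L} (F : FibreEnum f) (G : FibreEnum g)
    (H : FibreEnum h) {C : Type u} (X : I → C) (l : L)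
    (x : Fin (∑ p, F.card (G.concatIdx H l p))) :
    concat (fun p r => X (F.idx (G.concatIdx H l p) r).1) x =
      concat (fun q => concat fun r t => X (F.idx (G.idx (H.idx l q).1 r).1 t).1)
        (idxTriple F G H l x) :=
  concat_assoc (fun q r t => X (F.idx (G.idx (H.idx l q).1 r).1 t).1) x

/-- The elements of a fibre of a threefold composite, enumerated by iterated concatenation. -/
def tripleIdx {f : I ⟶ J} {g : J ⟶ K} {h : K ⟶ L} (F : FibreEnum f) (G : FibreEnum g)
    (H : FibreEnum h) (l : L) (x : Fin (∑ q, ∑ r, F.card (G.idx (H.idx l q).1 r).1)) : I :=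
  F.concatIdx G (H.idx l (finSigmaFinEquiv.symm x).1).1 (finSigmaFinEquiv.symm x).2

theorem tripleIdx_finSigma {f : I ⟶ J} {g : J ⟶ K} {h : K ⟶ L} (F : FibreEnum f) (G : FibreEnum g)
    (H : FibreEnum h) (l : L) (q : Fin (H.card l))
    (y : Fin (∑ r, F.card (G.idx (H.idx l q).1 r).1)) :
    tripleIdx F G H l (finSigmaFinEquiv ⟨q, y⟩) = F.concatIdx G (H.idx l q).1 y := by
  rw [tripleIdx, Equiv.symm_apply_apply]

theorem tripleIdx_injective {f : I ⟶ J} {g : J ⟶ K} {h : K ⟶ L} (F : FibreEnum f) (G : FibreEnum g)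
    (H : FibreEnum h) (l : L) {x y : Fin (∑ q, ∑ r, F.card (G.idx (H.idx l q).1 r).1)}
    (hxy : tripleIdx F G H l x = tripleIdx F G H l y) : x = y := by
  obtain ⟨⟨q, x⟩, rfl⟩ := finSigmaFinEquiv.surjective x
  obtain ⟨⟨q', y⟩, rfl⟩ := finSigmaFinEquiv.surjective y
  rw [tripleIdx_finSigma, tripleIdx_finSigma] at hxy
  have hq := congrArg (fun i => g (f i)) hxy
  simp only [FibreEnum.apply_concatIdx] at hq
  obtain rfl : q = q' := H.ext_idx hq
  rw [F.concatIdx_injective G hxy]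

theorem tripleIdx_idxTriple {f : I ⟶ J} {g : J ⟶ K} {h : K ⟶ L} (F : FibreEnum f)
    (G : FibreEnum g) (H : FibreEnum h) (l : L) (p : Fin (∑ q, G.card (H.idx l q).1))
    (t : Fin (F.card (G.concatIdx H l p))) :
    tripleIdx F G H l (idxTriple F G H l (finSigmaFinEquiv ⟨p, t⟩)) = (F.idx (G.concatIdx H l p) t).1 := by
  refine (congrArg _ (idxAssoc_apply (fun q r => F.card (G.idx (H.idx l q).1 r).1) p t)).trans ?_
  rw [tripleIdx_finSigma]
  exact FibreEnum.concatIdx_finSigma _ _ _ _ _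

/-- The associativity axiom at the points of iterated fibres; unfolding `concatIdx` and `idxTriple`
makes the index sets match those of `N.comp_assoc`. -/
theorem comp_comp_fibre {f : I ⟶ J} {g : J ⟶ K} {h : K ⟶ L} (F : FibreEnum f) (G : FibreEnum g)
    (H : FibreEnum h) {X : I → N.Col} {Y : J → N.Col} {Z : K → N.Col} {W : L → N.Col}
    (φ : N.Het F X Y) (ψ : N.Het G Y Z) (θ : N.Het H Z W) (l : L) :
    N.comp (N.comp (θ l) (fun q => ψ (H.idx l q).1)) (fun p => φ (G.concatIdx H l p)) =
      N.relabel (idxTriple F G H l) (concat_concatIdx F G H X l) rfl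
        (N.comp (θ l) (fun q => N.comp (ψ _) (fun r => φ (G.idx (H.idx l q).1 r).1))) :=
  N.comp_assoc (θ l) (fun q => ψ (H.idx l q).1) (fun q r => φ (G.idx (H.idx l q).1 r).1)

/-- Both sides are relabellings of the same nested composite of `θ`, `ψ` and `φ`: the left one by
equivariance in the inner operations, the right one by equivariance and the associativity axiom. -/
theorem Het.comp_assoc {f : I ⟶ J} {g : J ⟶ K} {h : K ⟶ L} {fg : I ⟶ K} {gh : J ⟶ L} {fgh : I ⟶ L}
    (e : f ≫ g = fg) (e' : g ≫ h = gh) (e₁ : fg ≫ h = fgh) (e₂ : f ≫ gh = fgh)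
    {F : FibreEnum f} {G : FibreEnum g} {H : FibreEnum h} {FG : FibreEnum fg} {GH : FibreEnum gh}
    {FGH : FibreEnum fgh}
    {X : I → N.Col} {Y : J → N.Col} {Z : K → N.Col} {W : L → N.Col} (φ : N.Het F X Y)
    (ψ : N.Het G Y Z) (θ : N.Het H Z W) :
    (Het.comp e₁ (φ.comp e ψ : N.Het FG X Z) θ : N.Het FGH X W) =
      Het.comp e₂ φ (ψ.comp e' θ : N.Het GH Y W) := by
  refine funext fun l => ?_
  have hq (p) := FibreEnum.compIdx_spec G H GH e' l p
  have key1 := N.comp_relabel_right (fun q => F.compIdx G FG e (H.idx l q).1)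
    (fun q p => concat_compIdx e F G FG X (H.idx l q).1 p) (θ l)
    (fun q => N.comp (ψ _) (fun r => φ (G.idx (H.idx l q).1 r).1))
  have key2 := N.comp_relabel (G.compIdx H GH e' l) (fun p => F.castIdx (hq p))
    (concat_compIdx e' G H GH Y l) rfl
    (fun p r => congrArg X (FibreEnum.castIdx_spec _ (hq p) r).symm)
    (N.comp (θ l) (fun q => ψ (H.idx l q).1))
    (fun p => φ (G.concatIdx H l p))
  have key3 (p) := N.eq_relabel_fibre F φ (hq p)
  have key4 := comp_comp_fibre F G H φ ψ θ l
  have l1 : Het.comp e₁ (φ.comp e ψ : N.Het FG X Z) θ l = _ :=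
    (congrArg (N.relabel (FG.compIdx H FGH e₁ l) (concat_compIdx e₁ FG H FGH X l) rfl) key1).trans
      (N.relabel_relabel _ _ _ _ _ _ _)
  have l2 : Het.comp e₂ φ (ψ.comp e' θ : N.Het GH Y W) l = _ :=
    (congrArg (N.relabel (F.compIdx GH FGH e₂ l) (concat_compIdx e₂ F GH FGH X l) rfl)
      ((congrArg (N.comp _) (funext key3)).trans (key2.trans ((congrArg (N.relabel _ _ rfl)
        key4).trans (N.relabel_relabel _ _ _ _ _ _ _))))).trans
      (N.relabel_relabel _ _ _ _ _ _ _)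
  refine l1.trans (Eq.trans (N.relabel_congr (fun p => ?_) _ _ _) l2.symm)
  -- Both bijections recover the point of `I` enumerated by `FGH`, and iterated concatenation lists
  -- each point once.
  apply tripleIdx_injective
  simp only [Equiv.trans_apply]
  trans (FGH.idx l p).1
  · rw [FibreEnum.compIdx_spec FG H _ e₁]
    generalize FG.compIdx H FGH e₁ l p = x
    obtain ⟨⟨q, r⟩, rfl⟩ := finSigmaFinEquiv.surjective x
    rw [idxMapRight_apply, tripleIdx_finSigma, FibreEnum.concatIdx_finSigma]
    exact (FibreEnum.compIdx_spec F G FG e _ r).symm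
  · rw [FibreEnum.compIdx_spec F GH _ e₂]
    generalize F.compIdx GH FGH e₂ l p = x
    obtain ⟨⟨q, r⟩, rfl⟩ := finSigmaFinEquiv.surjective x
    rw [idxMap_apply, FibreEnum.concatIdx_finSigma]
    refine Eq.trans ?_ (tripleIdx_idxTriple F G H l _ _).symm
    exact (FibreEnum.castIdx_spec _ (hq q) r).symm

end Operad

/-! ## Sums of finite sets and of pullback squares -/

namespace FintypeCat

variable {T : Type} {I : T → FintypeCat.{0}} {S : FintypeCat.{0}} (ι : ∀ a, I a ⟶ S)

/-- A family of mappings of finite sets is jointly bijective. -/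
def JointlyBijective : Prop := Function.Bijective fun x : (a : T) × I a => ι x.1 x.2

variable {ι}

/-- A jointly bijective family exhibits a product in the opposite category. -/
noncomputable def JointlyBijective.isLimit (h : JointlyBijective ι) :
    IsLimit (Fan.mk (op S) fun a => (ι a).op) :=
  Fan.IsLimit.mk _
    (fun s => (FintypeCat.homMk fun x => (s.proj ((Equiv.ofBijective _ h).symm x).1).unop
      ((Equiv.ofBijective _ h).symm x).2).op)
    (fun s a => by
      apply Quiver.Hom.unop_inj
      refine FintypeCat.hom_ext _ _ fun x => ?_
      change (s.proj ((Equiv.ofBijective _ h).symm (ι a x)).1).unop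
        ((Equiv.ofBijective _ h).symm (ι a x)).2 = _
      rw [show ι a x = Equiv.ofBijective _ h ⟨a, x⟩ from rfl, Equiv.symm_apply_apply])
    (fun s m hm => by
      apply Quiver.Hom.unop_inj
      refine FintypeCat.hom_ext _ _ fun x => ?_
      obtain ⟨⟨a, x⟩, rfl⟩ := (Equiv.ofBijective _ h).surjective x
      change _ = (s.proj ((Equiv.ofBijective _ h).symm _).1).unop
        ((Equiv.ofBijective _ h).symm _).2
      rw [Equiv.symm_apply_apply, ← hm a]
      rfl)

theorem jointlyBijective_sigma [Finite T] (I : T → FintypeCat.{0}) :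
    JointlyBijective (S := FintypeCat.of ((a : T) × I a))
      fun a => FintypeCat.homMk fun x => ⟨a, x⟩ :=
  Function.bijective_id

end FintypeCat

open FintypeCat in
-- Sums are stable under pullback: the decomposition of `R` pulls back along `g` to a decomposition
-- of `S`.
theorem PbSq.jointlyBijective_left {T : Type} {I J : T → FintypeCat.{0}}
    {f : ∀ a, I a ⟶ J a} {S R : FintypeCat.{0}} {g : S ⟶ R} (s : ∀ a, PbSq (f a) g)
    (h : JointlyBijective fun a => (s a).right) : JointlyBijective fun a => (s a).left := by
  constructor
  · rintro ⟨a, x⟩ ⟨b, y⟩ hxy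
    dsimp only at hxy
    have h1 := congrArg g hxy
    rw [(s a).w, (s b).w] at h1
    have h2 := h.1 (a₁ := ⟨a, f a x⟩) (a₂ := ⟨b, f b y⟩) h1
    obtain rfl : a = b := congrArg Sigma.fst h2
    rw [(s a).ext_left hxy (eq_of_heq (Sigma.mk.inj h2).2)]
  · intro x
    obtain ⟨⟨a, y⟩, hy⟩ := h.2 (g x)
    obtain ⟨i, hi, -⟩ := (s a).existsUnique hy.symm
    exact ⟨⟨a, i⟩, hi.1⟩

section

open FintypeCat

variable {T : Type} {I J : T → FintypeCat.{0}} {f : ∀ a, I a ⟶ J a} {S R : FintypeCat.{0}}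
  {g : S ⟶ R}

/-- An arrow of `ℙb`, as an object of the category `A₁` of the horizontal opposite. -/
abbrev pbOne {I J : FintypeCat.{0}} (f : I ⟶ J) : (pbDouble FintypeCat.{0}).hop.One :=
  DoubleCategory.One.mk (dom := op I) (cod := op J) f

/-- A pullback square, as an arrow of the category `A₁` of the horizontal opposite. -/
def PbSq.toOne {I J L K : FintypeCat.{0}} {f : I ⟶ J} {g : L ⟶ K} (s : PbSq f g) :
    pbOne g ⟶ pbOne f := s

/-- The pullback square on a sum given by pullback squares on the summands. -/
noncomputable def PbSq.desc {L K : FintypeCat.{0}} {k : L ⟶ K} (s : ∀ a, PbSq (f a) g)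
    (h : JointlyBijective fun a => (s a).right) (t : ∀ a, PbSq (f a) k) : PbSq g k :=
  let eL := Equiv.ofBijective _ (PbSq.jointlyBijective_left s h)
  let eR := Equiv.ofBijective _ h
  PbSq.ofExistsUnique (fun x => (t (eL.symm x).1).left (eL.symm x).2)
    (fun y => (t (eR.symm y).1).right (eR.symm y).2)
    (fun x => by
      obtain ⟨⟨a, x⟩, rfl⟩ := eL.surjective x
      rw [Equiv.symm_apply_apply, (t a).w]
      -- `g` sends the summand of index `a` into the summand of index `a`, so both sides of the new
      -- square are computed with the same member of `t`.
      have : eR.symm (g (eL ⟨a, x⟩)) = ⟨a, f a x⟩ := by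
        rw [Equiv.symm_apply_eq]
        exact (s a).w x
      rw [this])
    (fun x y hxy => by
      obtain ⟨⟨a, y⟩, rfl⟩ := eR.surjective y
      rw [Equiv.symm_apply_apply] at hxy
      obtain ⟨i, hi, hu⟩ := (t a).existsUnique hxy
      refine ⟨eL ⟨a, i⟩, ⟨?_, ?_⟩, ?_⟩
      · dsimp only
        rw [Equiv.symm_apply_apply]
        exact hi.1
      · refine ((s a).w i).trans ?_
        rw [hi.2]
        rfl
      · rintro x' ⟨h1, h2⟩
        obtain ⟨⟨b, x'⟩, rfl⟩ := eL.surjective x'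
        rw [Equiv.symm_apply_apply] at h1
        have h3 := eR.injective (a₁ := ⟨b, f b x'⟩) (((s b).w x').symm.trans h2)
        obtain rfl : b = a := congrArg Sigma.fst h3
        rw [hu x' ⟨h1, eq_of_heq (Sigma.mk.inj h3).2⟩])

theorem PbSq.desc_left {L K : FintypeCat.{0}} {k : L ⟶ K} (s : ∀ a, PbSq (f a) g)
    (h : JointlyBijective fun a => (s a).right) (t : ∀ a, PbSq (f a) k) (a : T) (x : I a) :
    (PbSq.desc s h t).left ((s a).left x) = (t a).left x := by
  change (t ((Equiv.ofBijective _ (PbSq.jointlyBijective_left s h)).symm _).1).left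
    ((Equiv.ofBijective _ (PbSq.jointlyBijective_left s h)).symm _).2 = _
  rw [show (s a).left x = Equiv.ofBijective _ (PbSq.jointlyBijective_left s h) ⟨a, x⟩ from rfl,
    Equiv.symm_apply_apply]

theorem PbSq.desc_right {L K : FintypeCat.{0}} {k : L ⟶ K} (s : ∀ a, PbSq (f a) g)
    (h : JointlyBijective fun a => (s a).right) (t : ∀ a, PbSq (f a) k) (a : T) (y : J a) :
    (PbSq.desc s h t).right ((s a).right y) = (t a).right y := by
  change (t ((Equiv.ofBijective _ h).symm _).1).right ((Equiv.ofBijective _ h).symm _).2 = _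
  rw [show (s a).right y = Equiv.ofBijective _ h ⟨a, y⟩ from rfl, Equiv.symm_apply_apply]

/-- A family of pullback squares with jointly bijective right sides exhibits a product in the
category `A₁` of the horizontal opposite. -/
noncomputable def PbSq.isLimit (s : ∀ a, PbSq (f a) g)
    (h : JointlyBijective fun a => (s a).right) :
    IsLimit (Fan.mk (pbOne g) fun a => (s a).toOne) :=
  Fan.IsLimit.mk _ (fun c => (PbSq.desc (k := c.pt.pro) s h fun a => c.proj a))
    (fun c a => PbSq.ext
      (FintypeCat.hom_ext _ _ fun x => PbSq.desc_left (k := c.pt.pro) s h (fun a => c.proj a) a x)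
      (FintypeCat.hom_ext _ _ fun x => PbSq.desc_right (k := c.pt.pro) s h (fun a => c.proj a) a x))
    (fun c m hm => PbSq.ext
      (FintypeCat.hom_ext _ _ fun x => by
        obtain ⟨⟨a, x⟩, rfl⟩ := (PbSq.jointlyBijective_left s h).2 x
        refine Eq.trans ?_ (PbSq.desc_left (k := c.pt.pro) s h (fun a => c.proj a) a x).symm
        rw [← hm a]
        rfl)
      (FintypeCat.hom_ext _ _ fun x => by
        obtain ⟨⟨a, x⟩, rfl⟩ := h.2 x
        refine Eq.trans ?_ (PbSq.desc_right (k := c.pt.pro) s h (fun a => c.proj a) a x).symm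
        rw [← hm a]
        rfl))

end

/-! ## Products of categories -/

section

variable {T : Type} {C : T → Cat.{u, u}} {P : Cat.{u, u}} {π : ∀ a, P ⟶ C a}

/-- Objects and arrows are lifted separately. The lifted object projects to the prescribed one only
up to propositional equality, so an arrow is lifted after conjugation by `eqToHom`; functoriality
and uniqueness are then checked componentwise. -/
theorem Cat.existsUnique_lift (ho : Function.Bijective fun (X : P) a => (π a).toFunctor.obj X)
    (hm : ∀ X Y : P, Function.Bijective fun (f : X ⟶ Y) a => (π a).toFunctor.map f) {D : Cat.{u, u}} (F : ∀ a, D ⟶ C a) :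
    ∃! G : D ⟶ P, ∀ a, G ≫ π a = F a := by
  choose obj hobj using fun d : D => ho.2 fun a => (F a).toFunctor.obj d
  replace hobj (d : D) (a : T) : (π a).toFunctor.obj (obj d) = (F a).toFunctor.obj d :=
    congrFun (hobj d) a
  choose map hmap using fun (d d' : D) (g : d ⟶ d') => (hm (obj d) (obj d')).2 fun a =>
    eqToHom (hobj d a) ≫ (F a).toFunctor.map g ≫ eqToHom (hobj d' a).symm
  replace hmap (d d' : D) (g : d ⟶ d') (a : T) : (π a).toFunctor.map (map d d' g) =
    eqToHom (hobj d a) ≫ (F a).toFunctor.map g ≫ eqToHom (hobj d' a).symm :=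
    congrFun (hmap d d' g) a
  let G : D ⥤ P :=
    { obj := obj
      map := fun {d d'} g => map d d' g
      map_id := fun d => (hm _ _).1 (funext fun a => by simp [hmap])
      map_comp := fun g g' => (hm _ _).1 (funext fun a => by simp [hmap]) }
  have hG (a) : G ⋙ (π a).toFunctor = (F a).toFunctor :=
    CategoryTheory.Functor.ext (fun d => hobj d a) fun d d' g => hmap d d' g a
  refine ⟨G.toCatHom, fun a => Cat.ext (hG a), fun G' hG' => Cat.ext ?_⟩
  have hG'' (a) : G'.toFunctor ⋙ (π a).toFunctor = (F a).toFunctor :=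
    congrArg Cat.Hom.toFunctor (hG' a)
  have h0 (d) : G'.toFunctor.obj d = G.obj d := ho.1 (funext fun a =>
    (Functor.congr_obj (hG'' a) d).trans (Functor.congr_obj (hG a) d).symm)
  refine CategoryTheory.Functor.ext h0 fun d d' g => (hm _ _).1 (funext fun a => ?_)
  have h1 := Functor.congr_hom ((hG'' a).trans (hG a).symm) g
  simpa [eqToHom_map] using h1

/-- A family of functors which is jointly bijective on objects and on arrows exhibits a
product of categories. -/
noncomputable def Cat.fanIsLimit
    (ho : Function.Bijective fun (X : P) a => (π a).toFunctor.obj X)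
    (hm : ∀ X Y : P, Function.Bijective fun (f : X ⟶ Y) a => (π a).toFunctor.map f) : IsLimit (Fan.mk P π) :=
  Fan.IsLimit.mk _ (fun s => (Cat.existsUnique_lift ho hm fun a => s.proj a).choose)
    (fun s a => (Cat.existsUnique_lift ho hm fun a => s.proj a).choose_spec.1 a)
    (fun s m h => (Cat.existsUnique_lift ho hm fun a => s.proj a).choose_spec.2 m h)

end

/-! ## Products of profunctors -/

open Prof

/-- A profunctor, as an object of the category `A₁` of profunctors and cells. -/
abbrev profOne {C D : Cat.{u, u}} (Φ : Prof C D) : catDouble.{u}.One :=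
  DoubleCategory.One.mk (dom := C) (cod := D) Φ

/-- A cell, as an arrow of the category `A₁` of profunctors and cells. -/
def Prof.Cell.toOne {C D C' D' : Cat.{u, u}} {Φ : Prof C D} {Ψ : Prof C' D'} (α : Cell Φ Ψ) :
    profOne Φ ⟶ profOne Ψ := α

namespace Prof

/-- The objects over which elements lie are often identified only through equalities between sides
of cells; this lemma and the next ones let such elements be compared without transports. -/
theorem Cell.app_heq {C D C' D' : Cat.{u, u}} {Φ : Prof C D} {Ψ : Prof C' D'} (α : Cell Φ Ψ)
    {X X' : C} {Y Y' : D} (hX : X = X') (hY : Y = Y') {φ : Het Φ X Y} {φ' : Het Φ X' Y'}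
    (h : HEq φ φ') : HEq (α.app φ) (α.app φ') := by
  subst hX hY
  obtain rfl := eq_of_heq h
  rfl

theorem Cell.app_congr {C D C' D' : Cat.{u, u}} {Φ : Prof C D} {Ψ : Prof C' D'} {α β : Cell Φ Ψ}
    (h : α = β) {X : C} {Y : D} (φ : Het Φ X Y) : HEq (α.app φ) (β.app φ) := by
  rw [h]

theorem pre_map_heq {C D C' : Cat.{u, u}} (Φ : Prof C' D) {F G : C ⟶ C'} (h : F = G) {X X' : C}
    (f : X' ⟶ X) {Y Y' : D} (hY : Y = Y') {φ : Het Φ (F.toFunctor.obj X) Y}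
    {ψ : Het Φ (G.toFunctor.obj X) Y'} (hφ : HEq φ ψ) :
    HEq (pre Φ (F.toFunctor.map f) φ) (pre Φ (G.toFunctor.map f) ψ) := by
  subst h hY
  obtain rfl := eq_of_heq hφ
  rfl

theorem post_map_heq {C D D' : Cat.{u, u}} (Φ : Prof C D') {F G : D ⟶ D'} (h : F = G) {X X' : C}
    (hX : X = X') {Y Y' : D} (g : Y ⟶ Y') {φ : Het Φ X (F.toFunctor.obj Y)}
    {ψ : Het Φ X' (G.toFunctor.obj Y)} (hφ : HEq φ ψ) :
    HEq (post Φ φ (F.toFunctor.map g)) (post Φ ψ (G.toFunctor.map g)) := by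
  subst h hX
  obtain rfl := eq_of_heq hφ
  rfl

variable {T : Type} {C D : T → Cat.{u, u}} {P Q : Cat.{u, u}} {Ψ : ∀ a, Prof (C a) (D a)}
  {Φ : Prof P Q} {π : ∀ a, Cell Φ (Ψ a)}

/-- With the sides prescribed, elements are lifted one at a time; naturality holds in each
component, and the components are jointly injective. Uniqueness is settled in `Cell.fanIsLimit`,
where the sides are unique by their own product property. -/
theorem Cell.existsUnique_lift
    (hb : ∀ X Y, Function.Bijective fun (φ : Het Φ X Y) a => (π a).app φ)
    {B E : Cat.{u, u}} {Θ : Prof B E} (α : ∀ a, Cell Θ (Ψ a)) (L : B ⟶ P) (R : E ⟶ Q)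
    (hL : ∀ a, L ≫ (π a).left = (α a).left) (hR : ∀ a, R ≫ (π a).right = (α a).right) :
    ∃ β : Cell Θ Φ, β.left = L ∧ β.right = R ∧ ∀ a, Cell.hcomp β (π a) = α a := by
  have hobjL (X) (a) : (α a).left.toFunctor.obj X = (π a).left.toFunctor.obj (L.toFunctor.obj X) :=
    congrArg (fun F => F.toFunctor.obj X) (hL a).symm
  have hobjR (Y) (a) : (α a).right.toFunctor.obj Y =
      (π a).right.toFunctor.obj (R.toFunctor.obj Y) :=
    congrArg (fun F => F.toFunctor.obj Y) (hR a).symm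
  choose app happ using fun (X : B) (Y : E) (φ : Het Θ X Y) =>
    (hb (L.toFunctor.obj X) (R.toFunctor.obj Y)).2 fun a =>
      cast (by rw [hobjL, hobjR]) ((α a).app φ)
  replace happ (X : B) (Y : E) (φ : Het Θ X Y) (a : T) :
      HEq ((π a).app (app X Y φ)) ((α a).app φ) :=
    (heq_of_eq (congrFun (happ X Y φ) a)).trans (cast_heq _ _)
  let β : Cell Θ Φ :=
    { left := L
      right := R
      app := fun {X Y} φ => app X Y φ
      app_pre := fun {X' X Y} f φ => (hb _ _).1 (funext fun a => eq_of_heq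
        (((happ _ _ _ a).trans (heq_of_eq ((α a).app_pre f φ))).trans
          ((pre_map_heq (Ψ a) (hL a).symm f (hobjR Y a) (happ _ _ φ a).symm).trans
            (heq_of_eq ((π a).app_pre (L.toFunctor.map f) (app X Y φ)).symm))))
      app_post := fun {X Y Y'} φ g => (hb _ _).1 (funext fun a => eq_of_heq
        (((happ _ _ _ a).trans (heq_of_eq ((α a).app_post φ g))).trans
          ((post_map_heq (Ψ a) (hR a).symm (hobjL X a) g (happ _ _ φ a).symm).trans
            (heq_of_eq ((π a).app_post (app X Y φ) (R.toFunctor.map g)).symm)))) }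
  exact ⟨β, rfl, rfl, fun a => Cell.ext_heq (hL a) (hR a) fun X Y φ => happ X Y φ a⟩

/-- A family of cells which is jointly bijective on elements, with sides exhibiting products of
categories, exhibits a product of profunctors. -/
noncomputable def Cell.fanIsLimit (hl : IsLimit (Fan.mk P fun a => (π a).left))
    (hr : IsLimit (Fan.mk Q fun a => (π a).right))
    (hb : ∀ X Y, Function.Bijective fun (φ : Het Φ X Y) a => (π a).app φ) :
    IsLimit (Fan.mk (profOne Φ) fun a => (π a).toOne) :=
  have key (s : Fan fun a => profOne (Ψ a)) := Cell.existsUnique_lift hb (Θ := s.pt.pro)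
    (fun a => s.proj a) (hl.lift (Fan.mk _ fun a => Cell.left (s.proj a)))
    (hr.lift (Fan.mk _ fun a => Cell.right (s.proj a)))
    (fun a => hl.fac (Fan.mk _ fun a => Cell.left (s.proj a)) ⟨a⟩)
    (fun a => hr.fac (Fan.mk _ fun a => Cell.right (s.proj a)) ⟨a⟩)
  Fan.IsLimit.mk _ (fun s => (key s).choose) (fun s a => (key s).choose_spec.2.2 a)
    (fun s m hm => by
      have hβ := (key s).choose_spec
      generalize (key s).choose = β at hβ ⊢
      have hL : Cell.left m = β.left := hl.hom_ext fun ⟨a⟩ =>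
        (congrArg Cell.left (hm a)).trans (congrArg Cell.left (hβ.2.2 a)).symm
      have hR : Cell.right m = β.right := hr.hom_ext fun ⟨a⟩ =>
        (congrArg Cell.right (hm a)).trans (congrArg Cell.right (hβ.2.2 a)).symm
      refine Cell.ext_heq hL hR fun X Y φ => ?_
      have h (a) : HEq ((π a).app (Cell.app m φ)) ((π a).app (β.app φ)) :=
        Cell.app_congr ((hm a).trans (hβ.2.2 a).symm) φ
      obtain ⟨l, r, m, _, _⟩ := m
      obtain ⟨l', r', b, _, _⟩ := β
      dsimp only at hL hR h ⊢
      subst hL hR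
      exact heq_of_eq ((hb _ _).1 (funext fun a => eq_of_heq (h a))))

/-- The total set of elements of a profunctor. -/
def Tot {C D : Cat.{u, u}} (Φ : Prof C D) : Type u := Σ (X : C) (Y : D), Het Φ X Y

/-- The action of a cell on the total set of elements. -/
def Cell.tot {C D C' D' : Cat.{u, u}} {Φ : Prof C D} {Ψ : Prof C' D'} (α : Cell Φ Ψ)
    (x : Tot Φ) : Tot Ψ :=
  ⟨_, _, α.app x.2.2⟩

theorem tot_mk_eq {C D : Cat.{u, u}} {Φ : Prof C D} {X X' : C} {Y Y' : D} {φ : Het Φ X Y}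
    {φ' : Het Φ X' Y'} : (⟨X, Y, φ⟩ : Tot Φ) = ⟨X', Y', φ'⟩ ↔ X = X' ∧ Y = Y' ∧ HEq φ φ' := by
  constructor
  · intro h
    cases h
    exact ⟨rfl, rfl, HEq.rfl⟩
  · rintro ⟨rfl, rfl, h⟩
    rw [eq_of_heq h]

/-- The profunctor with a single element, on the terminal category. -/
def pt : Prof (Cat.of (Discrete PUnit.{u + 1})) (Cat.of (Discrete PUnit.{u + 1})) :=
  (Functor.const _).obj ((Functor.const _).obj PUnit)

theorem punit_hom_eq_id (f : (⟨⟨⟩⟩ : Cat.of (Discrete PUnit.{u + 1})) ⟶ ⟨⟨⟩⟩) : f = 𝟙 _ :=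
  @Subsingleton.elim ((⟨⟨⟩⟩ : Discrete PUnit.{u + 1}) ⟶ ⟨⟨⟩⟩) _ _ _

theorem punit_functor_ext {C : Cat.{u, u}} {F G : Cat.of (Discrete PUnit.{u + 1}) ⟶ C}
    (h : F.toFunctor.obj ⟨⟨⟩⟩ = G.toFunctor.obj ⟨⟨⟩⟩) : F = G := by
  refine Cat.ext (CategoryTheory.Functor.ext (fun ⟨⟨⟩⟩ => h) fun ⟨⟨⟩⟩ ⟨⟨⟩⟩ f => ?_)
  obtain rfl := punit_hom_eq_id f
  have hF := F.toFunctor.map_id ⟨⟨⟩⟩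
  have hG := G.toFunctor.map_id ⟨⟨⟩⟩
  refine hF.trans (Eq.trans ?_ (congrArg (fun k => eqToHom h ≫ k ≫ eqToHom h.symm) hG).symm)
  simp

/-- Elements of a profunctor are cells from the single element profunctor. -/
def Cell.ofTot {C D : Cat.{u, u}} {Φ : Prof C D} (x : Tot Φ) : Cell pt Φ where
  left := Functor.toCatHom (D := C) (Discrete.functor fun _ => x.1)
  right := Functor.toCatHom (D := D) (Discrete.functor fun _ => x.2.1)
  app _ := x.2.2
  app_pre {X' X Y} f φ := by
    obtain ⟨⟨⟩⟩ := X
    obtain ⟨⟨⟩⟩ := X'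
    obtain rfl := punit_hom_eq_id f
    exact (pre_id Φ x.2.2).symm
  app_post {X Y Y'} φ f := by
    obtain ⟨⟨⟩⟩ := Y
    obtain ⟨⟨⟩⟩ := Y'
    obtain rfl := punit_hom_eq_id f
    exact (post_id Φ x.2.2).symm

theorem Cell.ofTot_hcomp {C D C' D' : Cat.{u, u}} {Φ : Prof C D} {Ψ : Prof C' D'} (α : Cell Φ Ψ)
    (x : Tot Φ) : Cell.hcomp (Cell.ofTot x) α = Cell.ofTot (α.tot x) := by
  refine Cell.ext_heq ?_ ?_ fun _ _ _ => HEq.rfl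
  all_goals exact punit_functor_ext rfl

/-- Elements are cells out of `pt`, so `Tot` is representable and turns a product cone into a
bijection. This extracts elements from an abstract product; the objects below the elements are not
fixed here. -/
theorem Cell.tot_bijective (h : IsLimit (Fan.mk (profOne Φ) fun a => (π a).toOne)) :
    Function.Bijective fun (x : Tot Φ) a => (π a).tot x := by
  constructor
  · intro x y hxy
    have : (Cell.ofTot x).toOne = (Cell.ofTot y).toOne := Fan.IsLimit.hom_ext h _ _ fun a =>
      (Cell.ofTot_hcomp (π a) x).trans
        ((congrArg Cell.ofTot (congrFun hxy a)).trans (Cell.ofTot_hcomp (π a) y).symm)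
    exact congrArg (fun α : Cell pt Φ => α.tot ⟨⟨⟨⟩⟩, ⟨⟨⟩⟩, PUnit.unit⟩) this
  · intro y
    let β : Cell pt Φ := h.lift (Fan.mk (profOne pt) fun a => (Cell.ofTot (y a)).toOne)
    refine ⟨β.tot ⟨⟨⟨⟩⟩, ⟨⟨⟩⟩, PUnit.unit⟩, funext fun a => ?_⟩
    have := h.fac (Fan.mk (profOne pt) fun a => (Cell.ofTot (y a)).toOne) ⟨a⟩
    exact congrArg (fun α : Cell pt (Ψ a) => α.tot ⟨⟨⟨⟩⟩, ⟨⟨⟩⟩, PUnit.unit⟩) this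

end Prof

/-! ## The DF operad of a coloured operad -/

namespace Operad

variable (N : Operad.{u}) {I J K L : FintypeCat.{0}}

/-- Families of colours. -/
def Fam (I : FintypeCat.{0}) : Type u := I → N.Col

/-- An arrow is an element over the identity mapping, that is, a family of unary operations. With
this choice the identity profunctor is definitionally `prof (𝟙 I)`, which gives normality by `rfl`.
-/
noncomputable instance (I : FintypeCat.{0}) : Category.{u} (N.Fam I) where
  Hom X Y := N.Het (FibreEnum.std (𝟙 I)) X Y
  id X := Het.one _ X
  comp φ ψ := Het.comp (Category.id_comp _) φ ψ
  id_comp φ := Het.one_comp _ φ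
  comp_id φ := Het.comp_one _ φ
  assoc φ ψ θ := Het.comp_assoc _ _ _ _ φ ψ θ

/-- The identity square of a mapping. -/
def vsq (l : I ⟶ L) : PbSq (𝟙 I) (𝟙 L) := (pbDouble FintypeCat.{0}).vidSq l

/-- Reindexing of families of colours. -/
noncomputable def famMap (l : I ⟶ L) : N.Fam L ⥤ N.Fam I where
  obj X := fun i => X (l i)
  map φ := Het.cell (vsq l) (fun _ => rfl) (fun _ => rfl) φ
  map_id _ := Het.cell_one _ _ _
  map_comp φ ψ := (Het.comp_cell _ _ (vsq l) (vsq l) (vsq l) (fun _ => rfl) (fun _ => rfl)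
    (fun _ => rfl) _ _ _ _ φ ψ).symm

theorem famMap_id (I : FintypeCat.{0}) : N.famMap (𝟙 I) = 𝟭 _ :=
  Functor.hext (fun _ => rfl) fun X Y φ => heq_of_eq <|
    Het.cell_id (vsq (𝟙 I)) (fun _ => rfl) (fun _ => rfl) (fun _ => rfl) (fun _ => rfl)
      (show N.Het (FibreEnum.std (𝟙 I)) X Y from φ)

theorem famMap_comp (k : I ⟶ J) (l : J ⟶ L) : N.famMap (k ≫ l) = N.famMap l ⋙ N.famMap k :=
  Functor.hext (fun _ => rfl) fun X Y φ => heq_of_eq <| Eq.symm <|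
    Het.cell_cell (vsq k) (vsq l) (vsq (k ≫ l)) (fun _ => rfl) (fun _ => rfl) (fun _ => rfl)
      (fun _ => rfl) (fun _ => rfl) (fun _ => rfl) (show N.Het (FibreEnum.std (𝟙 L)) X Y from φ)

/-- The functor of families of colours. -/
noncomputable def famFunctor : FintypeCat.{0}ᵒᵖ ⥤ Cat.{u, u} where
  obj I := Cat.of (N.Fam I.unop)
  map k := (N.famMap k.unop).toCatHom
  map_id I := Cat.ext (N.famMap_id I.unop)
  map_comp k l := Cat.ext (N.famMap_comp l.unop k.unop)

/-- The profunctor of families of operations over a mapping. -/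
noncomputable def prof (f : I ⟶ J) : Prof (Cat.of (N.Fam I)) (Cat.of (N.Fam J)) :=
  Prof.mk (fun X Y => N.Het (FibreEnum.std f) X Y)
    (fun g φ => Het.comp (Category.id_comp f) g φ)
    (fun φ g => Het.comp (Category.comp_id f) φ g)
    (fun φ => Het.one_comp _ φ) (fun φ => Het.comp_one _ φ)
    (fun g h φ => Het.comp_assoc _ _ _ _ g h φ)
    (fun φ g h => (Het.comp_assoc _ _ _ _ φ g h).symm)
    (fun g φ h => (Het.comp_assoc _ _ _ _ g φ h).symm)

/-- The action of a pullback square on families of operations. -/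
noncomputable def sqCell {f : I ⟶ J} {g : L ⟶ K} (s : PbSq f g) : Cell (N.prof g) (N.prof f) where
  left := (N.famMap s.left).toCatHom
  right := (N.famMap s.right).toCatHom
  app φ := Het.cell s (fun _ => rfl) (fun _ => rfl) φ
  app_pre h φ := (Het.comp_cell (Category.id_comp f) (Category.id_comp g) (vsq s.left) s s
    (fun _ => rfl) (fun _ => rfl) (fun _ => rfl) (fun _ => rfl) (fun _ => rfl) (fun _ => rfl)
    (fun _ => rfl) h φ).symm
  app_post φ h := (Het.comp_cell (Category.comp_id f) (Category.comp_id g) s (vsq s.right) s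
    (fun _ => rfl) (fun _ => rfl) (fun _ => rfl) (fun _ => rfl) (fun _ => rfl) (fun _ => rfl)
    (fun _ => rfl) φ h).symm

/-- The unit cell. -/
noncomputable def unitCell (I : FintypeCat.{0}) :
    Cell (Prof.hom (Cat.of (N.Fam I))) (N.prof (𝟙 I)) where
  left := 𝟙 _
  right := 𝟙 _
  app φ := φ
  app_pre _ _ := rfl
  app_post _ _ := rfl

/-- Composition of families of operations as a cell. -/
noncomputable def compCell (f : I ⟶ J) (g : J ⟶ K) :
    Cell (Prof.comp (N.prof f) (N.prof g)) (N.prof (f ≫ g)) where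
  left := 𝟙 _
  right := 𝟙 _
  app := CompHet.lift (fun _ φ ψ => Het.comp rfl φ ψ)
    (fun _ _ φ h ψ => Het.comp_assoc _ _ _ _ φ h ψ)
  app_pre h x := by
    induction x using CompHet.ind with | h _ φ ψ =>
    exact Het.comp_assoc _ _ _ _ h φ ψ
  app_post x h := by
    induction x using CompHet.ind with | h _ φ ψ =>
    exact (Het.comp_assoc _ _ _ _ φ ψ h).symm

/-- Substituting the common side turns the transport inside `Cell.vcomp` into an identity, and the
claim becomes `Het.comp_cell`. Keeping `st` arbitrary lets it be the square produced by the
horizontal opposite. -/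
theorem compCell_natural {I' J' K' : FintypeCat.{0}} {f : I ⟶ J} {g : J ⟶ K} {f' : I' ⟶ J'}
    {g' : J' ⟶ K'} (s : PbSq f' f) (t : PbSq g' g) (e : s.right = t.left) (st : PbSq (f' ≫ g') (f ≫ g))
    (hl : st.left = s.left) (hr : st.right = t.right) :
    Cell.hcomp (Cell.vcomp (N.sqCell s) (N.sqCell t) (congrArg (fun l => (N.famMap l).toCatHom) e))
      (N.compCell f' g') = Cell.hcomp (N.compCell f g) (N.sqCell st) := by
  obtain ⟨l, r, hs⟩ := s
  obtain ⟨l', r', ht⟩ := t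
  obtain ⟨l'', r'', hst⟩ := st
  dsimp only at e hl hr
  subst e hl hr
  refine Cell.ext_heq rfl rfl fun X Z x => heq_of_eq ?_
  induction x using CompHet.ind with | h Y φ ψ =>
  have h := pre_id (N.prof g') ((N.sqCell ⟨r, r'', ht⟩).app ψ)
  refine (congrArg (fun ψ' : N.Het (FibreEnum.std g') _ _ => (Het.comp rfl
    (Het.cell ⟨l'', r, hs⟩ (fun _ => rfl) (fun _ => rfl) φ) ψ' :
      N.Het (FibreEnum.std (f' ≫ g')) _ _)) h).trans ?_
  exact Het.comp_cell rfl rfl ⟨l'', r, hs⟩ ⟨r, r'', ht⟩ ⟨l'', r'', hst⟩ (fun _ => rfl)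
    (fun _ => rfl) (fun _ => rfl) (fun _ => rfl) (fun _ => rfl) (fun _ => rfl) (fun _ => rfl) φ ψ

/-- Stated for any square with identity sides, to cover the associativity and unit cells of pullback
squares: composition of mappings is strictly associative and unital. -/
theorem sqCell_id (f : I ⟶ J) (s : PbSq f f) (hl : s.left = 𝟙 I) (hr : s.right = 𝟙 J) :
    N.sqCell s = Cell.hid (N.prof f) := by
  obtain ⟨l, r, hs⟩ := s
  dsimp only at hl hr
  subst hl hr
  refine Cell.ext_heq (Cat.ext (N.famMap_id I)) (Cat.ext (N.famMap_id J)) fun X Y φ => heq_of_eq ?_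
  exact Het.cell_id ⟨𝟙 I, 𝟙 J, hs⟩ (fun _ => rfl) (fun _ => rfl) (fun _ => rfl) (fun _ => rfl)
    (show N.Het (FibreEnum.std f) X Y from φ)

theorem sqCell_comp {I' J' : FintypeCat.{0}} {f : I ⟶ J} {g : L ⟶ K} {h : I' ⟶ J'}
    (s : PbSq f g) (t : PbSq g h) :
    N.sqCell ((pbDouble _).hcomp s t) = Cell.hcomp (N.sqCell t) (N.sqCell s) := by
  refine Cell.ext_heq (Cat.ext (N.famMap_comp s.left t.left))
    (Cat.ext (N.famMap_comp s.right t.right)) fun X Y φ => heq_of_eq (Eq.symm ?_)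
  exact Het.cell_cell s t _ (fun _ => rfl) (fun _ => rfl) (fun _ => rfl) (fun _ => rfl)
    (fun _ => rfl) (fun _ => rfl) (show N.Het (FibreEnum.std h) X Y from φ)

theorem compCell_assoc (f : I ⟶ J) (g : J ⟶ K) (k : K ⟶ L) :
    Cell.hcomp (Cell.vcomp (N.compCell f g) (Cell.hid (N.prof k)) rfl) (N.compCell (f ≫ g) k) =
      Cell.hcomp (Cell.assoc _ _ _) (Cell.hcomp (Cell.vcomp (Cell.hid (N.prof f)) (N.compCell g k)
        rfl) (N.compCell f (g ≫ k))) := by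
  refine Cell.ext_heq rfl rfl fun X Z x => heq_of_eq ?_
  induction x using CompHet.ind with | h _ x θ =>
  induction x using CompHet.ind with | h _ φ ψ =>
  have h1 := pre_id (N.prof k) θ
  have h2 := pre_id (N.prof (g ≫ k)) ((N.compCell g k).app (tmul _ _ ψ θ))
  refine (congrArg (fun θ' : N.Het (FibreEnum.std k) _ _ => (Het.comp rfl
    (Het.comp rfl φ ψ : N.Het (FibreEnum.std (f ≫ g)) _ _) θ' :
      N.Het (FibreEnum.std ((f ≫ g) ≫ k)) _ _)) h1).trans ?_
  refine Eq.trans ?_ (congrArg (fun θ' : N.Het (FibreEnum.std (g ≫ k)) _ _ => (Het.comp rfl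
    φ θ' : N.Het (FibreEnum.std (f ≫ g ≫ k)) _ _)) h2).symm
  exact Het.comp_assoc rfl rfl rfl rfl φ ψ θ

theorem unitCell_comp (f : I ⟶ J) :
    Cell.hcomp (Cell.vcomp (N.unitCell I) (Cell.hid (N.prof f)) rfl) (N.compCell (𝟙 I) f) =
      Cell.lunit (N.prof f) := by
  refine Cell.ext_heq rfl rfl fun X Z x => heq_of_eq ?_
  induction x using CompHet.ind with | h _ g φ =>
  have h1 := pre_id (N.prof f) φ
  exact congrArg (fun φ' : N.Het (FibreEnum.std f) _ _ => (Het.comp rfl (show N.Het _ _ _ from g) φ' :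
      N.Het (FibreEnum.std (𝟙 I ≫ f)) _ _)) h1

theorem compCell_unit (f : I ⟶ J) :
    Cell.hcomp (Cell.vcomp (Cell.hid (N.prof f)) (N.unitCell J) rfl) (N.compCell f (𝟙 J)) =
      Cell.runit (N.prof f) := by
  refine Cell.ext_heq rfl rfl fun X Z x => heq_of_eq ?_
  induction x using CompHet.ind with | h _ φ g =>
  have h1 := pre_id (N.prof (𝟙 J)) ((N.unitCell J).app g)
  exact congrArg (fun g' : N.Het (FibreEnum.std (𝟙 J)) _ _ => (Het.comp rfl φ g' :
      N.Het (FibreEnum.std (f ≫ 𝟙 J)) _ _)) h1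

/-- The lax double functor of families of operations. -/
noncomputable def laxDoubleFunctor :
    LaxDoubleFunctor (pbDouble FintypeCat.{0}).hop catDouble.{u} where
  h := N.famFunctor
  pro f := N.prof f
  sq s := N.sqCell s
  left_sq _ := rfl
  right_sq _ := rfl
  sq_hid f := N.sqCell_id f _ rfl rfl
  sq_hcomp s t := N.sqCell_comp t s
  unit I := N.unitCell I.unop
  left_unit _ := rfl
  right_unit _ := rfl
  comp f g := N.compCell f g
  left_comp _ _ := rfl
  right_comp _ _ := rfl
  unit_natural _ := Cell.ext_heq rfl rfl fun _ _ _ => HEq.rfl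
  comp_natural s t e := N.compCell_natural s t (Quiver.Hom.op_inj e) _ rfl rfl
  comp_assoc f g k := (congrArg (fun α => Cell.hcomp _ (Cell.hcomp (N.compCell (f ≫ g) k) α))
    (N.sqCell_id ((f ≫ g) ≫ k) _ rfl rfl)).trans (N.compCell_assoc f g k)
  unit_comp f := (congrArg (fun α => Cell.hcomp _ (Cell.hcomp (N.compCell (𝟙 _) f) α))
    (N.sqCell_id f _ rfl rfl)).trans (N.unitCell_comp f)
  comp_unit f := (congrArg (fun α => Cell.hcomp _ (Cell.hcomp (N.compCell f (𝟙 _)) α))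
    (N.sqCell_id f _ rfl rfl)).trans (N.compCell_unit f)

theorem laxDoubleFunctor_normal : N.laxDoubleFunctor.Normal := fun _ => ⟨rfl, rfl⟩

end Operad

/-- A dependent product may be reindexed along a bijection and changed factor by factor. With
currying, this says that families over a sum are families of families. -/
theorem Function.Bijective.piMap_comp {A K : Type*} {e : A → K} (he : Function.Bijective e)
    {P : K → Type*} {Q : A → Type*} {r : ∀ a, P (e a) → Q a}
    (hr : ∀ a, Function.Bijective (r a)) :
    Function.Bijective fun (φ : ∀ k, P k) a => r a (φ (e a)) :=
  ((Equiv.piCongrRight fun a => Equiv.ofBijective _ (hr a)).bijective).comp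
    ((Equiv.ofBijective e he).piCongrLeft P).symm.bijective

/-! ### Preservation of products by families of colours and operations -/

namespace Operad

open FintypeCat

variable (N : Operad.{u}) {I J K L : FintypeCat.{0}}

theorem relabel_bijective {m n : ℕ} {A : Fin n → N.Col} {A' : Fin m → N.Col} {B B' : N.Col}
    (σ : Fin m ≃ Fin n) (hA : ∀ p, A' p = A (σ p)) (hB : B' = B) :
    Function.Bijective (N.relabel σ hA hB) := by
  refine Function.bijective_iff_has_inverse.2 ⟨N.relabel σ.symm (fun p => ?_) hB.symm, ?_, ?_⟩
  · rw [hA, Equiv.apply_symm_apply]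
  · intro θ
    rw [relabel_relabel]
    exact N.relabel_eq_self _ _ (by simp) _
  · intro θ
    rw [relabel_relabel]
    exact N.relabel_eq_self _ _ (by simp) _

variable {N} {T : Type} {S R : T → FintypeCat.{0}} {f : ∀ a, S a ⟶ R a}

/-- Families of operations over a sum of mappings are families of families of operations. -/
theorem Het.cell_bijective {g : L ⟶ K} (s : ∀ a, PbSq (f a) g)
    (h : JointlyBijective fun a => (s a).right) (E : ∀ a, FibreEnum (f a)) (E' : FibreEnum g)
    {X : L → N.Col} {Y : K → N.Col} {X' : ∀ a, S a → N.Col} {Y' : ∀ a, R a → N.Col}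
    (hX : ∀ a i, X' a i = X ((s a).left i)) (hY : ∀ a j, Y' a j = Y ((s a).right j)) :
    Function.Bijective fun (φ : N.Het E' X Y) a =>
      (Het.cell (s a) (hX a) (hY a) φ : N.Het (E a) (X' a) (Y' a)) :=
  (Equiv.piCurry fun a j => N.Op (fun p => X' a ((E a).idx j p).1) (Y' a j)).bijective.comp
    (Function.Bijective.piMap_comp h (P := fun k => N.Op (fun p => X (E'.idx k p).1) (Y k))
      (Q := fun x => N.Op (fun p => X' x.1 ((E x.1).idx x.2 p).1) (Y' x.1 x.2))
      (r := fun x => N.relabel ((s x.1).idx (E x.1) E' x.2)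
        (fun p => (hX _ _).trans (congrArg X ((s x.1).idx_spec _ _ x.2 p))) (hY _ _))
      fun _ => N.relabel_bijective _ _ _)

variable (N)

theorem famMap_obj_bijective {I : T → FintypeCat.{0}} {ι : ∀ a, I a ⟶ L}
    (h : JointlyBijective ι) : Function.Bijective fun (X : N.Fam L) a => (N.famMap (ι a)).obj X :=
  (Equiv.piCurry fun (a : T) (_ : I a) => N.Col).bijective.comp
    (Function.Bijective.piMap_comp h (P := fun _ => N.Col) (Q := fun _ => N.Col)
      (r := fun _ => id) fun _ => Function.bijective_id)

/-- The product of the categories of families of colours. -/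
noncomputable def famIsLimit {I : T → FintypeCat.{0}} {ι : ∀ a, I a ⟶ L}
    (h : JointlyBijective ι) :
    IsLimit (Fan.mk (Cat.of (N.Fam L)) fun a => (N.famMap (ι a)).toCatHom) :=
  Cat.fanIsLimit (N.famMap_obj_bijective h) fun _ _ => Het.cell_bijective (fun a => vsq (ι a)) h
    (fun _ => FibreEnum.std _) (FibreEnum.std _) (fun _ _ => rfl) (fun _ _ => rfl)

/-- The product of the profunctors of families of operations. -/
noncomputable def profIsLimit {g : L ⟶ K} (s : ∀ a, PbSq (f a) g)
    (h : JointlyBijective fun a => (s a).right) :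
    IsLimit (Fan.mk (profOne (N.prof g)) fun a => (N.sqCell (s a)).toOne) :=
  Cell.fanIsLimit (N.famIsLimit (PbSq.jointlyBijective_left s h)) (N.famIsLimit h)
    fun _ _ => Het.cell_bijective s h (fun _ => FibreEnum.std _) (FibreEnum.std _)
      (fun _ _ => rfl) (fun _ _ => rfl)

/-- The sum of a family of mappings. -/
def sigmaMap [Finite T] (f : ∀ a, S a ⟶ R a) :
    FintypeCat.of ((a : T) × S a) ⟶ FintypeCat.of ((a : T) × R a) :=
  FintypeCat.homMk fun x => ⟨x.1, f x.1 x.2⟩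

/-- The inclusions of the summands of a sum of mappings. -/
def sigmaSq [Finite T] (f : ∀ a, S a ⟶ R a) (a : T) : PbSq (f a) (sigmaMap f) :=
  PbSq.ofExistsUnique (fun x => (⟨a, x⟩ : (a : T) × S a)) (fun x => (⟨a, x⟩ : (a : T) × R a))
    (fun _ => rfl) (by
      rintro ⟨b, x⟩ y hxy
      have hb : b = a := congrArg Sigma.fst hxy
      subst hb
      obtain rfl := eq_of_heq (Sigma.mk.inj hxy).2
      exact ⟨x, ⟨rfl, rfl⟩, fun x' hx' => eq_of_heq (Sigma.mk.inj hx'.1).2⟩)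

/-- For each finite family one product cone with a product image suffices; the disjoint union with
its inclusions is chosen, where `famIsLimit` and `profIsLimit` apply. -/
theorem laxDoubleFunctor_preservesProducts : N.laxDoubleFunctor.PreservesProducts := by
  refine ⟨⟨fun n => ?_⟩, ⟨fun n => ?_⟩⟩
  · have (F : Fin n → FintypeCat.{0}ᵒᵖ) : PreservesLimit (Discrete.functor F) N.famFunctor :=
      preservesLimit_of_preserves_limit_cone
        (jointlyBijective_sigma fun a => (F a).unop).isLimit
        ((isLimitMapConeFanMkEquiv _ _ _).symm
          (N.famIsLimit (jointlyBijective_sigma fun a => (F a).unop)))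
    exact preservesLimitsOfShape_of_discrete N.famFunctor
  · have (F : Fin n → (pbDouble FintypeCat.{0}).hop.One) :
        PreservesLimit (Discrete.functor F) N.laxDoubleFunctor.v := by
      have h : JointlyBijective fun a => (sigmaSq (fun a => (F a).pro) a).right :=
        jointlyBijective_sigma fun a => (F a).cod.unop
      exact preservesLimit_of_preserves_limit_cone (PbSq.isLimit _ h)
        ((isLimitMapConeFanMkEquiv _ _ _).symm (N.profIsLimit _ h))
    exact preservesLimitsOfShape_of_discrete _

/-- The DF operad of families of operations of a coloured operad. -/
noncomputable def toDFOperad : DFOperad.{u} where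
  toLaxDoubleFunctor := N.laxDoubleFunctor
  normal := N.laxDoubleFunctor_normal
  preservesProducts := N.laxDoubleFunctor_preservesProducts

/-! ### Independence of the enumeration and the non-skeletal form of an operad -/

variable {N} in
-- Any `σ` matching the enumerated points equals the canonical bijection, as enumerations are
-- injective. `NonSkeletalForm` quantifies over all such `σ`; `Het.comp_eq` plays the same role for
-- composition.
theorem Het.cell_eq {f : I ⟶ J} {g : L ⟶ K} (s : PbSq f g) {E : FibreEnum f}
    {E' : FibreEnum g} {X : L → N.Col} {Y : K → N.Col}
    {X' : I → N.Col} {Y' : J → N.Col} (hX : ∀ i, X' i = X (s.left i))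
    (hY : ∀ j, Y' j = Y (s.right j)) (φ : N.Het E' X Y) (j : J)
    (σ : Fin (E.card j) ≃ Fin (E'.card (s.right j)))
    (hσ : ∀ p, s.left (E.idx j p).1 = (E'.idx (s.right j) (σ p)).1) :
    (φ.cell s hX hY : N.Het E X' Y') j =
      N.relabel σ (fun p => (hX _).trans (congrArg X (hσ p))) (hY j) (φ (s.right j)) :=
  N.relabel_congr (fun p => FibreEnum.ext_idx _ ((s.idx_spec _ _ j p).symm.trans (hσ p))) _ _ _

variable {N} in
theorem Het.comp_eq {f : I ⟶ J} {g : J ⟶ K} {h : I ⟶ K} (e : f ≫ g = h) {E : FibreEnum f}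
    {E' : FibreEnum g} {E'' : FibreEnum h} {X : I → N.Col} {Y : J → N.Col} {Z : K → N.Col}
    (φ : N.Het E X Y) (ψ : N.Het E' Y Z) (k : K)
    (σ : Fin (E''.card k) ≃ Fin (∑ q, E.card (E'.idx k q).1))
    (hσ : ∀ p, (E''.idx k p).1 =
      (E.idx (E'.idx k (finSigmaFinEquiv.symm (σ p)).1).1 (finSigmaFinEquiv.symm (σ p)).2).1) :
    (φ.comp e ψ : N.Het E'' X Z) k = N.relabel σ (fun p => congrArg X (hσ p)) rfl
      (N.comp (ψ k) (fun q => φ (E'.idx k q).1)) :=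
  N.relabel_congr (fun p => FibreEnum.concatIdx_injective _ _
    ((FibreEnum.compIdx_spec _ _ _ e k p).symm.trans (hσ p))) _ _ _

/-- The identity pullback square. -/
def idSq (f : I ⟶ J) : PbSq f f := (pbDouble FintypeCat.{0}).hid f

/-- Change of enumeration. -/
noncomputable def Het.reenum {f : I ⟶ J} (E E' : FibreEnum f) (X : I → N.Col) (Y : J → N.Col) :
    N.Het E X Y ≃ N.Het E' X Y where
  toFun φ := Het.cell (idSq f) (fun _ => rfl) (fun _ => rfl) φ
  invFun φ := Het.cell (idSq f) (fun _ => rfl) (fun _ => rfl) φ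
  left_inv φ := (Het.cell_cell _ _ (idSq f) (fun _ => rfl) (fun _ => rfl) _ _ _ _ φ).trans
    (Het.cell_id _ (fun _ => rfl) (fun _ => rfl) _ _ φ)
  right_inv φ := (Het.cell_cell _ _ (idSq f) (fun _ => rfl) (fun _ => rfl) _ _ _ _ φ).trans
    (Het.cell_id _ (fun _ => rfl) (fun _ => rfl) _ _ φ)

/-- The DF operad of a coloured operad is its non-skeletal form. -/
noncomputable def nonSkeletalForm : NonSkeletalForm N N.toDFOperad where
  obj I := Equiv.refl (I → N.Col)
  obj_reindex _ _ _ := rfl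
  ops {I J f} E {X Y} := Het.reenum N (FibreEnum.std f) E X Y
  ops_cell {I J L K f g} s E E' X Y φ j σ hσ := by
    -- Changing the enumeration before or after restricting is pasting with an identity square, so
    -- both composites are the action of `s`.
    have h1 := Het.cell_cell (N := N) (E := E) (E' := FibreEnum.std f) (E'' := FibreEnum.std g)
      (idSq f) s s (fun _ => rfl) (fun _ => rfl) (X := X) (Y := Y) (fun _ => rfl) (fun _ => rfl)
      (fun _ => rfl) (fun _ => rfl) φ
    have h2 := Het.cell_cell (N := N) (E := E) (E' := E') (E'' := FibreEnum.std g)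
      s (idSq g) s (fun _ => rfl) (fun _ => rfl) (X := X) (Y := Y) (fun _ => rfl) (fun _ => rfl)
      (fun _ => rfl) (fun _ => rfl) φ
    exact (congrFun (h1.trans h2.symm) j).trans (Het.cell_eq s (fun _ => rfl) (fun _ => rfl)
      (Het.cell (E := E') (idSq g) (fun _ => rfl) (fun _ => rfl) φ) j σ hσ)
  ops_unit {I} E X i σ :=
    (congrFun (Het.cell_one (N := N) (E := E) (E' := FibreEnum.std (𝟙 I)) (idSq (𝟙 I)) (X := X)
      (fun _ => rfl) (fun _ => rfl)) i).trans
      (N.relabel_congr (fun p => Subsingleton.elim _ _) _ _ _)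
  ops_comp {I J K f g} E E' E'' {X Y Z} φ ψ k σ hσ := by
    -- A change of enumeration is the action of an identity square, so its compatibility with
    -- composition is an instance of naturality.
    have h := Het.comp_cell (N := N) (E₁ := E) (E₂ := E') (E₃ := E'') (E₁' := FibreEnum.std f)
      (E₂' := FibreEnum.std g) (E₃' := FibreEnum.std (f ≫ g)) (e := rfl) (e' := rfl)
      (idSq f) (idSq g) (idSq (f ≫ g)) (fun _ => rfl) (fun _ => rfl) (fun _ => rfl) (X := X)
      (Y := Y) (Z := Z) (fun _ => rfl) (fun _ => rfl) (fun _ => rfl) (fun _ => rfl) φ ψ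
    exact (congrFun h k).symm.trans (Het.comp_eq rfl
      (Het.cell (E := E) (idSq f) (fun _ => rfl) (fun _ => rfl) φ)
      (Het.cell (E := E') (idSq g) (fun _ => rfl) (fun _ => rfl) ψ) k σ hσ)

end Operad

/-! ## Objects of products of categories -/

/-- Objects are functors from the terminal category, so the universal property of the product gives
a bijection on them. -/
theorem Cat.obj_bijective {T : Type} {C : T → Cat.{u, u}} {P : Cat.{u, u}} {π : ∀ a, P ⟶ C a}
    (h : IsLimit (Fan.mk P π)) : Function.Bijective fun (X : P) a => (π a).toFunctor.obj X := by
  let c {D : Cat.{u, u}} (X : D) : Cat.of (Discrete PUnit.{u + 1}) ⟶ D :=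
    Functor.toCatHom (D := D) (Discrete.functor fun _ => X)
  constructor
  · intro X Y hXY
    have : c X = c Y := Fan.IsLimit.hom_ext h _ _ fun a => punit_functor_ext (congrFun hXY a)
    exact congrArg (fun F => F.toFunctor.obj ⟨⟨⟩⟩) this
  · intro Y
    refine ⟨(h.lift (Fan.mk _ fun a => c (Y a))).toFunctor.obj ⟨⟨⟩⟩, funext fun a => ?_⟩
    exact congrArg (fun F => F.toFunctor.obj ⟨⟨⟩⟩) (h.fac (Fan.mk _ fun a => c (Y a)) ⟨a⟩)

namespace Prof

theorem pre_eqToHom_heq {C D : Cat.{u, u}} (Φ : Prof C D) {X X' : C} (h : X' = X) {Y : D}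
    (φ : Het Φ X Y) : HEq (pre Φ (eqToHom h) φ) φ := by
  subst h
  exact heq_of_eq (pre_id Φ φ)

end Prof

/-! ### Calculus of elements in a DF operad -/

namespace DFOperad

open FintypeCat

variable (M : DFOperad.{u}) {I J K L : FintypeCat.{0}}

/-- The one-point set. -/
abbrev pt : FintypeCat.{0} := FintypeCat.of Unit

/-- The map picking out an element. -/
def point (i : I) : pt ⟶ I := FintypeCat.homMk fun _ => i

theorem jointlyBijective_point (I : FintypeCat.{0}) :
    JointlyBijective fun i : I => point i :=
  ⟨fun _ _ h => Sigma.ext h HEq.rfl, fun i => ⟨⟨i, ()⟩, rfl⟩⟩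

/-- Preservation of products by the horizontal component enters here. Applied to the points of `I`,
it makes objects into families of colours. -/
theorem reindex_bijective {T : Type} [Finite T] {S : T → FintypeCat.{0}} {ι : ∀ a, S a ⟶ L}
    (h : JointlyBijective ι) :
    Function.Bijective fun (X : M.fam L) a => (M.reindex (ι a)).toFunctor.obj X :=
  have := M.preservesProducts.1
  Cat.obj_bijective (isLimitFanMkObjOfIsLimit M.h _ _ h.isLimit)

theorem reindex_id (X : M.fam I) : (M.reindex (𝟙 I)).toFunctor.obj X = X :=
  congrArg (fun F => F.toFunctor.obj X) (M.h.map_id (op I))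

theorem reindex_comp (k : I ⟶ J) (l : J ⟶ L) (X : M.fam L) :
    (M.reindex (k ≫ l)).toFunctor.obj X =
      (M.reindex k).toFunctor.obj ((M.reindex l).toFunctor.obj X) :=
  congrArg (fun F => F.toFunctor.obj X) (M.h.map_comp l.op k.op)

/-- The family of objects over the point underlying an object. -/
noncomputable def colEquiv (I : FintypeCat.{0}) : M.fam I ≃ (I → M.fam pt) :=
  Equiv.ofBijective _ (M.reindex_bijective (jointlyBijective_point I))

variable {M}

/-- The members of the family underlying an object. -/
noncomputable def col (X : M.fam I) (i : I) : M.fam pt := M.colEquiv I X i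

theorem col_reindex (l : I ⟶ L) (X : M.fam L) (i : I) :
    col ((M.reindex l).toFunctor.obj X) i = col X (l i) :=
  (M.reindex_comp (point i) l X).symm

theorem col_ext {X Y : M.fam I} (h : ∀ i, col X i = col Y i) : X = Y :=
  (M.colEquiv I).injective (funext h)

theorem col_pt (X : M.fam pt) (i : pt) : col X i = X := M.reindex_id X

/-- The object with a given underlying family. -/
noncomputable def glue (A : I → M.fam pt) : M.fam I := (M.colEquiv I).symm A

theorem col_glue (A : I → M.fam pt) (i : I) : col (glue A) i = A i :=
  congrFun ((M.colEquiv I).apply_symm_apply A) i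

theorem reindex_eq {l : I ⟶ L} {X : M.fam L} {X' : M.fam I}
    (h : ∀ i, col X' i = col X (l i)) : (M.reindex l).toFunctor.obj X = X' :=
  col_ext fun i => (col_reindex l X i).trans (h i).symm

variable (M)

/-- The cell of a pullback square. -/
def sqCell {f : I ⟶ J} {g : L ⟶ K} (s : PbSq f g) : Cell (M.prof g) (M.prof f) :=
  M.sq (I := op L) (J := op K) (L := op I) (K := op J) (f := g) (g := f) s

theorem sqCell_left {f : I ⟶ J} {g : L ⟶ K} (s : PbSq f g) :
    (M.sqCell s).left = M.reindex s.left :=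
  M.left_sq (I := op L) (J := op K) (L := op I) (K := op J) (f := g) (g := f) s

theorem sqCell_right {f : I ⟶ J} {g : L ⟶ K} (s : PbSq f g) :
    (M.sqCell s).right = M.reindex s.right :=
  M.right_sq (I := op L) (J := op K) (L := op I) (K := op J) (f := g) (g := f) s

/-- The unit cell. -/
def unitCell (I : FintypeCat.{0}) : Cell (Prof.hom (M.fam I)) (M.prof (𝟙 I)) := M.unit (op I)

theorem unitCell_left (I : FintypeCat.{0}) : (M.unitCell I).left = 𝟙 (M.fam I) :=
  M.left_unit (op I)

theorem unitCell_right (I : FintypeCat.{0}) : (M.unitCell I).right = 𝟙 (M.fam I) :=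
  M.right_unit (op I)

/-- The laxity cell. -/
def compCell (f : I ⟶ J) (g : J ⟶ K) :
    Cell (Prof.comp (M.prof f) (M.prof g)) (M.prof (f ≫ g)) :=
  M.comp (I := op I) (J := op J) (K := op K) f g

theorem compCell_left (f : I ⟶ J) (g : J ⟶ K) : (M.compCell f g).left = 𝟙 (M.fam I) :=
  M.left_comp (I := op I) (J := op J) (K := op K) f g

theorem compCell_right (f : I ⟶ J) (g : J ⟶ K) : (M.compCell f g).right = 𝟙 (M.fam K) :=
  M.right_comp (I := op I) (J := op J) (K := op K) f g

theorem sqCell_id (f : I ⟶ J) (s : PbSq f f) (hl : s.left = 𝟙 I) (hr : s.right = 𝟙 J) :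
    M.sqCell s = Cell.hid (M.prof f) := by
  obtain rfl : s = (pbDouble FintypeCat.{0}).hid f := PbSq.ext hl hr
  exact M.sq_hid (I := op I) (J := op J) f

theorem sqCell_comp {I' J' : FintypeCat.{0}} {f : I ⟶ J} {g : L ⟶ K} {h : I' ⟶ J'}
    (s : PbSq f g) (t : PbSq g h) :
    M.sqCell ((pbDouble _).hcomp s t) = Cell.hcomp (M.sqCell t) (M.sqCell s) :=
  M.sq_hcomp (I := op I') (J := op J') (L := op L) (K := op K) (P := op I) (Q := op J)
    (f := h) (g := g) (k := f) t s

variable {M}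

/-- The action of a pullback square. -/
def cell {f : I ⟶ J} {g : L ⟶ K} (s : PbSq f g) {X : M.fam L} {Y : M.fam K} {X' : M.fam I}
    {Y' : M.fam J} (hX : ∀ i, col X' i = col X (s.left i)) (hY : ∀ j, col Y' j = col Y (s.right j))
    (φ : Het (M.prof g) X Y) : Het (M.prof f) X' Y' :=
  cast (by rw [reindex_eq hX, reindex_eq hY]) (M.cellEl s φ)

/-- Composition. -/
def cmp {f : I ⟶ J} {g : J ⟶ K} {h : I ⟶ K} (e : f ≫ g = h) {X : M.fam I} {Y : M.fam J}
    {Z : M.fam K} (φ : Het (M.prof f) X Y) (ψ : Het (M.prof g) Y Z) : Het (M.prof h) X Z :=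
  cast (by rw [e]) (M.compEl φ ψ)

/-- The element over an identity mapping given by an arrow. -/
def unitMap {X Y : M.fam I} (g : X ⟶ Y) : Het (M.prof (𝟙 I)) X Y :=
  Cell.appOf (F := 𝟙 (M.fam I)) (G := 𝟙 (M.fam I)) (M.unitCell I) (M.unitCell_left I)
    (M.unitCell_right I) g

theorem cell_heq {f : I ⟶ J} {g : L ⟶ K} (s : PbSq f g) {X : M.fam L} {Y : M.fam K} {X' : M.fam I}
    {Y' : M.fam J} (hX : ∀ i, col X' i = col X (s.left i)) (hY : ∀ j, col Y' j = col Y (s.right j))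
    (φ : Het (M.prof g) X Y) : HEq (cell s hX hY φ) ((M.sqCell s).app φ) :=
  (cast_heq _ _).trans (cast_heq _ _)

theorem unitMap_heq {X Y : M.fam I} (g : X ⟶ Y) : HEq (unitMap g) ((M.unitCell I).app g) :=
  cast_heq _ _

/-- The laxity cell has identity sides only propositionally, whereas `cmp` has the expected type.
Letting all objects vary up to equality spares transports in the coherence proofs. -/
theorem compCell_heq {f : I ⟶ J} {g : J ⟶ K} {h : I ⟶ K} (e : f ≫ g = h) {X X' : M.fam I}
    {Y Y' : M.fam J} {Z Z' : M.fam K} (hX : X = X') (hY : Y = Y') (hZ : Z = Z')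
    {φ : Het (M.prof f) X Y} {ψ : Het (M.prof g) Y Z} {φ' : Het (M.prof f) X' Y'}
    {ψ' : Het (M.prof g) Y' Z'} (hφ : HEq φ φ') (hψ : HEq ψ ψ') :
    HEq ((M.compCell f g).app (tmul _ _ φ ψ)) (cmp e φ' ψ') := by
  subst hX hY hZ e
  obtain rfl := eq_of_heq hφ
  obtain rfl := eq_of_heq hψ
  exact (cast_heq _ _).symm

theorem cell_id {f : I ⟶ J} (s : PbSq f f) (hl : ∀ i, s.left i = i) (hr : ∀ j, s.right j = j)
    {X : M.fam I} {Y : M.fam J} (hX : ∀ i, col X i = col X (s.left i))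
    (hY : ∀ j, col Y j = col Y (s.right j)) (φ : Het (M.prof f) X Y) : cell s hX hY φ = φ :=
  eq_of_heq ((cell_heq s hX hY φ).trans (Cell.app_congr (M.sqCell_id f s
    (FintypeCat.hom_ext _ _ hl) (FintypeCat.hom_ext _ _ hr)) φ))

theorem cell_cell {I' J' : FintypeCat.{0}} {f : I ⟶ J} {g : L ⟶ K} {h : I' ⟶ J'}
    (s : PbSq f g) (t : PbSq g h) (st : PbSq f h) (hl : ∀ i, t.left (s.left i) = st.left i)
    (hr : ∀ j, t.right (s.right j) = st.right j) {X : M.fam I'} {Y : M.fam J'}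
    {X' : M.fam L} {Y' : M.fam K} {X'' : M.fam I} {Y'' : M.fam J}
    (hX : ∀ x, col X' x = col X (t.left x)) (hY : ∀ y, col Y' y = col Y (t.right y))
    (hX' : ∀ i, col X'' i = col X' (s.left i)) (hY' : ∀ j, col Y'' j = col Y' (s.right j))
    (φ : Het (M.prof h) X Y) :
    cell s hX' hY' (cell t hX hY φ) = cell st
      (fun i => (hX' i).trans ((hX _).trans (congrArg (col X) (hl i))))
      (fun j => (hY' j).trans ((hY _).trans (congrArg (col Y) (hr j)))) φ := by
  obtain rfl : st = (pbDouble _).hcomp s t :=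
    PbSq.ext (FintypeCat.hom_ext _ _ fun i => (hl i).symm)
      (FintypeCat.hom_ext _ _ fun j => (hr j).symm)
  refine eq_of_heq ((cell_heq _ _ _ _).trans (HEq.trans ?_ (cell_heq _ _ _ _).symm))
  refine HEq.trans ?_ (Cell.app_congr (M.sqCell_comp s t).symm φ)
  refine Cell.app_heq (M.sqCell s) ?_ ?_ (cell_heq t hX hY φ)
  · rw [sqCell_left]; exact (reindex_eq hX).symm
  · rw [sqCell_right]; exact (reindex_eq hY).symm

theorem cell_unitMap (k : I ⟶ L) {X Y : M.fam L} (g : X ⟶ Y) :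
    cell (Operad.vsq k) (col_reindex k X) (col_reindex k Y) (unitMap g) =
      unitMap ((M.reindex k).toFunctor.map g) := by
  have h := Cell.app_congr (M.unit_natural k.op) g
  refine eq_of_heq ((cell_heq _ _ _ _).trans (HEq.trans ?_ (h.symm.trans (unitMap_heq _).symm)))
  refine Cell.app_heq (M.sqCell (Operad.vsq k)) ?_ ?_ (unitMap_heq g)
  · exact (congrArg (fun F => F.toFunctor.obj X) (M.unitCell_left L)).symm
  · exact (congrArg (fun F => F.toFunctor.obj Y) (M.unitCell_right L)).symm

theorem cell_unitEl (s : PbSq (𝟙 I) (𝟙 L)) {X : M.fam L} {X' : M.fam I}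
    (hX : ∀ i, col X' i = col X (s.left i)) (hX' : ∀ i, col X' i = col X (s.right i)) :
    cell s hX hX' (M.unitEl X) = M.unitEl X' := by
  -- The vertical arrows being identities, commutativity makes both sides of the square equal.
  obtain ⟨k, hs⟩ : ∃ k, s = Operad.vsq k := ⟨s.left, PbSq.ext rfl
    (FintypeCat.hom_ext _ _ fun i => (s.w i).symm)⟩
  subst hs
  obtain rfl := reindex_eq hX
  refine (cell_unitMap _ (𝟙 X)).trans ?_
  rw [CategoryTheory.Functor.map_id]
  rfl

theorem cmp_cell {I' J' K' : FintypeCat.{0}} {f : I ⟶ J} {g : J ⟶ K} {h : I ⟶ K}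
    {f' : I' ⟶ J'} {g' : J' ⟶ K'} {h' : I' ⟶ K'} (e : f ≫ g = h) (e' : f' ≫ g' = h')
    (s : PbSq f f') (t : PbSq g g') (st : PbSq h h') (hst : ∀ j, s.right j = t.left j)
    (hl : ∀ i, st.left i = s.left i) (hr : ∀ k, st.right k = t.right k)
    {X : M.fam I'} {Y : M.fam J'} {Z : M.fam K'} {X' : M.fam I} {Y' : M.fam J}
    {Z' : M.fam K} (hX : ∀ i, col X' i = col X (s.left i))
    (hY : ∀ j, col Y' j = col Y (s.right j)) (hY' : ∀ j, col Y' j = col Y (t.left j))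
    (hZ : ∀ k, col Z' k = col Z (t.right k)) (φ : Het (M.prof f') X Y)
    (ψ : Het (M.prof g') Y Z) :
    cmp e (cell s hX hY φ) (cell t hY' hZ ψ) =
      cell st (fun i => (hX i).trans (congrArg (col X) (hl i).symm))
        (fun k => (hZ k).trans (congrArg (col Z) (hr k).symm)) (cmp e' φ ψ) := by
  subst e e'
  have hst' : s.right = t.left := FintypeCat.hom_ext _ _ hst
  obtain rfl : st = (pbDouble _).vcompSq s t hst' := PbSq.ext
    (FintypeCat.hom_ext _ _ hl) (FintypeCat.hom_ext _ _ hr)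
  have h := Cell.app_congr (M.comp_natural (I := op I') (J := op J') (K := op K') (I' := op I)
    (J' := op J) (K' := op K) (f := f') (g := g') (f' := f) (g' := g) s t
    (congrArg Quiver.Hom.op hst')) (tmul _ _ φ ψ)
  refine eq_of_heq (HEq.trans ?_ (h.trans ?_))
  · refine (compCell_heq rfl ?_ ?_ ?_ (cell_heq s hX hY φ).symm
      ((pre_eqToHom_heq _ _ _).trans (cell_heq t hY' hZ ψ).symm)).symm
    · exact (congrArg (fun F => F.toFunctor.obj X) (M.sqCell_left s)).trans (reindex_eq hX)
    · exact (congrArg (fun F => F.toFunctor.obj Y) (M.sqCell_right s)).trans (reindex_eq hY)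
    · exact (congrArg (fun F => F.toFunctor.obj Z) (M.sqCell_right t)).trans (reindex_eq hZ)
  · refine HEq.trans ?_ (cell_heq _ _ _ _).symm
    refine Cell.app_heq (M.sqCell _) ?_ ?_ (compCell_heq rfl rfl rfl rfl HEq.rfl HEq.rfl)
    · exact congrArg (fun F => F.toFunctor.obj X) (M.compCell_left f' g')
    · exact congrArg (fun F => F.toFunctor.obj Z) (M.compCell_right f' g')

/-- The left unit law of the lax functor evaluated at the class of `(g, φ)`. It expresses the action
of arrows through composition, so compatibility with actions will follow from compatibility with
composition. -/
theorem unitMap_cmp {f : I ⟶ J} (e : 𝟙 I ≫ f = f) {X X' : M.fam I} {Y : M.fam J} (g : X' ⟶ X)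
    (φ : Het (M.prof f) X Y) : cmp e (unitMap g) φ = pre (M.prof f) g φ := by
  have h := Cell.app_congr (M.unit_comp (I := op I) (J := op J) f) (tmul (Prof.hom _) _ g φ)
  refine eq_of_heq (HEq.trans (HEq.symm ?_) h)
  refine (Cell.app_congr (M.sqCell_id f _ rfl rfl) _).trans ?_
  refine compCell_heq e ?_ ?_ rfl (unitMap_heq g).symm (pre_eqToHom_heq _ _ _)
  · exact congrArg (fun F => F.toFunctor.obj X') (M.unitCell_left I)
  · exact congrArg (fun F => F.toFunctor.obj X) (M.unitCell_right I)

theorem cmp_unitMap {f : I ⟶ J} (e : f ≫ 𝟙 J = f) {X : M.fam I} {Y Y' : M.fam J}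
    (φ : Het (M.prof f) X Y) (g : Y ⟶ Y') : cmp e φ (unitMap g) = post (M.prof f) φ g := by
  have h := Cell.app_congr (M.comp_unit (I := op I) (J := op J) f) (tmul _ (Prof.hom _) φ g)
  refine eq_of_heq (HEq.trans (HEq.symm ?_) h)
  refine (Cell.app_congr (M.sqCell_id f _ rfl rfl) _).trans ?_
  refine compCell_heq e rfl rfl ?_ HEq.rfl ((pre_eqToHom_heq _ _ _).trans (unitMap_heq g).symm)
  exact congrArg (fun F => F.toFunctor.obj Y') (M.unitCell_right J)

theorem unitEl_cmp {f : I ⟶ J} (e : 𝟙 I ≫ f = f) {X : M.fam I} {Y : M.fam J}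
    (φ : Het (M.prof f) X Y) : cmp e (M.unitEl X) φ = φ :=
  (unitMap_cmp e (𝟙 X) φ).trans (pre_id _ φ)

theorem cmp_unitEl {f : I ⟶ J} (e : f ≫ 𝟙 J = f) {X : M.fam I} {Y : M.fam J}
    (φ : Het (M.prof f) X Y) : cmp e φ (M.unitEl Y) = φ :=
  (cmp_unitMap e φ (𝟙 Y)).trans (post_id _ φ)

theorem cmp_assoc {f : I ⟶ J} {g : J ⟶ K} {h : K ⟶ L} {fg : I ⟶ K} {gh : J ⟶ L} {fgh : I ⟶ L}
    (e₁ : f ≫ g = fg) (e₂ : fg ≫ h = fgh) (e₃ : g ≫ h = gh) (e₄ : f ≫ gh = fgh)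
    {X : M.fam I} {Y : M.fam J} {Z : M.fam K} {W : M.fam L} (φ : Het (M.prof f) X Y)
    (ψ : Het (M.prof g) Y Z) (θ : Het (M.prof h) Z W) :
    cmp e₂ (cmp e₁ φ ψ) θ = cmp e₄ φ (cmp e₃ ψ θ) := by
  subst e₁ e₂ e₃
  have h := Cell.app_congr (M.comp_assoc (I := op I) (J := op J) (K := op K) (L := op L) f g h)
    (tmul _ _ (tmul _ _ φ ψ) θ)
  refine eq_of_heq (HEq.trans (HEq.symm ?_) (h.trans ?_))
  · refine (Cell.app_congr (M.sqCell_id ((f ≫ g) ≫ _) _ rfl rfl) _).trans ?_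
    refine compCell_heq rfl ?_ ?_ rfl (compCell_heq rfl rfl rfl rfl HEq.rfl HEq.rfl)
      (pre_eqToHom_heq _ _ _)
    · exact congrArg (fun F => F.toFunctor.obj X) (M.compCell_left f g)
    · exact congrArg (fun F => F.toFunctor.obj Z) (M.compCell_right f g)
  · refine compCell_heq e₄ rfl rfl ?_ HEq.rfl ((pre_eqToHom_heq _ _ _).trans
      (compCell_heq rfl rfl rfl rfl HEq.rfl HEq.rfl))
    exact congrArg (fun F => F.toFunctor.obj W) (M.compCell_right g _)

/-- Preservation of products by the vertical component gives a bijection of total sets of elements;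
the remaining work is to fix the objects `X` and `Y`. -/
theorem cell_bijective {T : Type} [Finite T] {S R : T → FintypeCat.{0}} {f : ∀ a, S a ⟶ R a}
    {g : L ⟶ K} (s : ∀ a, PbSq (f a) g) (h : JointlyBijective fun a => (s a).right)
    {X : M.fam L} {Y : M.fam K} {X' : ∀ a, M.fam (S a)} {Y' : ∀ a, M.fam (R a)}
    (hX : ∀ a i, col (X' a) i = col X ((s a).left i))
    (hY : ∀ a j, col (Y' a) j = col Y ((s a).right j)) :
    Function.Bijective fun (φ : Het (M.prof g) X Y) a =>
      (cell (s a) (hX a) (hY a) φ : Het (M.prof (f a)) (X' a) (Y' a)) := by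
  have := M.preservesProducts.2
  have hb := Cell.tot_bijective (π := fun a => M.sqCell (s a))
    (isLimitFanMkObjOfIsLimit M.v _ _ (PbSq.isLimit s h))
  have hl (a) : (M.sqCell (s a)).left.toFunctor.obj X = X' a :=
    (congrArg (fun F => F.toFunctor.obj X) (M.sqCell_left (s a))).trans (reindex_eq (hX a))
  have hr (a) : (M.sqCell (s a)).right.toFunctor.obj Y = Y' a :=
    (congrArg (fun F => F.toFunctor.obj Y) (M.sqCell_right (s a))).trans (reindex_eq (hY a))
  have ht (φ : Het (M.prof g) X Y) (a) : (M.sqCell (s a)).tot ⟨X, Y, φ⟩ =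
      ⟨X' a, Y' a, cell (s a) (hX a) (hY a) φ⟩ :=
    tot_mk_eq.2 ⟨hl a, hr a, (cell_heq _ _ _ _).symm⟩
  constructor
  · intro φ φ' hφ
    have : (⟨X, Y, φ⟩ : Tot (M.prof g)) = ⟨X, Y, φ'⟩ := hb.1 (funext fun a => by
      dsimp only
      rw [ht, ht, show cell (s a) (hX a) (hY a) φ = _ from congrFun hφ a])
    exact eq_of_heq (tot_mk_eq.1 this).2.2
  · intro ψ
    obtain ⟨⟨X₀, Y₀, φ⟩, hφ⟩ := hb.2 fun a => ⟨X' a, Y' a, ψ a⟩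
    have hφ' (a) := tot_mk_eq.1 (congrFun hφ a)
    -- The preimage might lie over other objects, but these have the same restrictions as `X` and
    -- `Y`, hence equal them because the horizontal component preserves products too.
    obtain rfl : X₀ = X := (M.reindex_bijective (PbSq.jointlyBijective_left s h)).1
      (funext fun a => (congrArg (fun F => F.toFunctor.obj X₀) (M.sqCell_left (s a)).symm).trans
        ((hφ' a).1.trans (reindex_eq (hX a)).symm))
    obtain rfl : Y₀ = Y := (M.reindex_bijective h).1
      (funext fun a => (congrArg (fun F => F.toFunctor.obj Y₀) (M.sqCell_right (s a)).symm).trans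
        ((hφ' a).2.1.trans (reindex_eq (hY a)).symm))
    exact ⟨φ, funext fun a => eq_of_heq ((cell_heq _ _ _ _).trans (hφ' a).2.2)⟩

end DFOperad

/-! ## Squares of enumerated sets -/

namespace DFOperad

open FintypeCat

variable {I J K L : FintypeCat.{0}}

/-- The standard finite sets. -/
abbrev fin (n : ℕ) : FintypeCat.{0} := FintypeCat.of (Fin n)

/-- The mapping to the point. -/
def toPt (I : FintypeCat.{0}) : I ⟶ pt := FintypeCat.homMk fun _ => ()

/-- The square of a bijection of sets over the point. -/
def permSq {m n : ℕ} (σ : Fin m ≃ Fin n) : PbSq (toPt (fin m)) (toPt (fin n)) :=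
  PbSq.ofExistsUnique (L := fin n) (I := fin m) σ id (fun _ => rfl) fun x _ _ =>
    ⟨σ.symm x, ⟨σ.apply_symm_apply x, rfl⟩, fun _ h => (σ.symm_apply_eq.2 h.1.symm).symm⟩

/-- The square of the fibre of a mapping. -/
def fibreSq {f : I ⟶ J} (E : FibreEnum f) (j : J) : PbSq (toPt (fin (E.card j))) f :=
  PbSq.ofExistsUnique (I := fin (E.card j)) (J := pt) (fun p => (E.idx j p).1) (fun _ => j)
    (fun p => (E.idx j p).2) fun x _ hx => ⟨(E.idx j).symm ⟨x, hx⟩, ⟨by simp, rfl⟩,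
      fun p hp => ((E.idx j).symm_apply_eq.2 (Subtype.ext hp.1.symm)).symm⟩

theorem jointlyBijective_fibreSq {f : I ⟶ J} (E : FibreEnum f) :
    JointlyBijective fun j => (fibreSq E j).right :=
  jointlyBijective_point J

/-- The projection of a concatenated index set to the set of blocks. -/
def block {n : ℕ} (k : Fin n → ℕ) : fin (∑ i, k i) ⟶ fin n :=
  FintypeCat.homMk fun p => (finSigmaFinEquiv.symm p).1

theorem block_apply {n : ℕ} (k : Fin n → ℕ) (i : Fin n) (p : Fin (k i)) :
    block k (finSigmaFinEquiv ⟨i, p⟩) = i :=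
  congrArg Sigma.fst (finSigmaFinEquiv.symm_apply_apply (⟨i, p⟩ : (i : Fin n) × Fin (k i)))

/-- The enumeration of the blocks. -/
noncomputable def blockEnum {n : ℕ} (k : Fin n → ℕ) : FibreEnum (block k) where
  card := k
  idx i := Equiv.ofBijective (fun p => ⟨finSigmaFinEquiv ⟨i, p⟩, block_apply k i p⟩)
    ⟨fun p q h => eq_of_heq (Sigma.mk.inj (finSigmaFinEquiv.injective
      (congrArg Subtype.val h))).2, fun ⟨x, hx⟩ => by
      obtain ⟨⟨i', p⟩, rfl⟩ := finSigmaFinEquiv.surjective x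
      obtain rfl : i' = i := (block_apply k i' p).symm.trans hx
      exact ⟨p, rfl⟩⟩

/-- The square of a block. -/
noncomputable def blockSq {n : ℕ} (k : Fin n → ℕ) (i : Fin n) : PbSq (toPt (fin (k i))) (block k) :=
  fibreSq (blockEnum k) i

/-- A square from a concatenated index set from squares from its blocks. -/
def ofBlocks {n : ℕ} {k : Fin n → ℕ} {g : L ⟶ K} (r : fin n ⟶ K)
    (l : ∀ i, Fin (k i) → L) (hw : ∀ i p, g (l i p) = r i)
    (h : ∀ i x, g x = r i → ∃! p, l i p = x) : PbSq (block k) g :=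
  PbSq.ofExistsUnique (I := fin (∑ i, k i)) (J := fin n)
    (fun p => l (finSigmaFinEquiv.symm p).1 (finSigmaFinEquiv.symm p).2) r (fun _ => hw _ _)
    fun x i hx => by
      obtain ⟨p, hp, hu⟩ := h i x hx
      refine ⟨finSigmaFinEquiv ⟨i, p⟩, ⟨?_, block_apply k i p⟩, ?_⟩
      · rw [Equiv.symm_apply_apply]
        exact hp
      · rintro y ⟨hy, hy'⟩
        obtain ⟨⟨i', q⟩, rfl⟩ := finSigmaFinEquiv.surjective y
        obtain rfl : i' = i := (block_apply k i' q).symm.trans hy'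
        rw [Equiv.symm_apply_apply] at hy
        rw [hu q hy]

theorem ofBlocks_left {n : ℕ} {k : Fin n → ℕ} {g : L ⟶ K} (r : fin n ⟶ K)
    (l : ∀ i, Fin (k i) → L) (hw : ∀ i p, g (l i p) = r i)
    (h : ∀ i x, g x = r i → ∃! p, l i p = x) (i : Fin n) (p : Fin (k i)) :
    (ofBlocks r l hw h).left (finSigmaFinEquiv ⟨i, p⟩) = l i p := by
  change l (finSigmaFinEquiv.symm _).1 (finSigmaFinEquiv.symm _).2 = _
  rw [Equiv.symm_apply_apply]

/-! ## The coloured operad of a DF operad -/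

variable {M : DFOperad.{u}}

variable (M) in
/-- Operations of the coloured operad of a DF operad. -/
abbrev Operation {n : ℕ} (A : Fin n → M.fam pt) (B : M.fam pt) : Type u :=
  Het (M.prof (toPt (fin n))) (glue (I := fin n) A) B

theorem col_blockSq_left {n : ℕ} {k : Fin n → ℕ} (A : ∀ i, Fin (k i) → M.fam pt) (i : Fin n)
    (p : Fin (k i)) : col (glue (I := fin (k i)) (A i)) p =
      col (glue (I := fin (∑ i, k i)) (concat A)) ((blockSq k i).left p) := by
  rw [col_glue, col_glue]
  exact (concat_finSigma A ⟨i, p⟩).symm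

theorem col_blockSq_right {n : ℕ} (k : Fin n → ℕ) (B : Fin n → M.fam pt) (i : Fin n)
    (x : pt) : col (B i) x = col (glue (I := fin n) B) ((blockSq k i).right x) := by
  rw [col_glue, col_pt]
  rfl

/-- The projection `block k` is the sum of the mappings from its blocks to the point, so operations
on the blocks glue uniquely. -/
theorem blocks_bijective {n : ℕ} {B : Fin n → M.fam pt} {k : Fin n → ℕ}
    (A : ∀ i, Fin (k i) → M.fam pt) : Function.Bijective
      fun (Φ : Het (M.prof (block k)) (glue (I := fin (∑ i, k i)) (concat A))
        (glue (I := fin n) B)) i =>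
        (cell (blockSq k i) (col_blockSq_left A i) (col_blockSq_right k B i) Φ :
          M.Operation (A i) (B i)) :=
  cell_bijective (blockSq k) (jointlyBijective_fibreSq (blockEnum k)) (col_blockSq_left A)
    (col_blockSq_right k B)

/-- The element over the projection to the set of blocks given by operations on the blocks. -/
noncomputable def blocks {n : ℕ} {B : Fin n → M.fam pt} {k : Fin n → ℕ}
    {A : ∀ i, Fin (k i) → M.fam pt} (φ : ∀ i, M.Operation (A i) (B i)) :
    Het (M.prof (block k)) (glue (I := fin (∑ i, k i)) (concat A)) (glue (I := fin n) B) :=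
  ((blocks_bijective A).2 φ).choose

theorem cell_blocks {n : ℕ} {B : Fin n → M.fam pt} {k : Fin n → ℕ}
    {A : ∀ i, Fin (k i) → M.fam pt} (φ : ∀ i, M.Operation (A i) (B i)) (i : Fin n) :
    cell (blockSq k i) (col_blockSq_left A i) (col_blockSq_right k B i) (blocks φ) = φ i :=
  congrFun ((blocks_bijective A).2 φ).choose_spec i

/-- Uniqueness of gluing: to compute `blocks`, a candidate is proposed and its restriction to each
block is checked. -/
theorem eq_blocks {n : ℕ} {B : Fin n → M.fam pt} {k : Fin n → ℕ}
    {A : ∀ i, Fin (k i) → M.fam pt} {φ : ∀ i, M.Operation (A i) (B i)}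
    {Φ : Het (M.prof (block k)) (glue (I := fin (∑ i, k i)) (concat A)) (glue (I := fin n) B)}
    (h : ∀ i, cell (blockSq k i) (col_blockSq_left A i) (col_blockSq_right k B i) Φ = φ i) :
    blocks φ = Φ :=
  (blocks_bijective A).1 (funext fun i => (cell_blocks φ i).trans (h i).symm)

/-- Relabelling of operations. -/
noncomputable def rel {m n : ℕ} {A : Fin n → M.fam pt} {A' : Fin m → M.fam pt} {B B' : M.fam pt}
    (σ : Fin m ≃ Fin n) (hA : ∀ p, A' p = A (σ p)) (hB : B' = B) (θ : M.Operation A B) :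
    M.Operation A' B' :=
  cell (permSq σ) (fun p => (col_glue (I := fin m) A' p).trans
    ((hA p).trans (col_glue (I := fin n) A (σ p)).symm))
    (fun _ => (col_pt _ _).trans (hB.trans (col_pt _ _).symm)) θ

/-- The square of a singleton over the point. -/
def oneSq : PbSq (toPt (fin 1)) (𝟙 pt) :=
  PbSq.ofExistsUnique (I := fin 1) (J := pt) (L := pt) (K := pt) (fun _ => ()) id (fun _ => rfl)
    fun _ _ _ => ⟨0, ⟨rfl, rfl⟩, fun _ _ => Subsingleton.elim _ _⟩

theorem block_toPt {n : ℕ} (k : Fin n → ℕ) : block k ≫ toPt (fin n) = toPt (fin (∑ i, k i)) := rfl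

/-- Identity operations. -/
noncomputable def opOne (A : M.fam pt) : M.Operation (fun _ : Fin 1 => A) A :=
  cell oneSq (fun p => (col_glue (I := fin 1) (fun _ => A) p).trans (col_pt A _).symm) (fun _ => rfl)
    (M.unitEl A)

/-- Composition of operations. -/
noncomputable def opComp {n : ℕ} {B : Fin n → M.fam pt} {C : M.fam pt} {k : Fin n → ℕ}
    {A : ∀ i, Fin (k i) → M.fam pt} (θ : M.Operation B C) (φ : ∀ i, M.Operation (A i) (B i)) :
    M.Operation (concat A) C :=
  cmp (block_toPt k) (blocks φ) θ

theorem rel_refl {n : ℕ} {A : Fin n → M.fam pt} {B : M.fam pt} (hA) (hB) (θ : M.Operation A B) :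
    rel (Equiv.refl _) hA hB θ = θ :=
  cell_id _ (fun _ => rfl) (fun _ => rfl) _ _ _

theorem rel_rel {l m n : ℕ} {A : Fin n → M.fam pt} {A' : Fin m → M.fam pt}
    {A'' : Fin l → M.fam pt} {B B' B'' : M.fam pt} (σ : Fin m ≃ Fin n) (τ : Fin l ≃ Fin m)
    (hA : ∀ p, A' p = A (σ p)) (hB : B' = B) (hA' : ∀ p, A'' p = A' (τ p)) (hB' : B'' = B')
    (θ : M.Operation A B) :
    rel τ hA' hB' (rel σ hA hB θ) =
      rel (τ.trans σ) (fun p => (hA' p).trans (hA _)) (hB'.trans hB) θ :=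
  cell_cell _ _ _ (fun _ => rfl) (fun _ => rfl) _ _ _ _ _

/-- Relabelling of a composite. -/
theorem opComp_rel {m n : ℕ} (σ : Fin m ≃ Fin n) {k' : Fin m → ℕ} {k : Fin n → ℕ}
    (τ : ∀ i, Fin (k' i) ≃ Fin (k (σ i))) {B : Fin n → M.fam pt} {B' : Fin m → M.fam pt}
    {C : M.fam pt} {A : ∀ i, Fin (k i) → M.fam pt} {A' : ∀ i, Fin (k' i) → M.fam pt}
    (hB : ∀ i, B' i = B (σ i)) (hA : ∀ i p, A' i p = A (σ i) (τ i p)) (θ : M.Operation B C)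
    (φ : ∀ i, M.Operation (A i) (B i)) (ρ : Fin (∑ i, k' i) ≃ Fin (∑ i, k i))
    (hρ : ∀ i p, ρ (finSigmaFinEquiv ⟨i, p⟩) = finSigmaFinEquiv ⟨σ i, τ i p⟩)
    (hA' : ∀ p, concat A' p = concat A (ρ p)) :
    opComp (rel σ hB rfl θ) (fun i => rel (τ i) (hA i) (hB i) (φ (σ i))) =
      rel ρ hA' rfl (opComp θ φ) := by
  -- The square over `σ` whose upper side is `ρ`. Its action turns the gluing of the original
  -- operations into the gluing of the relabelled ones, after which naturality of composition
  -- applies.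
  let s : PbSq (block k') (block k) := ofBlocks (FintypeCat.homMk σ)
    (fun i p => finSigmaFinEquiv ⟨σ i, τ i p⟩) (fun i p => block_apply _ _ _) fun i x hx => by
      obtain ⟨⟨i', q⟩, rfl⟩ := finSigmaFinEquiv.surjective x
      obtain rfl : i' = σ i := (block_apply k i' q).symm.trans hx
      refine ⟨(τ i).symm q, by simp, fun p hp => ?_⟩
      rw [Equiv.eq_symm_apply]
      exact eq_of_heq (Sigma.mk.inj (finSigmaFinEquiv.injective hp)).2
  have hs (x) : s.left x = ρ x := by
    obtain ⟨⟨i, p⟩, rfl⟩ := finSigmaFinEquiv.surjective x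
    rw [hρ]
    exact ofBlocks_left _ _ _ _ i p
  have h1 : blocks (fun i => rel (τ i) (hA i) (hB i) (φ (σ i))) = cell s
      (fun x => by rw [col_glue, col_glue, hA', hs]) (fun i => by rw [col_glue, col_glue]; exact hB i)
      (blocks φ) := by
    refine eq_blocks fun i => ?_
    rw [← cell_blocks φ (σ i)]
    refine (cell_cell (blockSq k' i) s ((pbDouble _).hcomp (permSq (τ i)) (blockSq k (σ i)))
      (fun p => ?_) (fun _ => rfl) _ _ _ _ _).trans
      (cell_cell (permSq (τ i)) (blockSq k (σ i)) _ (fun _ => rfl) (fun _ => rfl) _ _ _ _ _).symm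
    exact ofBlocks_left _ _ _ _ i p
  unfold opComp
  rw [h1]
  exact cmp_cell (block_toPt k') (block_toPt k) s (permSq σ) (permSq ρ) (fun _ => rfl)
    (fun x => (hs x).symm) (fun _ => rfl) _ _ _ _ _ _

end DFOperad

/-! ### Unit and associativity laws for operations -/

namespace DFOperad

open FintypeCat

variable {I J K L : FintypeCat.{0}} {M : DFOperad.{u}}

/-- The second factor is regarded as acted on by an identity square. -/
theorem cmp_cell_left {I' : FintypeCat.{0}} {f : I ⟶ J} {g : J ⟶ K} {h : I ⟶ K}
    {f' : I' ⟶ J} {h' : I' ⟶ K} (e : f ≫ g = h) (e' : f' ≫ g = h')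
    (s : PbSq f f') (st : PbSq h h') (hs : ∀ j, s.right j = j)
    (hl : ∀ i, st.left i = s.left i) (hr : ∀ k, st.right k = k)
    {X : M.fam I'} {Y : M.fam J} {Z : M.fam K} {X' : M.fam I}
    (hX : ∀ i, col X' i = col X (s.left i)) (hY : ∀ j, col Y j = col Y (s.right j))
    (φ : Het (M.prof f') X Y) (ψ : Het (M.prof g) Y Z) :
    cmp e (cell s hX hY φ) ψ = cell st (fun i => (hX i).trans (congrArg (col X) (hl i).symm))
      (fun k => congrArg (col Z) (hr k).symm) (cmp e' φ ψ) :=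
  (congrArg (cmp e _) (cell_id (Operad.idSq g) (fun _ => rfl) (fun _ => rfl) (fun _ => rfl)
    (fun _ => rfl) ψ).symm).trans
    (cmp_cell e e' s (Operad.idSq g) st hs hl hr hX hY (fun _ => rfl) (fun _ => rfl) φ ψ)

/-- Glued as a single block, `θ` is its own restriction along `t`, and `opOne B` is a restriction of
the unit element over `pt`. Naturality of composition then reduces the claim to the unit law there.
-/
theorem opOne_comp {n : ℕ} {A : Fin n → M.fam pt} {B : M.fam pt} (θ : M.Operation A B) :
    opComp (opOne B) (fun _ => θ) = rel (idxOne n) (concat_one A) rfl θ := by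
  let t : PbSq (block fun _ : Fin 1 => n) (toPt (fin n)) := ofBlocks (toPt (fin 1))
    (fun _ p => p) (fun _ _ => rfl) fun _ x _ => ⟨x, rfl, fun _ h => h⟩
  have ht (x) : idxOne n x = t.left x := by
    obtain ⟨⟨i, p⟩, rfl⟩ := finSigmaFinEquiv.surjective x
    refine Eq.trans ?_ (ofBlocks_left (k := fun _ => n) (g := toPt (fin n)) (toPt (fin 1))
      (fun _ p => p) _ _ i p).symm
    simp [idxOne, Equiv.uniqueSigma]
  have h : blocks (fun _ : Fin 1 => θ) = cell t
      (fun x => by rw [col_glue, col_glue]; exact (concat_one A x).trans (congrArg A (ht x)))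
      (fun i => by rw [col_glue, col_pt]) θ := by
    refine eq_blocks fun i => (cell_cell (blockSq _ i) t (Operad.idSq _) (fun p => ?_)
      (fun _ => rfl) _ _ _ _ _).trans (cell_id _ (fun _ => rfl) (fun _ => rfl) _ _ _)
    exact ofBlocks_left (k := fun _ => n) (g := toPt (fin n)) (toPt (fin 1)) (fun _ p => p) _ _ i p
  unfold opComp opOne
  rw [h]
  refine (cmp_cell (block_toPt _) (Category.comp_id _) t oneSq (permSq (idxOne n)) (fun _ => rfl)
    ht (fun _ => rfl) _ _ _ _ _ _).trans ?_
  rw [cmp_unitEl]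
  rfl

theorem comp_opOne {n : ℕ} {A : Fin n → M.fam pt} {B : M.fam pt} (θ : M.Operation A B) :
    opComp θ (fun i => opOne (A i)) = rel (idxUnit n) (concat_unit A) rfl θ := by
  let t : PbSq (block fun _ : Fin n => 1) (𝟙 (fin n)) := ofBlocks (𝟙 _)
    (fun i _ => i) (fun _ _ => rfl) fun i x h => ⟨0, h.symm, fun _ _ => Subsingleton.elim _ _⟩
  have ht (x) : idxUnit n x = t.left x := rfl
  have h : blocks (fun i => opOne (A i)) = cell t
      (fun x => by rw [col_glue, col_glue]; exact (concat_unit A x).trans (congrArg A (ht x)))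
      (fun i => rfl) (M.unitEl (glue (I := fin n) A)) := by
    refine eq_blocks fun i => ?_
    -- All the identities are restrictions, along the points of `fin n`, of one unit element, so
    -- their gluing is a restriction of that element.
    have h1 : M.unitEl (A i) = cell (Operad.vsq (point (I := fin n) i))
        (fun _ => by rw [col_pt, col_glue]; rfl) (fun _ => by rw [col_pt, col_glue]; rfl)
        (M.unitEl (glue (I := fin n) A)) := (cell_unitEl _ _ _).symm
    unfold opOne
    rw [h1]
    refine (cell_cell (blockSq _ i) t ((pbDouble _).hcomp oneSq (Operad.vsq (point (I := fin n) i)))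
      (fun p => ?_) (fun _ => rfl) _ _ _ _ _).trans
      (cell_cell oneSq (Operad.vsq (point (I := fin n) i)) _ (fun _ => rfl) (fun _ => rfl)
        _ _ _ _ _).symm
    exact ofBlocks_left (k := fun _ => 1) _ _ _ _ i p
  unfold opComp
  rw [h]
  refine (cmp_cell_left (block_toPt _) (Category.id_comp _) t (permSq (idxUnit n)) (fun _ => rfl)
    ht (fun _ => rfl) _ _ _ _).trans ?_
  rw [unitEl_cmp]
  rfl

section

variable {n : ℕ} {k : Fin n → ℕ} (m : ∀ i, Fin (k i) → ℕ)

theorem idxAssoc_apply (q : Fin (∑ i, k i))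
    (l : Fin (m (finSigmaFinEquiv.symm q).1 (finSigmaFinEquiv.symm q).2)) :
    idxAssoc m (finSigmaFinEquiv ⟨q, l⟩) = finSigmaFinEquiv
      ⟨(finSigmaFinEquiv.symm q).1, finSigmaFinEquiv ⟨(finSigmaFinEquiv.symm q).2, l⟩⟩ := by
  simp only [idxAssoc, Equiv.trans_apply, Equiv.symm_apply_apply]
  rfl

/-- The lengths of the blocks of blocks. -/
abbrev innerLen (p : Fin (∑ i, k i)) : ℕ :=
  m (finSigmaFinEquiv.symm p).1 (finSigmaFinEquiv.symm p).2

theorem block_idxAssoc_symm (i : Fin n) (x : Fin (∑ j, m i j)) :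
    block (innerLen m) ((idxAssoc m).symm (finSigmaFinEquiv ⟨i, x⟩)) =
      finSigmaFinEquiv ⟨i, block (m i) x⟩ := by
  obtain ⟨y, hy⟩ := (idxAssoc m).surjective (finSigmaFinEquiv ⟨i, x⟩)
  rw [← hy, Equiv.symm_apply_apply]
  obtain ⟨⟨q, l⟩, rfl⟩ := finSigmaFinEquiv.surjective y
  rw [idxAssoc_apply] at hy
  obtain ⟨rfl, h⟩ := Sigma.mk.inj (finSigmaFinEquiv.injective hy)
  obtain rfl := eq_of_heq h
  refine (block_apply (innerLen m) q l).trans ?_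
  rw [block_apply (m _)]
  exact (finSigmaFinEquiv.apply_symm_apply q).symm

/-- The square of a block of blocks. -/
def assocSq (i : Fin n) : PbSq (block (m i)) (block (innerLen m)) :=
  PbSq.ofExistsUnique (I := fin (∑ j, m i j)) (J := fin (k i))
    (fun x => (idxAssoc m).symm (finSigmaFinEquiv ⟨i, x⟩))
    (fun j => finSigmaFinEquiv ⟨i, j⟩) (block_idxAssoc_symm m i) fun z j hz => by
      obtain ⟨⟨q, l⟩, rfl⟩ := finSigmaFinEquiv.surjective z
      rw [block_apply, ← Equiv.symm_apply_eq] at hz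
      obtain ⟨rfl, h⟩ := Sigma.mk.inj (hz : (⟨_, _⟩ : (i : Fin n) × Fin (k i)) = _)
      obtain rfl := eq_of_heq h
      refine ⟨finSigmaFinEquiv ⟨_, l⟩, ⟨?_, block_apply _ _ _⟩, fun x hx => ?_⟩
      · exact (Equiv.symm_apply_eq _).2 (idxAssoc_apply m q l).symm
      · have hx' := ((Equiv.symm_apply_eq _).1 hx.1).trans (idxAssoc_apply m q l)
        exact eq_of_heq (Sigma.mk.inj (finSigmaFinEquiv.injective hx')).2

/-- The square relating the two ways of concatenating. -/
def assocIsoSq : PbSq (block (innerLen m) ≫ block k) (block fun i => ∑ j, m i j) :=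
  PbSq.ofExistsUnique (idxAssoc m) id (fun y => by
      obtain ⟨⟨q, l⟩, rfl⟩ := finSigmaFinEquiv.surjective y
      rw [idxAssoc_apply, block_apply]
      exact congrArg (block k) (block_apply (innerLen m) q l).symm)
    fun x i hx => by
      refine ⟨(idxAssoc m).symm x, ⟨Equiv.apply_symm_apply _ _, ?_⟩,
        fun y hy => (Equiv.symm_apply_eq _).2 hy.1.symm |>.symm⟩
      obtain ⟨⟨i', x⟩, rfl⟩ := finSigmaFinEquiv.surjective x
      rw [block_apply] at hx
      subst hx
      exact (congrArg (block k) (block_idxAssoc_symm m i' x)).trans (block_apply _ _ _)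

/-- The `j`-th block of the `i`-th block is the block of index `finSigmaFinEquiv ⟨i, j⟩` in the full
concatenation, so the inner gluing restricts the global one. -/
theorem blocks_assoc {B : ∀ i, Fin (k i) → M.fam pt} {A : ∀ i j, Fin (m i j) → M.fam pt}
    (ψ : ∀ i j, M.Operation (A i j) (B i j)) (i : Fin n) (hX hY) :
    blocks (ψ i) = cell (assocSq m i) hX hY (blocks (B := concat B)
      fun p => ψ (finSigmaFinEquiv.symm p).1 (finSigmaFinEquiv.symm p).2) := by
  refine eq_blocks fun j => ?_
  -- Writing the pair as the decomposition of an index `q` makes the dependent types on both sides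
  -- literally the same.
  obtain ⟨q, hq⟩ : ∃ q, (⟨i, j⟩ : (i : Fin n) × Fin (k i)) = finSigmaFinEquiv.symm q :=
    ⟨_, (Equiv.symm_apply_apply _ _).symm⟩
  obtain ⟨rfl, h⟩ := Sigma.mk.inj (hq : _ = (⟨_, _⟩ : (i : Fin n) × Fin (k i)))
  obtain rfl := eq_of_heq h
  refine (cell_cell (blockSq _ _) (assocSq m _) (blockSq (innerLen m) q) (fun p => ?_)
    (fun _ => ?_) _ _ _ _ _).trans (cell_blocks _ q)
  · refine (Equiv.symm_apply_eq _).2 ?_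
    exact (idxAssoc_apply m q p).symm
  · exact finSigmaFinEquiv.apply_symm_apply q

theorem opComp_assoc {C : Fin n → M.fam pt} {D : M.fam pt}
    {B : ∀ i, Fin (k i) → M.fam pt} {A : ∀ i j, Fin (m i j) → M.fam pt}
    (θ : M.Operation C D) (φ : ∀ i, M.Operation (B i) (C i))
    (ψ : ∀ i j, M.Operation (A i j) (B i j)) :
    opComp (opComp θ φ) (fun p => ψ (finSigmaFinEquiv.symm p).1 (finSigmaFinEquiv.symm p).2) =
      rel (idxAssoc m) (concat_assoc A) rfl (opComp θ (fun i => opComp (φ i) (ψ i))) := by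
  -- A gluing of composites is, up to reassociation, a composite of gluings. This is checked over
  -- each `i`, along the vertical pasting of `assocSq m i` with the block square; associativity of
  -- `cmp` then finishes.
  have h : cmp rfl (blocks (B := concat B)
        fun p => ψ (finSigmaFinEquiv.symm p).1 (finSigmaFinEquiv.symm p).2) (blocks φ) =
      cell (assocIsoSq m) (fun x => by rw [col_glue, col_glue]; exact concat_assoc A x)
        (fun _ => rfl) (blocks fun i => opComp (φ i) (ψ i)) := by
    let z (i) : PbSq (toPt (fin (∑ j, m i j))) (block (innerLen m) ≫ block k) :=
      (pbDouble FintypeCat.{0}).vcompSq (assocSq m i) (blockSq k i) rfl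
    have hz (i) (p) : (assocIsoSq m).left ((z i).left p) = finSigmaFinEquiv ⟨i, p⟩ :=
      (idxAssoc m).apply_symm_apply _
    have hX (i) (p) : col (glue (I := fin (∑ j, m i j)) (concat (A i))) p =
        col (glue (I := fin (∑ q, innerLen m q)) (concat fun q : Fin (∑ i, k i) =>
          A (finSigmaFinEquiv.symm q).1 (finSigmaFinEquiv.symm q).2)) ((z i).left p) := by
      rw [col_glue, col_glue]
      refine Eq.trans ?_ (concat_assoc A _).symm
      refine Eq.trans ?_ (congrArg (concat fun i => concat (A i)) (hz i p)).symm
      exact (concat_finSigma (fun i => concat (A i)) ⟨i, p⟩).symm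
    refine (cell_bijective z (jointlyBijective_point (fin n)) hX
      (col_blockSq_right k C)).1 (funext fun i => ?_)
    refine Eq.trans ?_ (((cell_cell (z i) (assocIsoSq m) (blockSq (fun i => ∑ j, m i j) i)
      (hz i) (fun _ => rfl) _ _ _ _ _).trans
      (cell_blocks (fun i => opComp (φ i) (ψ i)) i)).symm)
    unfold opComp
    rw [blocks_assoc m ψ i (hX i) (fun j => by
      rw [col_glue, col_glue]; exact (concat_finSigma B ⟨i, j⟩).symm), ← cell_blocks φ i]
    exact (cmp_cell (block_toPt _) rfl (assocSq m i) (blockSq k i) (z i) (fun _ => rfl)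
      (fun _ => rfl) (fun _ => rfl) _ _ _ _ _ _).symm
  unfold opComp at h ⊢
  refine (cmp_assoc rfl rfl (block_toPt _) (block_toPt _) _ _ _).symm.trans
    ((congrArg (cmp rfl · θ) h).trans ?_)
  exact cmp_cell_left rfl (block_toPt _) (assocIsoSq m) (permSq (idxAssoc m))
    (fun _ => rfl) (fun _ => rfl) (fun _ => rfl) _ _ _ _

end

variable (M)

/-- The data of the coloured operad of a DF operad. -/
noncomputable def toOperadData : OperadData.{u} where
  Col := M.fam pt
  Op A B := M.Operation A B
  one := opOne
  comp := opComp
  act σ θ := rel σ (fun _ => rfl) rfl θ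

theorem toOperadData_relabel {m n : ℕ} {A : Fin n → M.fam pt} {A' : Fin m → M.fam pt}
    {B B' : M.fam pt} (σ : Fin m ≃ Fin n) (hA : ∀ p, A' p = A (σ p)) (hB : B' = B)
    (θ : M.Operation A B) : M.toOperadData.relabel σ hA hB θ = rel σ hA hB θ := by
  obtain rfl : m = n := by simpa using Fintype.card_congr σ
  obtain rfl : A' = A ∘ σ := funext hA
  subst hB
  rfl

/-- The coloured operad of a DF operad. -/
noncomputable def toOperad : Operad.{u} where
  toOperadData := M.toOperadData
  act_refl θ := rel_refl (fun _ => rfl) rfl θ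
  act_trans σ τ θ := rel_rel σ τ (fun _ => rfl) rfl (fun _ => rfl) rfl θ
  one_comp θ := (opOne_comp θ).trans (M.toOperadData_relabel _ _ _ _).symm
  comp_one θ := (comp_opOne θ).trans (M.toOperadData_relabel _ _ _ _).symm
  comp_assoc {n k m C D B A} θ φ ψ :=
    (opComp_assoc m θ φ ψ).trans (M.toOperadData_relabel _ _ _ _).symm
  act_comp {n k B C A} σ θ φ := by
    refine Eq.trans ?_ (M.toOperadData_relabel _ _ _ _).symm
    -- `opComp_rel` with trivial permutations inside the blocks; `comp_act` below is the case of a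
    -- trivial permutation of the blocks.
    refine Eq.trans ?_ (opComp_rel σ (fun i => Equiv.refl (Fin (k (σ i)))) (fun _ => rfl)
      (fun _ _ => rfl) θ φ (idxBlock σ k) (fun i p => ?_) (concat_block σ A))
    · exact congrArg (opComp (rel σ (fun _ => rfl) rfl θ))
        (funext fun i => (rel_refl (fun _ => rfl) rfl (φ (σ i))).symm)
    · simp only [idxBlock, Equiv.trans_apply, Equiv.symm_apply_apply]
      rfl
  comp_act {n k B C A} τ θ φ := by
    refine Eq.trans ?_ (M.toOperadData_relabel _ _ _ _).symm
    refine Eq.trans ?_ (opComp_rel (Equiv.refl _) τ (fun _ => rfl)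
      (fun _ _ => rfl) θ φ (idxSum τ) (fun i p => ?_) (concat_sum τ A))
    · exact congrArg (fun θ' => opComp θ' fun i => rel (τ i) (fun _ => rfl) rfl (φ i))
        (rel_refl (fun _ => rfl) rfl θ).symm
    · simp only [idxSum, Equiv.trans_apply, Equiv.symm_apply_apply]
      rfl

end DFOperad

/-! ### A DF operad as the non-skeletal form of its operad -/

namespace DFOperad

open FintypeCat

variable {I J K L : FintypeCat.{0}} {M : DFOperad.{u}}

theorem col_fibreSq_left {f : I ⟶ J} (E : FibreEnum f) (X : M.fam I) (j : J)
    (p : Fin (E.card j)) :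
    col (glue (I := fin (E.card j)) fun p => col X (E.idx j p).1) p =
      col X ((fibreSq E j).left p) :=
  col_glue (I := fin (E.card j)) (fun p => col X (E.idx j p).1) p

theorem col_fibreSq_right {f : I ⟶ J} (E : FibreEnum f) (Y : M.fam J) (j : J) (x : pt) :
    col (col Y j) x = col Y ((fibreSq E j).right x) :=
  col_pt (col Y j) x

/-- The operations on the fibres given by an element over a mapping. -/
noncomputable def fibreOps {f : I ⟶ J} (E : FibreEnum f) (X : M.fam I) (Y : M.fam J) :
    Het (M.prof f) X Y ≃ ∀ j, M.Operation (fun p => col X (E.idx j p).1) (col Y j) :=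
  Equiv.ofBijective
    (fun φ j => cell (fibreSq E j) (col_fibreSq_left E X j) (col_fibreSq_right E Y j) φ)
    (cell_bijective (fibreSq E) (jointlyBijective_fibreSq E) (col_fibreSq_left E X)
      (col_fibreSq_right E Y))

/-- The fibre square at `j` pasted with `s` equals the square of `σ` pasted with the fibre square of
`g` at `s.right j`. -/
theorem fibreOps_cell {f : I ⟶ J} {g : L ⟶ K} (s : PbSq f g)
    (E : FibreEnum f) (E' : FibreEnum g) {X : M.fam L} {Y : M.fam K} {X' : M.fam I}
    {Y' : M.fam J} (hX : ∀ i, col X' i = col X (s.left i)) (hY : ∀ j, col Y' j = col Y (s.right j))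
    (φ : Het (M.prof g) X Y) (j : J) (σ : Fin (E.card j) ≃ Fin (E'.card (s.right j)))
    (hσ : ∀ p, s.left (E.idx j p).1 = (E'.idx (s.right j) (σ p)).1) :
    fibreOps E X' Y' (cell s hX hY φ) j = rel σ (fun p => (hX _).trans (congrArg (col X) (hσ p)))
      (hY j) (fibreOps E' X Y φ (s.right j)) :=
  (cell_cell (fibreSq E j) s ((pbDouble _).hcomp (permSq σ) (fibreSq E' (s.right j))) hσ
    (fun _ => rfl) hX hY (col_fibreSq_left E X' j) (col_fibreSq_right E Y' j) φ).trans
    (cell_cell (permSq σ) (fibreSq E' (s.right j)) _ (fun _ => rfl) (fun _ => rfl)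
      (col_fibreSq_left E' X (s.right j)) (col_fibreSq_right E' Y (s.right j)) _ _ φ).symm

theorem fibreOps_unitEl (E : FibreEnum (𝟙 I)) (X : M.fam I) (i : I)
    (σ : Fin (E.card i) ≃ Fin 1) :
    fibreOps E X X (M.unitEl X) i =
      rel σ (fun p => congrArg (col X) (E.idx i p).2) rfl (opOne (col X i)) := by
  have h : M.unitEl (col X i) = cell (Operad.vsq (point i)) (fun _ => col_pt (col X i) _)
      (fun _ => col_pt (col X i) _) (M.unitEl X) :=
    (cell_unitEl (Operad.vsq (point i)) (fun _ => col_pt (col X i) _) _).symm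
  unfold opOne
  rw [h]
  have h1 := cell_cell oneSq (Operad.vsq (point i))
    ((pbDouble FintypeCat.{0}).hcomp oneSq (Operad.vsq (point i))) (fun _ => rfl) (fun _ => rfl)
    (fun _ => col_pt (col X i) _) (fun _ => col_pt (col X i) _)
    (fun p => (col_glue (I := fin 1) (fun _ => col X i) p).trans (col_pt (col X i) _).symm)
    (fun _ => rfl) (M.unitEl X)
  rw [h1]
  refine Eq.trans ?_ (cell_cell (permSq σ) _ (fibreSq E i) (fun p => ?_) (fun _ => rfl)
    _ _ _ _ _).symm
  · rfl
  · exact (E.idx i p).2.symm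

theorem fibreOps_cmp {f : I ⟶ J} {g : J ⟶ K} {h : I ⟶ K} (e : f ≫ g = h) (E : FibreEnum f)
    (E' : FibreEnum g) (E'' : FibreEnum h) {X : M.fam I} {Y : M.fam J} {Z : M.fam K}
    (φ : Het (M.prof f) X Y) (ψ : Het (M.prof g) Y Z) (k : K)
    (σ : Fin (E''.card k) ≃ Fin (∑ q, E.card (E'.idx k q).1))
    (hσ : ∀ p, (E''.idx k p).1 = E.concatIdx E' k (σ p)) :
    fibreOps E'' X Z (cmp e φ ψ) k = rel σ (fun p => congrArg (col X) (hσ p)) rfl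
      (opComp (fibreOps E' Y Z ψ k) (fun q => fibreOps E X Y φ (E'.idx k q).1)) := by
  -- Over the enumerated fibre of `g` at `k`, the mapping `f` becomes a projection onto blocks, the
  -- blocks being its own fibres.
  let s : PbSq (block fun q => E.card (E'.idx k q).1) f :=
    ofBlocks (FintypeCat.homMk fun q => (E'.idx k q).1) (fun q p => (E.idx (E'.idx k q).1 p).1)
      (fun q p => (E.idx (E'.idx k q).1 p).2)
      fun q x hx => ⟨(E.idx _).symm ⟨x, hx⟩, by simp, fun p hp =>
        ((E.idx _).symm_apply_eq.2 (Subtype.ext hp.symm)).symm⟩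
  have hs (x) : s.left x = E.concatIdx E' k x := rfl
  have h1 : blocks (fun q => fibreOps E X Y φ (E'.idx k q).1) = cell s
      (fun x => col_glue _ x)
      (fun q => col_glue (I := fin (E'.card k)) (fun q => col Y (E'.idx k q).1) q) φ := by
    refine eq_blocks fun q => cell_cell (blockSq _ q) s (fibreSq E _) (fun p => ?_)
      (fun _ => rfl) _ _ _ _ φ
    exact E.concatIdx_finSigma E' k q p
  unfold opComp
  rw [h1]
  -- Stacked on the fibre square of `g`, the square `s` gives the fibre of the composite with its
  -- concatenated enumeration; it differs from the fibre square of `E''` by `σ`.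
  let st : PbSq (toPt (fin (∑ q, E.card (E'.idx k q).1))) h :=
    PbSq.mk s.left (point k) (by
      subst e
      exact ((pbDouble FintypeCat.{0}).vcompSq s (fibreSq E' k) rfl).isPullback)
  have h2 := cmp_cell (block_toPt fun q => E.card (E'.idx k q).1) e s (fibreSq E' k) st
    (fun _ => rfl) (fun _ => rfl) (fun _ => rfl) (fun x => col_glue _ x)
    (fun q => col_glue (I := fin (E'.card k)) (fun q => col Y (E'.idx k q).1) q)
    (col_fibreSq_left E' Y k) (col_fibreSq_right E' Z k) φ ψ
  refine Eq.trans ?_ (congrArg (rel σ _ _) h2).symm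
  exact (cell_cell (permSq σ) st (fibreSq E'' k) (fun p => (hσ p).symm) (fun _ => rfl)
    _ _ _ _ _).symm

variable (M)

/-- A DF operad is the non-skeletal form of its coloured operad. -/
noncomputable def nonSkeletalForm : NonSkeletalForm M.toOperad M where
  obj I := M.colEquiv I
  obj_reindex l Y j := col_reindex l Y j
  ops {_ _ _} E {X Y} := fibreOps E X Y
  ops_cell {_ _ _ _ _ _} s E E' {X Y} φ j σ hσ :=
    (fibreOps_cell s E E' (col_reindex _ X) (col_reindex _ Y) φ j σ hσ).trans
      (M.toOperadData_relabel _ _ _ _).symm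
  ops_unit {_} E X i σ := (fibreOps_unitEl E X i σ).trans (M.toOperadData_relabel _ _ _ _).symm
  ops_comp {_ _ _ _ _} E E' E'' {_ _ _} φ ψ k σ hσ :=
    (fibreOps_cmp rfl E E' E'' φ ψ k σ hσ).trans (M.toOperadData_relabel _ _ _ _).symm

end DFOperad

/-! ## Isomorphisms of DF operads in terms of elements -/

namespace DFOperad

variable {I J K L : FintypeCat.{0}}

section

variable {M : DFOperad.{u}}

theorem cell_congr_heq {f : I ⟶ J} {g : L ⟶ K} (s : PbSq f g) {X X₂ : M.fam L} {Y Y₂ : M.fam K}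
    {X' X₂' : M.fam I} {Y' Y₂' : M.fam J} (hX : ∀ i, col X' i = col X (s.left i))
    (hY : ∀ j, col Y' j = col Y (s.right j)) (hX₂ : ∀ i, col X₂' i = col X₂ (s.left i))
    (hY₂ : ∀ j, col Y₂' j = col Y₂ (s.right j)) (eX : X = X₂) (eY : Y = Y₂)
    {φ : Het (M.prof g) X Y} {φ₂ : Het (M.prof g) X₂ Y₂} (h : HEq φ φ₂) :
    HEq (cell s hX hY φ) (cell s hX₂ hY₂ φ₂) :=
  (cell_heq _ _ _ _).trans ((Cell.app_heq _ eX eY h).trans (cell_heq _ _ _ _).symm)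

theorem cmp_congr_heq {f : I ⟶ J} {g : J ⟶ K} {h : I ⟶ K} (e : f ≫ g = h) {X X' : M.fam I}
    {Y Y' : M.fam J} {Z Z' : M.fam K} (hX : X = X') (hY : Y = Y') (hZ : Z = Z')
    {φ : Het (M.prof f) X Y} {ψ : Het (M.prof g) Y Z} {φ' : Het (M.prof f) X' Y'}
    {ψ' : Het (M.prof g) Y' Z'} (hφ : HEq φ φ') (hψ : HEq ψ ψ') :
    HEq (cmp e φ ψ) (cmp e φ' ψ') :=
  (compCell_heq e rfl rfl rfl HEq.rfl HEq.rfl).symm.trans (compCell_heq e hX hY hZ hφ hψ)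

/-- Normality enters here: arrows are exactly the elements over an identity mapping. -/
theorem unitMap_bijective (X Y : M.fam I) :
    Function.Bijective fun g : X ⟶ Y => unitMap g := by
  obtain ⟨e, h⟩ := M.normal (op I)
  -- Normality is an equality of profunctors; replacing the target by a variable `Φ` allows it to be
  -- substituted.
  have key : ∀ (Φ : Prof (M.fam I) (M.fam I)) (e : Prof.hom (M.fam I) = Φ)
      (α : Cell (Prof.hom (M.fam I)) Φ) (_ : α = e ▸ Cell.hid (Prof.hom (M.fam I)))
      (hl : α.left = 𝟙 (M.fam I)) (hr : α.right = 𝟙 (M.fam I)),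
      Function.Bijective fun g : X ⟶ Y =>
        Cell.appOf (F := 𝟙 (M.fam I)) (G := 𝟙 (M.fam I)) α hl hr g := by
    rintro _ rfl α rfl _ _
    exact Function.bijective_id
  exact key _ e _ h _ _

theorem unitMap_comp {X Y Z : M.fam I} (g : X ⟶ Y) (h : Y ⟶ Z) :
    unitMap (g ≫ h) = cmp (Category.id_comp (𝟙 I)) (unitMap g) (unitMap h) := by
  rw [unitMap_cmp]
  refine eq_of_heq ((unitMap_heq _).trans ((heq_of_eq ((M.unitCell I).app_pre g h)).trans ?_))
  refine pre_map_heq (M.prof (𝟙 I)) (M.unitCell_left I) g ?_ (unitMap_heq h).symm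
  exact congrArg (fun F => F.toFunctor.obj Z) (M.unitCell_right I)

theorem heq_of_unitMap_heq {X X' Y Y' : M.fam I} (hX : X = X') (hY : Y = Y') {g : X ⟶ Y}
    {g' : X' ⟶ Y'} (h : HEq (unitMap g) (unitMap g')) : HEq g g' := by
  subst hX hY
  exact heq_of_eq ((unitMap_bijective _ _).1 (eq_of_heq h))

end

/-- Isomorphisms of DF operads, in terms of objects and elements. -/
structure ElementIso (M M' : DFOperad.{u}) where
  obj : (I : FintypeCat.{0}) → M.fam I ≃ M'.fam I
  obj_reindex : ∀ {I L : FintypeCat.{0}} (l : I ⟶ L) (X : M.fam L),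
    obj I ((M.reindex l).toFunctor.obj X) = (M'.reindex l).toFunctor.obj (obj L X)
  het : {I J : FintypeCat.{0}} → (f : I ⟶ J) → {X : M.fam I} → {Y : M.fam J} →
    Het (M.prof f) X Y ≃ Het (M'.prof f) (obj I X) (obj J Y)
  het_cell : ∀ {I J L K : FintypeCat.{0}} {f : I ⟶ J} {g : L ⟶ K} (s : PbSq f g) {X : M.fam L}
    {Y : M.fam K} {X' : M.fam I} {Y' : M.fam J} (hX : ∀ i, col X' i = col X (s.left i))
    (hY : ∀ j, col Y' j = col Y (s.right j))
    (hX' : ∀ i, col (obj I X') i = col (obj L X) (s.left i))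
    (hY' : ∀ j, col (obj J Y') j = col (obj K Y) (s.right j)) (φ : Het (M.prof g) X Y),
    het f (cell s hX hY φ) = cell s hX' hY' (het g φ)
  het_unitEl : ∀ {I : FintypeCat.{0}} (X : M.fam I), het (𝟙 I) (M.unitEl X) = M'.unitEl (obj I X)
  het_cmp : ∀ {I J K : FintypeCat.{0}} {f : I ⟶ J} {g : J ⟶ K} {h : I ⟶ K} (e : f ≫ g = h)
    {X : M.fam I} {Y : M.fam J} {Z : M.fam K} (φ : Het (M.prof f) X Y) (ψ : Het (M.prof g) Y Z),
    het h (cmp e φ ψ) = cmp e (het f φ) (het g ψ)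

namespace ElementIso

variable {M M' : DFOperad.{u}} (T : ElementIso M M')

/-- Supplies the hypotheses of `het_cell` about the transported objects. -/
theorem col_obj {l : I ⟶ L} {X : M.fam L} {X' : M.fam I} (hX : ∀ i, col X' i = col X (l i))
    (i : I) : col (T.obj I X') i = col (T.obj L X) (l i) := by
  rw [← reindex_eq hX, T.obj_reindex, col_reindex]

theorem het_congr (f : I ⟶ J) {X X' : M.fam I} {Y Y' : M.fam J} (hX : X = X') (hY : Y = Y')
    {φ : Het (M.prof f) X Y} {φ' : Het (M.prof f) X' Y'} (h : HEq φ φ') :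
    HEq (T.het f φ) (T.het f φ') := by
  subst hX hY
  obtain rfl := eq_of_heq h
  rfl

theorem heq_of_het_heq (f : I ⟶ J) {X X' : M.fam I} {Y Y' : M.fam J} (hX : X = X') (hY : Y = Y')
    {φ : Het (M.prof f) X Y} {φ' : Het (M.prof f) X' Y'} (h : HEq (T.het f φ) (T.het f φ')) :
    HEq φ φ' := by
  subst hX hY
  exact heq_of_eq ((T.het f).injective (eq_of_heq h))

/-- The inverse on elements. -/
noncomputable def symmHet (f : I ⟶ J) (X : M'.fam I) (Y : M'.fam J) :
    Het (M'.prof f) X Y ≃ Het (M.prof f) ((T.obj I).symm X) ((T.obj J).symm Y) :=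
  (Equiv.cast (by rw [Equiv.apply_symm_apply, Equiv.apply_symm_apply])).trans (T.het f).symm

theorem het_symmHet (f : I ⟶ J) {X : M'.fam I} {Y : M'.fam J} (φ : Het (M'.prof f) X Y) :
    HEq (T.het f (T.symmHet f X Y φ)) φ := by
  refine (heq_of_eq ((T.het f).apply_symm_apply _)).trans ?_
  exact cast_heq _ _

theorem symmHet_het (f : I ⟶ J) {X : M.fam I} {Y : M.fam J} (φ : Het (M.prof f) X Y) :
    HEq (T.symmHet f _ _ (T.het f φ)) φ :=
  T.heq_of_het_heq f ((T.obj I).symm_apply_apply X) ((T.obj J).symm_apply_apply Y)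
    (T.het_symmHet f _)

/-- The inverse isomorphism. -/
noncomputable def symm : ElementIso M' M where
  obj I := (T.obj I).symm
  obj_reindex l X := by
    rw [Equiv.symm_apply_eq, T.obj_reindex, Equiv.apply_symm_apply]
  het {_ _} f {X Y} := T.symmHet f X Y
  het_cell {I J L K f g} s X Y X' Y' hX hY hX' hY' φ := by
    refine (T.het f).injective (eq_of_heq ((T.het_symmHet f _).trans ?_))
    rw [T.het_cell s hX' hY' (T.col_obj hX') (T.col_obj hY')]
    exact cell_congr_heq s _ _ _ _ ((T.obj L).apply_symm_apply X).symm
      ((T.obj K).apply_symm_apply Y).symm (T.het_symmHet g φ).symm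
  het_unitEl {I} X := by
    refine (T.het (𝟙 I)).injective (eq_of_heq ((T.het_symmHet _ _).trans ?_))
    rw [T.het_unitEl, Equiv.apply_symm_apply]
  het_cmp {I J K f g h} e X Y Z φ ψ := by
    refine (T.het h).injective (eq_of_heq ((T.het_symmHet h _).trans ?_))
    rw [T.het_cmp]
    exact cmp_congr_heq e ((T.obj I).apply_symm_apply X).symm ((T.obj J).apply_symm_apply Y).symm
      ((T.obj K).apply_symm_apply Z).symm (T.het_symmHet f φ).symm (T.het_symmHet g ψ).symm

/-- Arrows being elements over the identity, the action on them is forced by `het`. Functoriality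
thereby reduces to `het_unitEl` and `het_cmp`. -/
theorem exists_map {X Y : M.fam I} (g : X ⟶ Y) :
    ∃ g' : T.obj I X ⟶ T.obj I Y, unitMap g' = T.het (𝟙 I) (unitMap g) :=
  (unitMap_bijective _ _).2 _

/-- The functors underlying an isomorphism. -/
noncomputable def functor (I : FintypeCat.{0}) : M.fam I ⥤ M'.fam I where
  obj X := T.obj I X
  map g := (T.exists_map g).choose
  map_id X := (unitMap_bijective _ _).1 ((T.exists_map (𝟙 X)).choose_spec.trans
    (T.het_unitEl X))
  map_comp g h := (unitMap_bijective _ _).1 <|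
    (T.exists_map (g ≫ h)).choose_spec.trans ((congrArg (T.het _) (unitMap_comp g h)).trans
      ((T.het_cmp _ _ _).trans ((unitMap_comp _ _).trans (congrArg₂ (cmp _)
        (T.exists_map g).choose_spec (T.exists_map h).choose_spec)).symm))

theorem unitMap_map {X Y : M.fam I} (g : X ⟶ Y) :
    unitMap ((T.functor I).map g) = T.het (𝟙 I) (unitMap g) :=
  (T.exists_map g).choose_spec

/-- The functors underlying an isomorphism, as arrows. -/
noncomputable def hom (I : FintypeCat.{0}) : M.fam I ⟶ M'.fam I := (T.functor I).toCatHom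

/-- The cells underlying an isomorphism. -/
noncomputable def hetCell (f : I ⟶ J) : Cell (M.prof f) (M'.prof f) where
  left := T.hom I
  right := T.hom J
  app φ := T.het f φ
  app_pre g φ := by
    refine Eq.trans ?_ (unitMap_cmp (Category.id_comp f) ((T.functor _).map g) (T.het f φ))
    rw [← unitMap_cmp (Category.id_comp f), T.het_cmp, ← T.unitMap_map]
    rfl
  app_post φ g := by
    refine Eq.trans ?_ (cmp_unitMap (Category.comp_id f) (T.het f φ) ((T.functor _).map g))
    rw [← cmp_unitMap (Category.comp_id f), T.het_cmp, ← T.unitMap_map]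
    rfl

/-- On arrows, the two composites are compared through `unitMap`, which commutes with restriction by
`cell_unitMap`. -/
theorem reindex_functor (l : I ⟶ L) :
    M.reindex l ≫ T.hom I = T.hom L ≫ M'.reindex l := by
  refine Cat.ext (Functor.hext (fun X => T.obj_reindex l X) fun X Y g => ?_)
  refine heq_of_unitMap_heq (T.obj_reindex l X) (T.obj_reindex l Y) ?_
  have h1 : unitMap ((T.functor I).map ((M.reindex l).toFunctor.map g)) =
      cell (Operad.vsq l) (T.col_obj (col_reindex l X)) (T.col_obj (col_reindex l Y))
        (unitMap ((T.functor L).map g)) := by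
    rw [T.unitMap_map, ← cell_unitMap]
    exact (T.het_cell (Operad.vsq l) _ _ _ _ _).trans
      (congrArg (cell (Operad.vsq l) _ _) (T.unitMap_map g).symm)
  have h2 := cell_unitMap l ((T.functor L).map g)
  refine (heq_of_eq h1).trans (HEq.trans ?_ (heq_of_eq h2))
  exact cell_congr_heq (Operad.vsq l) _ _ _ _ rfl rfl HEq.rfl

/-- The double natural transformation underlying an isomorphism. -/
noncomputable def trans : LaxDoubleFunctor.Trans M.toLaxDoubleFunctor M'.toLaxDoubleFunctor where
  app I := T.hom I.unop
  sq f := T.hetCell f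
  left_sq _ := rfl
  right_sq _ := rfl
  app_natural k := T.reindex_functor k.unop
  sq_natural {I J L K f g} s := by
    have hl := (congrArg (· ≫ T.hom L.unop) (M.sqCell_left s)).trans
      ((T.reindex_functor _).trans (congrArg (T.hom I.unop ≫ ·)
        (M'.sqCell_left s).symm))
    have hr := (congrArg (· ≫ T.hom K.unop) (M.sqCell_right s)).trans
      ((T.reindex_functor _).trans (congrArg (T.hom J.unop ≫ ·)
        (M'.sqCell_right s).symm))
    refine Cell.ext_heq hl hr fun X Y φ => ?_
    have h1 := T.het_cell s (col_reindex _ X) (col_reindex _ Y) (T.col_obj (col_reindex _ X))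
      (T.col_obj (col_reindex _ Y)) φ
    refine HEq.trans ?_ ((heq_of_eq h1).trans (cell_heq s _ _ _))
    refine T.het_congr _ ?_ ?_ (cell_heq s _ _ φ).symm
    · exact congrArg (fun F => F.toFunctor.obj X) (M.sqCell_left s)
    · exact congrArg (fun F => F.toFunctor.obj Y) (M.sqCell_right s)
  unit_sq I := by
    have hl := (congrArg (· ≫ T.hom I.unop) (M.unitCell_left I.unop)).trans
      (congrArg (T.hom I.unop ≫ ·) (M'.unitCell_left I.unop).symm)
    have hr := (congrArg (· ≫ T.hom I.unop) (M.unitCell_right I.unop)).trans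
      (congrArg (T.hom I.unop ≫ ·) (M'.unitCell_right I.unop).symm)
    refine Cell.ext_heq hl hr fun X Y g => ?_
    refine HEq.trans ?_ ((heq_of_eq (T.unitMap_map g).symm).trans (unitMap_heq _))
    refine T.het_congr _ ?_ ?_ (unitMap_heq g).symm
    · exact congrArg (fun F => F.toFunctor.obj X) (M.unitCell_left I.unop)
    · exact congrArg (fun F => F.toFunctor.obj Y) (M.unitCell_right I.unop)
  comp_sq {I J K} f g := by
    have hl := (congrArg (· ≫ T.hom I.unop)
      (M.compCell_left (I := I.unop) (J := J.unop) (K := K.unop) f g)).trans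
      (congrArg (T.hom I.unop ≫ ·)
        (M'.compCell_left (I := I.unop) (J := J.unop) (K := K.unop) f g).symm)
    have hr := (congrArg (· ≫ T.hom K.unop)
      (M.compCell_right (I := I.unop) (J := J.unop) (K := K.unop) f g)).trans
      (congrArg (T.hom K.unop ≫ ·)
        (M'.compCell_right (I := I.unop) (J := J.unop) (K := K.unop) f g).symm)
    refine Cell.ext_heq hl hr fun X Z x => ?_
    induction x using CompHet.ind with | h Y φ ψ =>
    refine HEq.trans ?_ ((heq_of_eq (T.het_cmp (I := I.unop) (J := J.unop) (K := K.unop) (f := f)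
      (g := g) rfl φ ψ)).trans (compCell_heq (M := M') (I := I.unop) (J := J.unop) (K := K.unop)
      (f := f) (g := g) rfl rfl rfl rfl HEq.rfl (pre_eqToHom_heq _ _ _)).symm)
    refine T.het_congr (I := I.unop) (J := K.unop) _ ?_ ?_ (compCell_heq (I := I.unop)
      (J := J.unop) (K := K.unop) (f := f) (g := g) rfl rfl rfl rfl HEq.rfl HEq.rfl)
    · exact congrArg (fun F => F.toFunctor.obj X)
        (M.compCell_left (I := I.unop) (J := J.unop) (K := K.unop) f g)
    · exact congrArg (fun F => F.toFunctor.obj Z)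
        (M.compCell_right (I := I.unop) (J := J.unop) (K := K.unop) f g)

theorem functor_symm_functor (I : FintypeCat.{0}) :
    T.hom I ≫ T.symm.hom I = 𝟙 (M.fam I) := by
  refine Cat.ext (Functor.hext (fun X => (T.obj I).symm_apply_apply X) fun X Y g => ?_)
  refine heq_of_unitMap_heq ((T.obj I).symm_apply_apply X) ((T.obj I).symm_apply_apply Y) ?_
  refine (heq_of_eq (T.symm.unitMap_map _)).trans ?_
  exact (heq_of_eq (congrArg (T.symm.het (𝟙 I)) (T.unitMap_map g))).trans (T.symmHet_het _ _)

theorem symm_functor_functor (I : FintypeCat.{0}) :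
    T.symm.hom I ≫ T.hom I = 𝟙 (M'.fam I) := by
  refine Cat.ext (Functor.hext (fun X => (T.obj I).apply_symm_apply X) fun X Y g => ?_)
  refine heq_of_unitMap_heq ((T.obj I).apply_symm_apply X) ((T.obj I).apply_symm_apply Y) ?_
  refine (heq_of_eq (T.unitMap_map _)).trans ?_
  exact (heq_of_eq (congrArg (T.het (𝟙 I)) (T.symm.unitMap_map g))).trans (T.het_symmHet _ _)

/-- The isomorphism of lax double functors. -/
noncomputable def toIso : LaxDoubleFunctor.Iso M.toLaxDoubleFunctor M'.toLaxDoubleFunctor where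
  hom := T.trans
  inv := T.symm.trans
  app_hom_inv I := T.functor_symm_functor I.unop
  app_inv_hom I := T.symm_functor_functor I.unop
  sq_hom_inv _ := Cell.ext_heq (T.functor_symm_functor _) (T.functor_symm_functor _)
    fun _ _ φ => T.symmHet_het _ φ
  sq_inv_hom _ := Cell.ext_heq (T.symm_functor_functor _) (T.symm_functor_functor _)
    fun _ _ φ => T.het_symmHet _ φ

end ElementIso

end DFOperad

/-- The inverse cell lands over the doubly transported objects, equal to `X` and `Y` only
propositionally; hence the cast in the proof of surjectivity. -/
theorem Prof.Cell.app_bijective {C D C' D' : Cat.{u, u}} {Φ : Prof C D} {Ψ : Prof C' D'}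
    {α : Cell Φ Ψ} {β : Cell Ψ Φ} (h : Cell.hcomp α β = Cell.hid Φ)
    (h' : Cell.hcomp β α = Cell.hid Ψ) (X : C) (Y : D) :
    Function.Bijective fun φ : Het Φ X Y => α.app φ := by
  have hX : β.left.toFunctor.obj (α.left.toFunctor.obj X) = X :=
    congrArg (fun γ : Cell Φ Φ => γ.left.toFunctor.obj X) h
  have hY : β.right.toFunctor.obj (α.right.toFunctor.obj Y) = Y :=
    congrArg (fun γ : Cell Φ Φ => γ.right.toFunctor.obj Y) h
  constructor
  · intro φ φ' hφ
    exact eq_of_heq ((Cell.app_congr h φ).symm.trans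
      ((heq_of_eq (congrArg β.app hφ)).trans (Cell.app_congr h φ')))
  · intro ψ
    have e : Het Φ (β.left.toFunctor.obj (α.left.toFunctor.obj X))
        (β.right.toFunctor.obj (α.right.toFunctor.obj Y)) = Het Φ X Y := by rw [hX, hY]
    exact ⟨cast e (β.app ψ), eq_of_heq ((Cell.app_heq α hX.symm hY.symm (cast_heq e _)).trans
      (Cell.app_congr h' ψ))⟩

/-! ### Elementwise isomorphisms from isomorphisms of lax double functors -/

namespace DFOperad

variable {I J K L : FintypeCat.{0}}

namespace ElementIso

section

variable {M M' : DFOperad.{u}}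
  (Φ : LaxDoubleFunctor.Iso M.toLaxDoubleFunctor M'.toLaxDoubleFunctor)

/-- The functors of an isomorphism of lax double functors. -/
def isoHom (I : FintypeCat.{0}) : M.fam I ⟶ M'.fam I := Φ.hom.app (op I)

/-- The cells of an isomorphism of lax double functors. -/
def isoCell (f : I ⟶ J) : Cell (M.prof f) (M'.prof f) := Φ.hom.sq (I := op I) (J := op J) f

theorem isoCell_left (f : I ⟶ J) : (isoCell Φ f).left = isoHom Φ I :=
  Φ.hom.left_sq (I := op I) (J := op J) f

theorem isoCell_right (f : I ⟶ J) : (isoCell Φ f).right = isoHom Φ J :=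
  Φ.hom.right_sq (I := op I) (J := op J) f

/-- The bijections on elements of an isomorphism of lax double functors. -/
noncomputable def isoHet (f : I ⟶ J) (X : M.fam I) (Y : M.fam J) : Het (M.prof f) X Y ≃
    Het (M'.prof f) ((isoHom Φ I).toFunctor.obj X) ((isoHom Φ J).toFunctor.obj Y) :=
  (Equiv.ofBijective (fun φ : Het (M.prof f) X Y => (isoCell Φ f).app φ) (Cell.app_bijective
    (Φ.sq_hom_inv (I := op I) (J := op J) f) (Φ.sq_inv_hom (I := op I) (J := op J) f) X Y)).trans
    (Equiv.cast (by rw [isoCell_left, isoCell_right]))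

theorem isoHet_heq (f : I ⟶ J) {X : M.fam I} {Y : M.fam J} (φ : Het (M.prof f) X Y) :
    HEq (isoHet Φ f X Y φ) ((isoCell Φ f).app φ) :=
  cast_heq _ _

theorem isoHom_reindex (l : I ⟶ L) (X : M.fam L) :
    (isoHom Φ I).toFunctor.obj ((M.reindex l).toFunctor.obj X) =
      (M'.reindex l).toFunctor.obj ((isoHom Φ L).toFunctor.obj X) :=
  congrArg (fun F => F.toFunctor.obj X) (Φ.hom.app_natural l.op)

/-- The isomorphism in terms of elements of an isomorphism of lax double functors. -/
noncomputable def ofIso : ElementIso M M' where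
  obj I :=
    { toFun := fun X => (isoHom Φ I).toFunctor.obj X
      invFun := fun X => (Φ.inv.app (op I)).toFunctor.obj X
      left_inv := fun X => congrArg (fun F => F.toFunctor.obj X) (Φ.app_hom_inv (op I))
      right_inv := fun X => congrArg (fun F => F.toFunctor.obj X) (Φ.app_inv_hom (op I)) }
  obj_reindex l X := isoHom_reindex Φ l X
  het {_ _} f {X Y} := isoHet Φ f X Y
  het_cell {I J L K f g} s X Y X' Y' hX hY hX' hY' φ := by
    refine eq_of_heq ((isoHet_heq Φ f _).trans (HEq.trans ?_ (cell_heq s hX' hY' _).symm))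
    refine (Cell.app_heq (isoCell Φ f) ?_ ?_ (cell_heq s hX hY φ)).trans ((Cell.app_congr
      (Φ.hom.sq_natural (I := op L) (J := op K) (L := op I) (K := op J) (f := g) (g := f) s)
      φ).trans (Cell.app_heq (M'.sqCell s) ?_ ?_ (isoHet_heq Φ g φ).symm))
    · exact (reindex_eq hX).symm.trans
        (congrArg (fun F => F.toFunctor.obj X) (M.sqCell_left s)).symm
    · exact (reindex_eq hY).symm.trans
        (congrArg (fun F => F.toFunctor.obj Y) (M.sqCell_right s)).symm
    · exact congrArg (fun F => F.toFunctor.obj X) (isoCell_left Φ g)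
    · exact congrArg (fun F => F.toFunctor.obj Y) (isoCell_right Φ g)
  het_unitEl {I} X := by
    refine eq_of_heq ((isoHet_heq Φ (𝟙 I) _).trans (HEq.trans ?_ (unitMap_heq _).symm))
    refine (Cell.app_heq (isoCell Φ (𝟙 I)) ?_ ?_ (unitMap_heq (𝟙 X))).trans
      ((Cell.app_congr (Φ.hom.unit_sq (op I)) (𝟙 X : X ⟶ X)).trans (heq_of_eq ?_))
    · exact (congrArg (fun F => F.toFunctor.obj X) (M.unitCell_left I)).symm
    · exact (congrArg (fun F => F.toFunctor.obj X) (M.unitCell_right I)).symm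
    · exact congrArg (M'.unitCell I).app ((isoHom Φ I).toFunctor.map_id X)
  het_cmp {I J K f g h} e X Y Z φ ψ := by
    subst e
    refine eq_of_heq ((isoHet_heq Φ (f ≫ g) _).trans ?_)
    refine (Cell.app_heq (isoCell Φ (f ≫ g)) ?_ ?_
      (compCell_heq rfl rfl rfl rfl HEq.rfl HEq.rfl).symm).trans ((Cell.app_congr
      (Φ.hom.comp_sq (I := op I) (J := op J) (K := op K) f g) (tmul _ _ φ ψ)).trans
      (compCell_heq rfl ?_ ?_ ?_ (isoHet_heq Φ f φ).symm
        ((pre_eqToHom_heq _ _ _).trans (isoHet_heq Φ g ψ).symm)))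
    · exact (congrArg (fun F => F.toFunctor.obj X) (M.compCell_left f g)).symm
    · exact (congrArg (fun F => F.toFunctor.obj Z) (M.compCell_right f g)).symm
    · exact congrArg (fun F => F.toFunctor.obj X) (isoCell_left Φ f)
    · exact congrArg (fun F => F.toFunctor.obj Y) (isoCell_right Φ f)
    · exact congrArg (fun F => F.toFunctor.obj Z) (isoCell_right Φ g)

end

end ElementIso

end DFOperad

/-! ## Transport of operations -/

namespace Operad

variable (N : Operad.{u})

theorem relabel_heq {m n : ℕ} (σ : Fin m ≃ Fin n) {A₁ A₂ : Fin n → N.Col} {A₁' A₂' : Fin m → N.Col}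
    {B₁ B₂ B₁' B₂' : N.Col} (hA₁ : ∀ p, A₁' p = A₁ (σ p)) (hB₁ : B₁' = B₁)
    (hA₂ : ∀ p, A₂' p = A₂ (σ p)) (hB₂ : B₂' = B₂) (hA : A₁ = A₂) (hB : B₁ = B₂)
    {θ₁ : N.Op A₁ B₁} {θ₂ : N.Op A₂ B₂} (h : HEq θ₁ θ₂) :
    HEq (N.relabel σ hA₁ hB₁ θ₁) (N.relabel σ hA₂ hB₂ θ₂) := by
  subst hA hB hB₁ hB₂
  obtain rfl : A₁' = A₂' := funext fun p => (hA₁ p).trans (hA₂ p).symm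
  obtain rfl := eq_of_heq h
  rfl

theorem one_heq {A B : N.Col} (h : A = B) : HEq (N.one A) (N.one B) := by
  subst h
  rfl

theorem comp_heq {n : ℕ} {k : Fin n → ℕ} {B B' : Fin n → N.Col} {C C' : N.Col}
    {A A' : ∀ i, Fin (k i) → N.Col} (hB : B = B') (hC : C = C') (hA : ∀ i, A i = A' i)
    {θ : N.Op B C} {θ' : N.Op B' C'} {φ : ∀ i, N.Op (A i) (B i)} {φ' : ∀ i, N.Op (A' i) (B' i)}
    (hθ : HEq θ θ') (hφ : ∀ i, HEq (φ i) (φ' i)) : HEq (N.comp θ φ) (N.comp θ' φ') := by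
  subst hB hC
  obtain rfl : A = A' := funext hA
  obtain rfl := eq_of_heq hθ
  obtain rfl : φ = φ' := funext fun i => eq_of_heq (hφ i)
  rfl

variable {N} {N' : Operad.{u}} (i : Operad.Iso N N')

theorem Iso.op_relabel {m n : ℕ} (σ : Fin m ≃ Fin n) {A : Fin n → N.Col} {A' : Fin m → N.Col}
    {B B' : N.Col} (hA : ∀ p, A' p = A (σ p)) (hB : B' = B) (θ : N.Op A B) :
    i.op (N.relabel σ hA hB θ) =
      N'.relabel σ (fun p => congrArg i.col (hA p)) (congrArg i.col hB) (i.op θ) := by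
  obtain rfl : m = n := by simpa using Fintype.card_congr σ
  obtain rfl : A' = A ∘ σ := funext hA
  subst hB
  exact i.op_act σ θ

end Operad

/-! ### Colours and restrictions in a non-skeletal form -/

namespace NonSkeletalForm

open DFOperad

variable {N : Operad.{u}} {M : DFOperad.{u}} (h : NonSkeletalForm N M)
  {I J K L : FintypeCat.{0}}

theorem obj_eq {l : I ⟶ L} {X : M.fam L} {X' : M.fam I} (hX : ∀ i, col X' i = col X (l i))
    (i : I) : h.obj I X' i = h.obj L X (l i) := by
  rw [← reindex_eq hX, h.obj_reindex]

theorem obj_ext {X Y : M.fam I} (e : ∀ i, h.obj I X i = h.obj I Y i) : X = Y :=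
  (h.obj I).injective (funext e)

/-- Converse of `obj_eq`: `h.obj` and `col` both determine an object and commute with reindexing, so
they detect the same equations. -/
theorem col_eq {l : I ⟶ L} {X : M.fam L} {X' : M.fam I}
    (hX : ∀ i, h.obj I X' i = h.obj L X (l i)) (i : I) : col X' i = col X (l i) := by
  have : X' = (M.reindex l).toFunctor.obj X := h.obj_ext fun i =>
    (hX i).trans (h.obj_reindex l X i).symm
  rw [this, col_reindex]

theorem ops_cell' {f : I ⟶ J} {g : L ⟶ K} (s : PbSq f g)
    (E : FibreEnum f) (E' : FibreEnum g) {X : M.fam L} {Y : M.fam K} {X' : M.fam I}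
    {Y' : M.fam J} (hX : ∀ i, col X' i = col X (s.left i)) (hY : ∀ j, col Y' j = col Y (s.right j))
    (φ : Het (M.prof g) X Y) (j : J) (σ : Fin (E.card j) ≃ Fin (E'.card (s.right j)))
    (hσ : ∀ p, s.left (E.idx j p).1 = (E'.idx (s.right j) (σ p)).1) :
    h.ops E (cell s hX hY φ) j = N.relabel σ
      (fun p => (h.obj_eq hX _).trans (congrArg (h.obj L X) (hσ p))) (h.obj_eq hY j)
      (h.ops E' φ (s.right j)) := by
  obtain rfl := reindex_eq hX
  obtain rfl := reindex_eq hY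
  exact h.ops_cell s E E' φ j σ hσ

theorem ops_heq {f : I ⟶ J} (E : FibreEnum f) {X X' : M.fam I} {Y Y' : M.fam J} (hX : X = X')
    (hY : Y = Y') {φ : Het (M.prof f) X Y} {φ' : Het (M.prof f) X' Y'} (e : HEq φ φ') (j : J) :
    HEq (h.ops E φ j) (h.ops E φ' j) := by
  subst hX hY
  obtain rfl := eq_of_heq e
  rfl

end NonSkeletalForm

namespace NonSkeletalForm

open DFOperad

variable {N N' : Operad.{u}} {M M' : DFOperad.{u}} (h : NonSkeletalForm N M)
  (h' : NonSkeletalForm N' M') {I J K L : FintypeCat.{0}}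

/-! ## Isomorphisms of DF operads from isomorphisms of operads -/

section

variable (i : Operad.Iso N N')

/-- The bijections on objects given by a bijection of colours. -/
def mapObj (I : FintypeCat.{0}) : M.fam I ≃ M'.fam I :=
  (h.obj I).trans ((Equiv.piCongrRight fun _ => i.col).trans (h'.obj I).symm)

theorem obj_mapObj (X : M.fam I) (x : I) :
    h'.obj I (h.mapObj h' i I X) x = i.col (h.obj I X x) :=
  congrFun ((h'.obj I).apply_symm_apply _) x

/-- The bijections on elements given by an isomorphism of operads. -/
noncomputable def mapHet (f : I ⟶ J) (X : M.fam I) (Y : M.fam J) :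
    Het (M.prof f) X Y ≃ Het (M'.prof f) (h.mapObj h' i I X) (h.mapObj h' i J Y) :=
  (h.ops (FibreEnum.std f)).trans ((Equiv.piCongrRight fun j => i.op.trans (Equiv.cast (by
    rw [h.obj_mapObj h' i Y j]
    exact congrArg (N'.Op · _) (funext fun p => (h.obj_mapObj h' i X _).symm)))).trans
    (h'.ops (FibreEnum.std f)).symm)

theorem ops_mapHet (f : I ⟶ J) {X : M.fam I} {Y : M.fam J} (φ : Het (M.prof f) X Y) (j : J) :
    HEq (h'.ops (FibreEnum.std f) (h.mapHet h' i f X Y φ) j)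
      (i.op (h.ops (FibreEnum.std f) φ j)) :=
  (heq_of_eq (congrFun ((h'.ops (FibreEnum.std f)).apply_symm_apply _) j)).trans (cast_heq _ _)

/-- The isomorphism of DF operads given by an isomorphism of operads. -/
noncomputable def elementIso : ElementIso M M' where
  obj I := h.mapObj h' i I
  obj_reindex l X := h'.obj_ext fun x => by
    rw [obj_mapObj, h.obj_reindex, h'.obj_reindex, obj_mapObj]
  het {_ _} f {X Y} := h.mapHet h' i f X Y
  het_cell {I J L K f g} s X Y X' Y' hX hY hX' hY' φ := by
    refine (h'.ops (FibreEnum.std f)).injective (funext fun j => eq_of_heq ?_)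
    refine (h.ops_mapHet h' i f _ j).trans ?_
    -- Standard enumerations are used on both sides, so both actions are relabellings by the same
    -- bijection, with which the isomorphism of operads commutes.
    rw [h.ops_cell' s _ (FibreEnum.std g) hX hY φ j (s.idx _ _ j) (s.idx_spec _ _ j),
      h'.ops_cell' s _ (FibreEnum.std g) hX' hY' _ j (s.idx _ _ j) (s.idx_spec _ _ j),
      i.op_relabel]
    exact N'.relabel_heq _ _ _ _ _ (funext fun p => (h.obj_mapObj h' i X _).symm)
      (h.obj_mapObj h' i Y _).symm (h.ops_mapHet h' i g φ _).symm
  het_unitEl {I} X := by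
    refine (h'.ops (FibreEnum.std (𝟙 I))).injective (funext fun x => eq_of_heq ?_)
    refine (h.ops_mapHet h' i _ _ x).trans ?_
    have h1 := h.ops_unit (FibreEnum.std (𝟙 I)) X x (finCongr (Operad.card_fibre_id _ x))
    have h2 := h'.ops_unit (FibreEnum.std (𝟙 I)) (h.mapObj h' i I X) x
      (finCongr (Operad.card_fibre_id _ x))
    refine (heq_of_eq (congrArg i.op h1)).trans (HEq.trans ?_ (heq_of_eq h2).symm)
    refine (heq_of_eq (i.op_relabel _ _ _ _)).trans ?_
    exact N'.relabel_heq _ _ _ _ _ (funext fun _ => (h.obj_mapObj h' i X _).symm)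
      (h.obj_mapObj h' i X _).symm
      ((heq_of_eq (i.op_one _)).trans (N'.one_heq (h.obj_mapObj h' i X _).symm))
  het_cmp {I J K f g gf} e X Y Z φ ψ := by
    subst e
    refine (h'.ops (FibreEnum.std (f ≫ g))).injective (funext fun k => eq_of_heq ?_)
    refine (h.ops_mapHet h' i _ _ k).trans ?_
    have h1 := h.ops_comp (FibreEnum.std f) (FibreEnum.std g) (FibreEnum.std (f ≫ g)) φ ψ k
      (FibreEnum.compIdx _ _ _ rfl k) (FibreEnum.compIdx_spec _ _ _ rfl k)
    have h2 := h'.ops_comp (FibreEnum.std f) (FibreEnum.std g) (FibreEnum.std (f ≫ g))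
      (h.mapHet h' i f X Y φ) (h.mapHet h' i g Y Z ψ) k
      (FibreEnum.compIdx _ _ _ rfl k) (FibreEnum.compIdx_spec _ _ _ rfl k)
    refine (heq_of_eq (congrArg i.op h1)).trans (HEq.trans ?_ (heq_of_eq h2).symm)
    refine (heq_of_eq (i.op_relabel _ _ _ _)).trans ?_
    refine N'.relabel_heq _ _ _ _ _ ?_ (h.obj_mapObj h' i Z _).symm ?_
    · exact funext fun _ => (h.obj_mapObj h' i X _).symm
    · exact (heq_of_eq (i.op_comp _ _)).trans (N'.comp_heq
        (funext fun q => (h.obj_mapObj h' i Y _).symm) (h.obj_mapObj h' i Z _).symm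
        (fun q => funext fun p => (h.obj_mapObj h' i X _).symm)
        (h.ops_mapHet h' i g ψ k).symm fun q => (h.ops_mapHet h' i f φ _).symm)

end

/-! ## Isomorphisms of operads from isomorphisms of DF operads -/

section

/-- The enumeration of the only fibre of a mapping to the point. -/
def ptEnum (n : ℕ) : FibreEnum (toPt (fin n)) where
  card _ := n
  idx _ := (Equiv.subtypeUnivEquiv fun _ => rfl).symm

/-- The object given by a sequence of colours. -/
def seqObj {n : ℕ} (A : Fin n → N.Col) : M.fam (fin n) := (h.obj (fin n)).symm A

/-- The object given by a colour. -/
def ptObj (B : N.Col) : M.fam pt := (h.obj pt).symm fun _ => B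

theorem obj_seqObj {n : ℕ} (A : Fin n → N.Col) (p : Fin n) : h.obj (fin n) (h.seqObj A) p = A p :=
  congrFun ((h.obj (fin n)).apply_symm_apply A) p

theorem obj_ptObj (B : N.Col) (p : pt) : h.obj pt (h.ptObj B) p = B :=
  congrFun ((h.obj pt).apply_symm_apply fun _ => B) p

/-- Operations as elements. -/
noncomputable def opEquiv {n : ℕ} (A : Fin n → N.Col) (B : N.Col) :
    Het (M.prof (toPt (fin n))) (h.seqObj A) (h.ptObj B) ≃ N.Op A B :=
  (h.ops (ptEnum n)).trans ((Equiv.piUnique _).trans (Equiv.cast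
    (congrArg₂ N.Op (funext fun p => h.obj_seqObj A p) (h.obj_ptObj B _))))

theorem opEquiv_heq {n : ℕ} {A : Fin n → N.Col} {B : N.Col}
    (φ : Het (M.prof (toPt (fin n))) (h.seqObj A) (h.ptObj B)) :
    HEq (h.opEquiv A B φ) (h.ops (ptEnum n) φ ()) :=
  cast_heq _ _

variable (T : ElementIso M M')

/-- The bijection of colours. -/
def mapCol : N.Col ≃ N'.Col :=
  (Equiv.funUnique Unit N.Col).symm.trans ((h.obj pt).symm.trans ((T.obj pt).trans
    ((h'.obj pt).trans (Equiv.funUnique Unit N'.Col))))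

theorem mapCol_eq (B : N.Col) : h.mapCol h' T B = h'.obj pt (T.obj pt (h.ptObj B)) () := rfl

/-- `T` commutes with reindexing along points, so its effect on an object is determined colour by
colour. -/
theorem obj_obj (X : M.fam I) (x : I) :
    h'.obj I (T.obj I X) x = h.mapCol h' T (h.obj I X x) := by
  have h1 := h'.obj_reindex (point x) (T.obj I X) ()
  have h2 : h.ptObj (h.obj I X x) = (M.reindex (point x)).toFunctor.obj X :=
    h.obj_ext fun p => (h.obj_ptObj _ p).trans (h.obj_reindex (point x) X p).symm
  rw [mapCol_eq, h2, T.obj_reindex, h1]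
  rfl

theorem obj_seqObj_map {n : ℕ} (A : Fin n → N.Col) :
    h'.seqObj (h.mapCol h' T ∘ A) = T.obj (fin n) (h.seqObj A) :=
  h'.obj_ext fun p => by
    rw [obj_seqObj, h.obj_obj h' T, obj_seqObj]
    rfl

theorem obj_ptObj_map (B : N.Col) : h'.ptObj (h.mapCol h' T B) = T.obj pt (h.ptObj B) :=
  h'.obj_ext fun p => by
    rw [obj_ptObj, h.obj_obj h' T, obj_ptObj]

/-- The bijection of operations. -/
noncomputable def mapOp {n : ℕ} (A : Fin n → N.Col) (B : N.Col) :
    N.Op A B ≃ N'.Op (h.mapCol h' T ∘ A) (h.mapCol h' T B) :=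
  (h.opEquiv A B).symm.trans ((T.het _).trans ((Equiv.cast (by
    rw [obj_seqObj_map, obj_ptObj_map])).trans (h'.opEquiv _ _)))

theorem mapOp_opEquiv {n : ℕ} {A : Fin n → N.Col} {B : N.Col}
    (φ : Het (M.prof (toPt (fin n))) (h.seqObj A) (h.ptObj B)) :
    HEq (h.mapOp h' T A B (h.opEquiv A B φ)) (h'.ops (ptEnum n) (T.het _ φ) ()) := by
  simp only [mapOp, Equiv.trans_apply, Equiv.symm_apply_apply]
  refine (h'.opEquiv_heq _).trans ?_
  exact h'.ops_heq _ (h.obj_seqObj_map h' T A) (h.obj_ptObj_map h' T B) (cast_heq _ _) ()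

theorem mapOp_heq {n : ℕ} {A A' : Fin n → N.Col} {B B' : N.Col} (hA : A = A') (hB : B = B')
    {θ : N.Op A B} {θ' : N.Op A' B'} (e : HEq θ θ') :
    HEq (h.mapOp h' T A B θ) (h.mapOp h' T A' B' θ') := by
  subst hA hB
  obtain rfl := eq_of_heq e
  rfl

/-- Restriction to the fibre square at `j` reduces to a mapping to the point, where `mapOp` is
defined. `T` commutes with this restriction, and with matching enumerations the relabellings are
trivial. -/
theorem ops_het {f : I ⟶ J} (E : FibreEnum f) {X : M.fam I} {Y : M.fam J}
    (φ : Het (M.prof f) X Y) (j : J) :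
    HEq (h'.ops E (T.het f φ) j) (h.mapOp h' T _ _ (h.ops E φ j)) := by
  have hX := h.col_eq (l := (fibreSq E j).left) (X := X)
    (X' := h.seqObj fun p => h.obj I X (E.idx j p).1) fun p => h.obj_seqObj _ p
  have hY := h.col_eq (l := (fibreSq E j).right) (X := Y)
    (X' := h.ptObj (h.obj J Y j)) fun p => h.obj_ptObj _ p
  have h1 : HEq (h.opEquiv _ _ (cell (fibreSq E j) hX hY φ)) (h.ops E φ j) := by
    refine (h.opEquiv_heq _).trans ?_
    rw [h.ops_cell' (fibreSq E j) (ptEnum _) E hX hY φ () (Equiv.refl _) fun _ => rfl]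
    exact N.relabel_refl _ _ _
  have h2 := h.mapOp_heq h' T rfl rfl h1
  refine HEq.trans ?_ ((h.mapOp_opEquiv h' T _).symm.trans h2)
  rw [T.het_cell (fibreSq E j) hX hY (T.col_obj hX) (T.col_obj hY),
    h'.ops_cell' (fibreSq E j) (ptEnum _) E _ _ _ () (Equiv.refl _) fun _ => rfl]
  exact (N'.relabel_refl _ _ _).symm

/-- The isomorphism of operads given by an isomorphism of DF operads. -/
noncomputable def operadIso : Operad.Iso N N' where
  col := h.mapCol h' T
  op {n A B} := h.mapOp h' T A B
  op_one A := by
    -- The single fibre is given cardinality literally `1`, so that the relabelling in `ops_unit` is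
    -- the trivial one.
    let E : FibreEnum (𝟙 DFOperad.pt) := ⟨fun _ => 1, fun _ => (Equiv.ofUnique (Fin 1) Unit).trans
      (Equiv.subtypeUnivEquiv fun _ => Subsingleton.elim _ _).symm⟩
    have h1 : HEq (h.ops E (M.unitEl (h.ptObj A)) ()) (N.one A) := by
      rw [h.ops_unit E _ () (Equiv.refl _)]
      exact (N.relabel_refl _ _ _).trans (N.one_heq (h.obj_ptObj A _))
    have h2 := h.ops_het h' T E (M.unitEl (h.ptObj A)) ()
    rw [T.het_unitEl, h'.ops_unit E _ () (Equiv.refl _)] at h2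
    exact eq_of_heq ((h.mapOp_heq h' T (funext fun _ => (h.obj_ptObj A _).symm)
      (h.obj_ptObj A _).symm h1.symm).trans (h2.symm.trans (N'.relabel_refl _ _ _)))
  op_act {n A B} σ θ := by
    obtain ⟨φ, rfl⟩ := (h.opEquiv A B).surjective θ
    have hX := h.col_eq (l := (permSq σ).left) (X := h.seqObj A) (X' := h.seqObj (A ∘ σ))
      fun p => (h.obj_seqObj _ p).trans (h.obj_seqObj A (σ p)).symm
    have hY := h.col_eq (l := (permSq σ).right) (X := h.ptObj B) (X' := h.ptObj B) fun _ => rfl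
    have h1 : h.opEquiv (A ∘ σ) B (cell (permSq σ) hX hY φ) = N.act σ (h.opEquiv A B φ) := by
      refine eq_of_heq ((h.opEquiv_heq _).trans ?_)
      rw [h.ops_cell' (permSq σ) (ptEnum _) (ptEnum _) hX hY φ () σ fun _ => rfl,
        ← N.relabel_eq_act]
      exact N.relabel_heq σ _ _ _ _ (funext fun p => h.obj_seqObj A p) (h.obj_ptObj B _)
        (h.opEquiv_heq φ).symm
    rw [← h1]
    refine eq_of_heq ((h.mapOp_opEquiv h' T _).trans ?_)
    rw [T.het_cell (permSq σ) hX hY (T.col_obj hX) (T.col_obj hY),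
      h'.ops_cell' (permSq σ) (ptEnum _) (ptEnum _) _ _ _ () σ fun _ => rfl, ← N'.relabel_eq_act]
    refine N'.relabel_heq σ _ _ _ _ ?_ ?_ (h.mapOp_opEquiv h' T φ).symm
    · exact funext fun p => (h.obj_obj h' T _ _).trans (congrArg _ (h.obj_seqObj A p))
    · rfl
  op_comp {n B C k A} θ φ := by
    obtain ⟨θ, rfl⟩ := (h.opEquiv B C).surjective θ
    -- The inner operations are realised by one element over the projection onto blocks, so that the
    -- laxity cell computes the operadic composite.
    obtain ⟨Ψ, hΨ⟩ : ∃ Ψ : Het (M.prof (block k)) (h.seqObj (concat A)) (h.seqObj B),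
        ∀ i, HEq (h.ops (blockEnum k) Ψ i) (φ i) := by
      have e (i) : N.Op (A i) (B i) = N.Op (fun p => h.obj _ (h.seqObj (concat A))
          ((blockEnum k).idx i p).1) (h.obj _ (h.seqObj B) i) :=
        congrArg₂ N.Op (funext fun p => (concat_finSigma A ⟨i, p⟩).symm.trans
          (h.obj_seqObj (concat A) _).symm) (h.obj_seqObj B i).symm
      refine ⟨(h.ops (blockEnum k)).symm fun i => cast (e i) (φ i), fun i => ?_⟩
      rw [Equiv.apply_symm_apply]
      exact cast_heq _ _
    -- Concatenating the block enumerations gives the standard enumeration of `Fin (∑ i, k i)`,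
    -- hence the identity bijection.
    have h1 := h.ops_comp (blockEnum k) (ptEnum n) (ptEnum (∑ i, k i)) Ψ θ ()
      (Equiv.refl (Fin (∑ i, k i))) fun p => (finSigmaFinEquiv.apply_symm_apply p).symm
    have h2 := h'.ops_comp (blockEnum k) (ptEnum n) (ptEnum (∑ i, k i)) (T.het _ Ψ) (T.het _ θ) ()
      (Equiv.refl (Fin (∑ i, k i))) fun p => (finSigmaFinEquiv.apply_symm_apply p).symm
    have h3 : HEq (h.opEquiv _ _ (cmp (block_toPt k) Ψ θ)) (N.comp (h.opEquiv B C θ) φ) := by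
      refine (h.opEquiv_heq _).trans ((heq_of_eq h1).trans ((N.relabel_refl _ _ _).trans ?_))
      exact N.comp_heq (funext fun p => h.obj_seqObj B p) (h.obj_ptObj C _)
        (fun i => funext fun p => (h.obj_seqObj (concat A) _).trans (concat_finSigma A ⟨i, p⟩))
        (h.opEquiv_heq θ).symm hΨ
    refine eq_of_heq ((h.mapOp_heq h' T rfl rfl h3.symm).trans
      ((h.mapOp_opEquiv h' T _).trans ?_))
    rw [T.het_cmp]
    refine (heq_of_eq h2).trans ((N'.relabel_refl _ _ _).trans ?_)
    refine N'.comp_heq ?_ rfl (fun i => ?_) (h.mapOp_opEquiv h' T θ).symm fun i =>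
      (h.ops_het h' T (blockEnum k) Ψ i).trans (h.mapOp_heq h' T ?_ ?_ (hΨ i))
    · exact funext fun p => (h.obj_obj h' T _ _).trans (congrArg _ (h.obj_seqObj B p))
    · exact funext fun p => (h.obj_obj h' T _ _).trans (congrArg _
        ((h.obj_seqObj (concat A) _).trans (concat_finSigma A ⟨i, p⟩)))
    · exact funext fun p => (h.obj_seqObj (concat A) _).trans (concat_finSigma A ⟨i, p⟩)
    · exact h.obj_seqObj B i

end

end NonSkeletalForm

/-- Isomorphism of operads is isomorphism of their non-skeletal forms. -/
theorem NonSkeletalForm.nonempty_iso_iff {N N' : Operad.{u}} {M M' : DFOperad.{u}}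
    (h : NonSkeletalForm N M) (h' : NonSkeletalForm N' M') : Nonempty (Operad.Iso N N') ↔
      Nonempty (LaxDoubleFunctor.Iso M.toLaxDoubleFunctor M'.toLaxDoubleFunctor) :=
  ⟨fun ⟨i⟩ => ⟨(h.elementIso h' i).toIso⟩,
    fun ⟨Φ⟩ => ⟨h.operadIso h' (DFOperad.ElementIso.ofIso Φ)⟩⟩

/-- The identity isomorphism. -/
def Operad.Iso.refl (N : Operad.{u}) : Operad.Iso N N where
  col := Equiv.refl _
  op := Equiv.refl _
  op_one _ := rfl
  op_comp _ _ := rfl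
  op_act _ _ := rfl

theorem mainTheorem1 :
    ∃ (toDF : Operad.{u} → DFOperad.{u}) (toOp : DFOperad.{u} → Operad.{u}),
      (∀ N : Operad.{u}, Nonempty (NonSkeletalForm N (toDF N))) ∧
      (∀ M : DFOperad.{u}, Nonempty (NonSkeletalForm (toOp M) M)) ∧
      (∀ M : DFOperad.{u}, Nonempty (LaxDoubleFunctor.Iso
        (toDF (toOp M)).toLaxDoubleFunctor M.toLaxDoubleFunctor)) ∧
      (∀ N : Operad.{u}, Nonempty (Operad.Iso (toOp (toDF N)) N)) ∧
      (∀ (N N' : Operad.{u}) (M M' : DFOperad.{u}), Nonempty (NonSkeletalForm N M) →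
        Nonempty (NonSkeletalForm N' M') →
        (Nonempty (Operad.Iso N N') ↔
          Nonempty (LaxDoubleFunctor.Iso M.toLaxDoubleFunctor M'.toLaxDoubleFunctor))) :=
  ⟨Operad.toDFOperad, DFOperad.toOperad, fun N => ⟨N.nonSkeletalForm⟩, fun M => ⟨M.nonSkeletalForm⟩,
    -- Both DF operads are non-skeletal forms of `M.toOperad`.
    fun M => (M.toOperad.nonSkeletalForm.nonempty_iso_iff M.nonSkeletalForm).1
      ⟨Operad.Iso.refl _⟩,
    -- One DF operad is the non-skeletal form of both operads; its identity isomorphism induces the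
    -- required one.
    fun N => ⟨N.toDFOperad.nonSkeletalForm.operadIso N.nonSkeletalForm
      { obj := fun _ => Equiv.refl _
        obj_reindex := fun _ _ => rfl
        het := fun _ => Equiv.refl _
        het_cell := fun _ _ _ _ _ _ _ _ _ _ => rfl
        het_unitEl := fun _ => rfl
        het_cmp := fun _ _ _ _ _ _ => rfl }⟩,
    fun _ _ _ _ ⟨h⟩ ⟨h'⟩ => h.nonempty_iso_iff h'⟩
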